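/- **Setting.** Consider $\min_{x\in\mathbb R^p}\Phi(x):=f(x,y^*(x))$, $y^*(x)=\arg\min_{y\in\mathbb R^q}g(x,y)$, where $f(x,y)=\mathbb E_\xi F(x,y;\xi)$ and $g(x,y)=\mathbb E_\zeta G(x,y;\zeta)$. Assume, with $0<\mu\le L$ and $M,\tau,\rho\ge 0$, that for every sample $\xi,\zeta$: $G(x,\cdot;\zeta)$ is $\mu$-strongly convex; $F(x,\cdot;\xi)$ is $M$-Lipschitz; $\nabla_xF,\nabla_yF,\nabla_yG$ are $L$-Lipschitz in $(x,y)$; $\nabla_x\nabla_yG$ is $\tau$-Lipschitz and $\nabla_y^2G$ is $\rho$-Lipschitz in $(x,y)$. Assume also that the variances of $\nabla_xF$ and $\nabla_yF$ are at most $\sigma_f^2$, and those of $\nabla_yG$, $\nabla_x\nabla_yG$, $\nabla_y^2G$ are at most $\sigma_g^2,\sigma_{g,1}^2,\sigma_{g,2}^2$, uniformly in $(x,y)$ (operator norm for matrices). Put $\kappa=L/\mu$. **Algorithm (SSGD).** Given $x^0,y^0,v^0$, for $k=0,1,\dots$ set $$x^{k+1}=x^k-\alpha\big(\nabla_xF(x^k,y^k;\mathcal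 D_F)-\nabla_x\nabla_yG(x^k,y^k;\mathcal D_G)v^k\big);$$ starting from $y^{k+1,0}=y^k$, set $y^{k+1,t+1}=y^{k+1,t}-\beta\nabla_yG(x^{k+1},y^{k+1,t};\mathcal S_t)$ for $t<T$, and $y^{k+1}=y^{k+1,T}$; starting from $v^{k+1,0}=v^k$, set $v^{k+1,j+1}=(I-\eta\nabla_y^2G(x^{k+1},y^{k+1};\mathcal B_j))v^{k+1,j}+\eta\nabla_yF(x^{k+1},y^{k+1};\mathcal D_{F,j})$ for $j<J$, and $v^{k+1}=v^{k+1,J}$. A batch argument means the average over the batch; all batches consist of fresh independent samples; $\mathcal D_F,\mathcal D_{F,j}$ have size $D_f$, and $\mathcal D_G,\mathcal S_t,\mathcal B_j$ have sizes $D_g,S,D$ (all sizes at least $1$). **Theorem.** Let $\|v^0\|\le M/\mu$, $\Phi(x^0)-\inf\Phi\le\Delta$, $\|y^0-y^*(x^0)\|\le R$, and let $0<b<1$. There is $c_0>0$ depending only on $L,M,\tau,\rho,b$ such that for every $c_1\in(0,c_0]$ the following holds for all $T,J\ge1$ and all step sizes with $c_1\kappa^{-5}\le\alpha\le c_0\kappa^{-5}$,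 $b/L\le\beta\le 2/(\mu+L)$, $b/L\le\eta<1/L$. 1. $\Phi$ is differentiable, each $\|\nabla\Phi(x^k)\|^2$ is integrable, and for all $K\ge1$ $$\frac1K\sum_{k=0}^{K-1}\mathbb E\|\nabla\Phi(x^k)\|^2\le C\Big(\frac{\kappa^5}{K}+\kappa^2\frac{\sigma_f^2}{D_f}+\kappa^2\frac{\sigma_{g,1}^2}{D_g}+\kappa^8\frac{\sigma_g^2}{S}+\kappa^4\frac{\sigma_{g,2}^2}{D}\Big),$$ with $C$ depending only on $L,M,\tau,\rho,b,c_1,\Delta,R$ (not on $\mu$, the variances, the dimensions, $T$, $J$ or the batch sizes). 2. For every $\varepsilon\in(0,1]$ there are $K,D_f,D_g,S,D\ge 1$, depending only on $\varepsilon$, $\kappa$, the constants of part 1 and the variance bounds, such that $\mathbb E\|\nabla\Phi(\bar x)\|^2\le\varepsilon$ for $\bar x$ uniformly distributed on $x^0,\dots,x^{K-1}$, independently of the samples, while the $K$ outer iterations evaluate at most $C'\kappa^7\varepsilon^{-2}J$ sample gradients of $F$, $C'\kappa^{13}\varepsilon^{-2}T$ sample gradients of $G$, $C'\kappa^7\varepsilon^{-2}$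 Jacobian-vector products and $C'\kappa^9\varepsilon^{-2}J$ Hessian-vector products of $G$, in total at most $C'\kappa^{13}\varepsilon^{-2}\max\{T,J\}$, where $C'$ depends only on $L,M,\tau,\rho,b,c_1,\Delta,R,\sigma_f,\sigma_g,\sigma_{g,1},\sigma_{g,2}$. -/

import Mathlib

open MeasureTheory ProbabilityTheory

universe u v w

noncomputable section

namespace SSGD

/-- Euclidean space `ℝⁿ`. -/
abbrev Vec (n : ℕ) := EuclideanSpace ℝ (Fin n)

/-! ### Partial derivatives of a function of `(x, y)` -/

section Derivatives

variable {p q : ℕ}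

/-- The partial gradient `∇ₓ h(x, y)`. -/
def gradX (h : Vec p → Vec q → ℝ) (x : Vec p) (y : Vec q) : Vec p :=
  gradient (fun x' => h x' y) x

/-- The partial gradient `∇_y h(x, y)`. -/
def gradY (h : Vec p → Vec q → ℝ) (x : Vec p) (y : Vec q) : Vec q :=
  gradient (fun y' => h x y') y

/-- The partial Hessian `∇_y² h(x, y)`, as an operator on `ℝ^q`. -/
def hessYY (h : Vec p → Vec q → ℝ) (x : Vec p) (y : Vec q) : Vec q →L[ℝ] Vec q :=
  fderiv ℝ (fun y' => gradY h x y') y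

/-- The mixed derivative `∇ₓ∇_y h(x, y)`, the `p × q` matrix with entries `∂²h / ∂xᵢ∂yⱼ`, as an
operator from `ℝ^q` to `ℝ^p`: the transpose of the Jacobian of `x ↦ ∇_y h(x, y)`. -/
def mixedXY (h : Vec p → Vec q → ℝ) (x : Vec p) (y : Vec q) : Vec q →L[ℝ] Vec p :=
  ContinuousLinearMap.adjoint (fderiv ℝ (fun x' => gradY h x' y) x)

/-- `φ` is `c`-Lipschitz in `(x, y)`. The pair carries the norm `‖x‖ + ‖y‖`, which dominates the
Euclidean norm of `ℝ^(p+q)`, so every map that is `c`-Lipschitz for the latter qualifies. -/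
def LipXY {E : Type*} [NormedAddCommGroup E] (c : ℝ) (φ : Vec p → Vec q → E) : Prop :=
  ∀ x₁ x₂ y₁ y₂, ‖φ x₁ y₁ - φ x₂ y₂‖ ≤ c * (‖x₁ - x₂‖ + ‖y₁ - y₂‖)

end Derivatives

/-! ### The stochastic bilevel problem -/

/-- Data of the problem `min_x f(x, y*(x))`, `y*(x) = argmin_y g(x, y)` with
`f(x, y) = E_ξ F(x, y; ξ)` and `g(x, y) = E_ζ G(x, y; ζ)`. -/
structure Problem (p q : ℕ) (Ξ Z : Type*) [MeasurableSpace Ξ] [MeasurableSpace Z] where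
  F : Ξ → Vec p → Vec q → ℝ
  G : Z → Vec p → Vec q → ℝ
  /-- the distribution of `ξ` -/
  lawF : Measure Ξ
  /-- the distribution of `ζ` -/
  lawG : Measure Z
  probF : IsProbabilityMeasure lawF
  probG : IsProbabilityMeasure lawG

section Problem

variable {p q : ℕ} {Ξ Z : Type*} [MeasurableSpace Ξ] [MeasurableSpace Z]

/-- The upper level function `f(x, y) = E_ξ F(x, y; ξ)`. -/
def Problem.f (P : Problem p q Ξ Z) (x : Vec p) (y : Vec q) : ℝ := ∫ ξ, P.F ξ x y ∂P.lawF

/-- The lower level function `g(x, y) = E_ζ G(x, y; ζ)`. -/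
def Problem.g (P : Problem p q Ξ Z) (x : Vec p) (y : Vec q) : ℝ := ∫ ζ, P.G ζ x y ∂P.lawG

/-- The lower level solution `y*(x) = argmin_y g(x, y)`. -/
def Problem.yStar (P : Problem p q Ξ Z) (x : Vec p) : Vec q :=
  Classical.epsilon fun y => ∀ y', P.g x y ≤ P.g x y'

/-- The bilevel objective `Φ(x) = f(x, y*(x))`. -/
def Problem.Φ (P : Problem p q Ξ Z) (x : Vec p) : ℝ := P.f x (P.yStar x)

/-- `F(x, y; ·)` and `G(x, y; ·)` are measurable and have an expectation. -/
structure Problem.WellPosed (P : Problem p q Ξ Z) : Prop where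
  measurable_F : ∀ x y, Measurable fun ξ => P.F ξ x y
  measurable_G : ∀ x y, Measurable fun ζ => P.G ζ x y
  integrable_F : ∀ x y, Integrable (fun ξ => P.F ξ x y) P.lawF
  integrable_G : ∀ x y, Integrable (fun ζ => P.G ζ x y) P.lawG

/-- The lower level is `μ`-strongly convex in `y`, for every sample. -/
def Problem.StronglyConvex (P : Problem p q Ξ Z) (μ : ℝ) : Prop :=
  ∀ ζ x, StrongConvexOn Set.univ μ fun y => P.G ζ x y

/-- Smoothness, for every sample: `F` is `M`-Lipschitz in `y`; `∇F` and `∇_y G` are `L`-Lipschitz;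
`∇ₓ∇_y G` is `τ`-Lipschitz and `∇_y² G` is `ρ`-Lipschitz (in the operator norm). -/
structure Problem.Smooth (P : Problem p q Ξ Z) (L M τ ρ : ℝ) : Prop where
  differentiable_F : ∀ ξ, Differentiable ℝ fun z : Vec p × Vec q => P.F ξ z.1 z.2
  differentiable_G : ∀ ζ x, Differentiable ℝ fun y => P.G ζ x y
  differentiable_gradY_G : ∀ ζ, Differentiable ℝ fun z : Vec p × Vec q => gradY (P.G ζ) z.1 z.2
  lip_F : ∀ ξ x y₁ y₂, |P.F ξ x y₁ - P.F ξ x y₂| ≤ M * ‖y₁ - y₂‖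
  lip_gradX_F : ∀ ξ, LipXY L (gradX (P.F ξ))
  lip_gradY_F : ∀ ξ, LipXY L (gradY (P.F ξ))
  lip_gradY_G : ∀ ζ, LipXY L (gradY (P.G ζ))
  lip_mixedXY_G : ∀ ζ, LipXY τ (mixedXY (P.G ζ))
  lip_hessYY_G : ∀ ζ, LipXY ρ (hessYY (P.G ζ))

/-- The random element `A` satisfies `E ‖A - a‖² ≤ s²`. -/
def VarianceLE {S E : Type*} [MeasurableSpace S] [NormedAddCommGroup E]
    (P : Measure S) (A : S → E) (a : E) (s : ℝ) : Prop :=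
  Integrable (fun ω => ‖A ω - a‖ ^ 2) P ∧ ∫ ω, ‖A ω - a‖ ^ 2 ∂P ≤ s ^ 2

/-- Bounded variance of the stochastic gradients, Jacobians and Hessians. -/
structure Problem.BoundedVariance (P : Problem p q Ξ Z) (σf σg σg1 σg2 : ℝ) : Prop where
  gradX_F : ∀ x y, VarianceLE P.lawF (fun ξ => gradX (P.F ξ) x y) (gradX P.f x y) σf
  gradY_F : ∀ x y, VarianceLE P.lawF (fun ξ => gradY (P.F ξ) x y) (gradY P.f x y) σf
  gradY_G : ∀ x y, VarianceLE P.lawG (fun ζ => gradY (P.G ζ) x y) (gradY P.g x y) σg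
  mixedXY_G : ∀ x y, VarianceLE P.lawG (fun ζ => mixedXY (P.G ζ) x y) (mixedXY P.g x y) σg1
  hessYY_G : ∀ x y, VarianceLE P.lawG (fun ζ => hessYY (P.G ζ) x y) (hessYY P.g x y) σg2

/-- All standing assumptions on the problem. -/
structure Problem.Assumptions (P : Problem p q Ξ Z) (μ L M τ ρ σf σg σg1 σg2 : ℝ) : Prop where
  wellPosed : P.WellPosed
  stronglyConvex : P.StronglyConvex μ
  smooth : P.Smooth L M τ ρ
  boundedVariance : P.BoundedVariance σf σg σg1 σg2

/-- Admissible initial values: `‖v⁰‖ ≤ M / μ`, the initial optimality gap `Φ(x⁰) - inf Φ` is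
at most `Δ` (in particular `Φ` is bounded below), and `‖y⁰ - y*(x⁰)‖ ≤ R`. -/
structure Problem.InitOK (P : Problem p q Ξ Z) (μ M Δ R : ℝ)
    (x₀ : Vec p) (y₀ v₀ : Vec q) : Prop where
  norm_v₀ : ‖v₀‖ ≤ M / μ
  gap : ∀ x, P.Φ x₀ - P.Φ x ≤ Δ
  dist_y₀ : ‖y₀ - P.yStar x₀‖ ≤ R

end Problem

/-! ### Sampling -/

/-- Labels of the samples of `ξ`: sample number `i` of the batch `D_F` of outer iteration `k`,
and of the batch `D_{F,j}` of inner step `j` of outer iteration `k`. -/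
inductive DrawF
  | outer (k i : ℕ)
  | inner (k j i : ℕ)

/-- Labels of the samples of `ζ`: sample number `i` of the batches `D_G`, `S_t`, `B_j` of outer
iteration `k`. -/
inductive DrawG
  | mixed (k i : ℕ)
  | lower (k t i : ℕ)
  | hess (k j i : ℕ)

/-- All samples are drawn from the laws of the problem and are mutually independent. -/
structure IsSampling {p q : ℕ} {Ξ Z Ω : Type*} [MeasurableSpace Ξ] [MeasurableSpace Z]
    [MeasurableSpace Ω] (P : Problem p q Ξ Z) (Pr : Measure Ω)
    (ξ : DrawF → Ω → Ξ) (ζ : DrawG → Ω → Z) : Prop where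
  lawF : ∀ d, MeasurePreserving (ξ d) Pr P.lawF
  lawG : ∀ d, MeasurePreserving (ζ d) Pr P.lawG
  indepF : iIndepFun ξ Pr
  indepG : iIndepFun ζ Pr
  indepFG : IndepFun (fun ω d => ξ d ω) (fun ω d => ζ d ω) Pr

/-! ### The algorithm -/

/-- Parameters of SSGD: step sizes `α`, `β`, `η`, inner step counts `T`, `J`, batch sizes. -/
structure Params where
  α : ℝ
  β : ℝ
  η : ℝ
  T : ℕ
  J : ℕ
  /-- size of `D_F` and of `D_{F,j}` -/
  Df : ℕ
  /-- size of `D_G` -/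
  Dg : ℕ
  /-- size of `S_t` -/
  S : ℕ
  /-- size of `B_j` -/
  D : ℕ

/-- The current iterates and the numbers of oracle calls made so far. -/
structure State (p q : ℕ) where
  x : Vec p
  y : Vec q
  v : Vec q
  /-- gradients of `F(·; ξ)` evaluated so far -/
  nGradF : ℕ
  /-- gradients of `G(·; ζ)` evaluated so far -/
  nGradG : ℕ
  /-- Jacobian-vector products with `∇ₓ∇_y G(·; ζ)` evaluated so far -/
  nJac : ℕ
  /-- Hessian-vector products with `∇_y² G(·; ζ)` evaluated so far -/
  nHess : ℕ

/-- Total number of oracle calls. -/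
def State.cost {p q : ℕ} (s : State p q) : ℕ := s.nGradF + s.nGradG + s.nJac + s.nHess

/-- Average over a batch of size `n`. -/
def batchMean {E : Type*} [AddCommGroup E] [Module ℝ E] (n : ℕ) (φ : ℕ → E) : E :=
  (n : ℝ)⁻¹ • ∑ i ∈ Finset.range n, φ i

/-- `for n = 0, …, N - 1: s ← step n s`. -/
def loop {A : Type*} (step : ℕ → A → A) : ℕ → A → A
  | 0, s => s
  | n + 1, s => step n (loop step n s)

section Algorithm

variable {p q : ℕ} {Ξ Z : Type*} [MeasurableSpace Ξ] [MeasurableSpace Z]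

/-- `x ← x - α h` with the hypergradient estimate
`h = ∇ₓ F(x, y; D_F) - ∇ₓ∇_y G(x, y; D_G) v`. -/
def upperStep (P : Problem p q Ξ Z) (a : Params) (ξ : ℕ → Ξ) (ζ : ℕ → Z)
    (s : State p q) : State p q :=
  { s with
    x := s.x - a.α • (batchMean a.Df (fun i => gradX (P.F (ξ i)) s.x s.y)
      - batchMean a.Dg (fun i => mixedXY (P.G (ζ i)) s.x s.y s.v))
    nGradF := s.nGradF + a.Df
    nJac := s.nJac + a.Dg }

/-- `y ← y - β ∇_y G(x, y; S_t)`. -/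
def lowerStep (P : Problem p q Ξ Z) (a : Params) (ζ : ℕ → Z) (s : State p q) : State p q :=
  { s with
    y := s.y - a.β • batchMean a.S (fun i => gradY (P.G (ζ i)) s.x s.y)
    nGradG := s.nGradG + a.S }

/-- `v ← (I - η ∇_y² G(x, y; B_j)) v + η ∇_y F(x, y; D_{F,j})`. -/
def linearStep (P : Problem p q Ξ Z) (a : Params) (ξ : ℕ → Ξ) (ζ : ℕ → Z)
    (s : State p q) : State p q :=
  { s with
    v := s.v - a.η • batchMean a.D (fun i => hessYY (P.G (ζ i)) s.x s.y s.v)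
      + a.η • batchMean a.Df (fun i => gradY (P.F (ξ i)) s.x s.y)
    nGradF := s.nGradF + a.Df
    nHess := s.nHess + a.D }

/-- Outer iteration `k`: one update of `x`, then `T` steps for `y` and `J` steps for `v`, both
started at their current values. -/
def outerStep (P : Problem p q Ξ Z) (a : Params) (ξ : DrawF → Ξ) (ζ : DrawG → Z)
    (k : ℕ) (s : State p q) : State p q :=
  let s₁ := upperStep P a (fun i => ξ (.outer k i)) (fun i => ζ (.mixed k i)) s
  let s₂ := loop (fun t => lowerStep P a (fun i => ζ (.lower k t i))) a.T s₁
  loop (fun j => linearStep P a (fun i => ξ (.inner k j i)) (fun i => ζ (.hess k j i))) a.J s₂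

/-- The state `(xᵏ, yᵏ, vᵏ)` of SSGD after `k` outer iterations, with the oracle calls made. -/
def run (P : Problem p q Ξ Z) (a : Params) (x₀ : Vec p) (y₀ v₀ : Vec q)
    (ξ : DrawF → Ξ) (ζ : DrawG → Z) (k : ℕ) : State p q :=
  loop (outerStep P a ξ ζ) k ⟨x₀, y₀, v₀, 0, 0, 0, 0⟩

end Algorithm

/-- Admissible parameters for the condition number `κ = L / μ`: `α` is of order `κ⁻⁵` (between
`c₁ κ⁻⁵` and `c₀ κ⁻⁵`), `β ≤ 2 / (μ + L)` and `η < 1 / L` are of order `1 / L` (at least `b / L`),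
and the inner step counts and batch sizes are arbitrary positive integers. -/
structure Params.Admissible (a : Params) (μ L b c₁ c₀ : ℝ) : Prop where
  α_lower : c₁ / (L / μ) ^ 5 ≤ a.α
  α_upper : a.α ≤ c₀ / (L / μ) ^ 5
  β_lower : b / L ≤ a.β
  β_upper : a.β ≤ 2 / (μ + L)
  η_lower : b / L ≤ a.η
  η_upper : a.η < 1 / L
  T_pos : 1 ≤ a.T
  J_pos : 1 ≤ a.J
  Df_pos : 1 ≤ a.Df
  Dg_pos : 1 ≤ a.Dg
  S_pos : 1 ≤ a.S
  D_pos : 1 ≤ a.D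

end SSGD

end

/-! Let y*(x) be the lower level solution and v(x) the solution of ∇_y²g v = ∇_y f at (x, y*(x)).
Because ∇_y g vanishes along (x, y*(x)), v(x) acts as an adjoint variable: ∇Φ = ∇ₓf − ∇ₓ∇_y g v(x),
and the quadratic Taylor remainder of Φ has a constant of order κ³ (`Standing.norm_Φ_sub_sub_le`).
SSGD is therefore inexact gradient descent on Φ. With e_k = E‖yᵏ − y*(xᵏ)‖² and w_k = E‖vᵏ −
v(xᵏ)‖², its squared bias is at most of order κ²e_k + w_k (`errDir_le`).

Samples are fresh, so the noise of a step is orthogonal in L² to everything determined by the past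
(`Oracle.noise_of_indep`), and only variances enter. Every sampled Hessian lies between μ and L, so
‖v‖ ≤ M/μ holds for every realisation (`norm_linearStep_le`). This turns operator variances into
vector variances and bounds w_k by a multiple of κ².

One inner step contracts a mean squared error by 1 − b/κ; more steps do no harm. Young's inequality
with weight b/(4κ) pays for the drift of the targets, and with D_k = E‖xᵏ⁺¹ − xᵏ‖², up to constants
free of μ (`outerStep_recursion`, `errorRecursion_runState`), e_{k+1} ≤ (1 − b/(4κ)) e_k + κ³ D_k +
κ σ_g²/S, w_{k+1} ≤ (1 − b/(4κ)) w_k + κ⁷ D_k + κ⁵ e_{k+1} + κ σ_f²/D_f + κ³ σ_{g,2}²/D. Each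
summation over k costs a factor κ, so the total bias contains ∑ D_k with factor κ¹⁰ and the noise of
y with factor κ⁸. As D_k carries a factor α², the choice α = c κ⁻⁵ with c small lets the left side
of the descent inequality absorb this feedback (`le_of_absorption`); dividing the initial gap by α
gives κ⁵/K.

One term resists: passed through both recursions, the initial error R² of y would contribute κ⁷. In
`ErrorRecursion.w_le_transient` the trivial bound on w_k is used until the transient of e_k has
decayed by a power of κ, after which the transient is harmless; this leaves κ⁵.

For the complexity, K and the batch sizes make each of the five terms of the rate at most ε/5, and
the oracle calls are products of these numbers. -/

namespace SSGD

open Filter Topology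

/-! ### Symmetric operators with two-sided bounds. -/

section Operators

variable {E : Type*} [NormedAddCommGroup E] [InnerProductSpace ℝ E]

/-- Polarization: 4⟨Tu, w⟩ is the difference of the quadratic form at u + w and u − w. Taking w
parallel to Tu with ‖w‖ = ‖u‖ makes the left side 4‖u‖‖Tu‖, and the parallelogram law bounds the
right side. -/
theorem norm_apply_le_of_symmetric (T : E →L[ℝ] E)
    (hT : ∀ u w, inner ℝ (T u) w = inner ℝ u (T w)) {c : ℝ}
    (h : ∀ u, |inner ℝ (T u) u| ≤ c * ‖u‖ ^ 2) (u : E) : ‖T u‖ ≤ c * ‖u‖ := by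
  by_cases hu : u = 0
  · simp [hu]
  have hu' : 0 < ‖u‖ := norm_pos_iff.2 hu
  have hc : 0 ≤ c := by
    have := (abs_nonneg _).trans (h u)
    exact nonneg_of_mul_nonneg_left this (by positivity)
  by_cases hTu : T u = 0
  · rw [hTu, norm_zero]; positivity
  have hTu' : 0 < ‖T u‖ := norm_pos_iff.2 hTu
  set w : E := (‖u‖ / ‖T u‖) • T u with hw
  have hnw : ‖w‖ = ‖u‖ := by
    rw [hw, norm_smul, Real.norm_of_nonneg (by positivity)]; field_simp
  have h1 : inner ℝ (T u) w = ‖u‖ * ‖T u‖ := by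
    rw [hw, real_inner_smul_right, real_inner_self_eq_norm_sq]; field_simp
  have h2 : 4 * inner ℝ (T u) w
      = inner ℝ (T (u + w)) (u + w) - inner ℝ (T (u - w)) (u - w) := by
    simp only [map_add, map_sub, inner_add_left, inner_add_right, inner_sub_left, inner_sub_right]
    rw [hT w u, real_inner_comm w]
    have := real_inner_comm w (T u)
    linarith
  have h3 := (abs_le.1 (h (u + w))).2
  have h4 := (abs_le.1 (h (u - w))).1
  have h5 := parallelogram_law_with_norm ℝ u w
  have h6 : 4 * (‖u‖ * ‖T u‖) ≤ 4 * (c * ‖u‖ * ‖u‖) := by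
    rw [← h1, h2]
    rw [hnw] at h5
    nlinarith
  have h7 : ‖u‖ * ‖T u‖ ≤ ‖u‖ * (c * ‖u‖) := by linarith
  exact le_of_mul_le_mul_left h7 hu'

/-- The form of I − βH lies between 1 − βL and 1 − βμ, and β(μ + L) ≤ 2 says exactly that 1 − βL ≥
−(1 − βμ). Every contraction of the inner loops rests on this bound. -/
theorem norm_sub_smul_apply_le (H : E →L[ℝ] E)
    (hH : ∀ u w, inner ℝ (H u) w = inner ℝ u (H w)) {μ L β : ℝ}
    (hlow : ∀ u, μ * ‖u‖ ^ 2 ≤ inner ℝ (H u) u) (hup : ∀ u, ‖H u‖ ≤ L * ‖u‖)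
    (hβ : 0 ≤ β) (hβ' : β * (μ + L) ≤ 2) (u : E) : ‖u - β • H u‖ ≤ (1 - β * μ) * ‖u‖ := by
  have key := norm_apply_le_of_symmetric (ContinuousLinearMap.id ℝ E - β • H)
    (c := 1 - β * μ) (fun u w => by
      simp [inner_sub_left, inner_sub_right, real_inner_smul_left, real_inner_smul_right, hH]) ?_ u
  · simpa using key
  intro u
  have h1 := hlow u
  have h2 : inner ℝ (H u) u ≤ L * ‖u‖ ^ 2 := by
    calc inner ℝ (H u) u ≤ ‖H u‖ * ‖u‖ := real_inner_le_norm _ _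
      _ ≤ (L * ‖u‖) * ‖u‖ := by gcongr; exact hup u
      _ = _ := by ring
  have h3 : inner ℝ ((ContinuousLinearMap.id ℝ E - β • H) u) u
      = ‖u‖ ^ 2 - β * inner ℝ (H u) u := by
    simp [inner_sub_left, real_inner_smul_left]
  rw [h3, abs_le]
  have h4 := mul_le_mul_of_nonneg_left h1 hβ
  have h5 := mul_le_mul_of_nonneg_left h2 hβ
  constructor
  · nlinarith [sq_nonneg ‖u‖]
  · nlinarith

end Operators

/-! ### First and second order consequences of strong convexity. -/

section Convex

variable {E : Type*} [NormedAddCommGroup E] [InnerProductSpace ℝ E] [CompleteSpace E]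

theorem tendsto_inner_slope {f : E → ℝ} {y g : E} (hf : HasGradientAt f g y) (u : E) :
    Tendsto (fun t : ℝ => t⁻¹ * (f (y + t • u) - f y)) (𝓝[>] 0) (𝓝 (inner ℝ g u)) := by
  have h1 : HasDerivAt (fun t : ℝ => f (y + t • u)) (inner ℝ g u) 0 := by
    have h2 : HasDerivAt (fun t : ℝ => y + t • u) u 0 := by
      simpa using ((hasDerivAt_id (0 : ℝ)).smul_const u).const_add y
    have h3 : HasFDerivAt f (InnerProductSpace.toDual ℝ E g) (y + (0 : ℝ) • u) := by
      simpa using hf.hasFDerivAt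
    have h4 := h3.comp_hasDerivAt (0 : ℝ) h2
    rw [InnerProductSpace.toDual_apply_apply] at h4
    exact h4
  simpa using h1.tendsto_slope_zero_right

/-- Divide the strong convexity inequality on the segment from y to y' by the parameter t and let t
tend to 0 from the right. -/
theorem strongConvexOn_first_order {f : E → ℝ} {μ : ℝ} (hf : StrongConvexOn Set.univ μ f)
    {y g : E} (hg : HasGradientAt f g y) (y' : E) :
    inner ℝ g (y' - y) + μ / 2 * ‖y' - y‖ ^ 2 ≤ f y' - f y := by
  have h1 := tendsto_inner_slope hg (y' - y)
  have h2 : Tendsto (fun t : ℝ => f y' - f y - (1 - t) * (μ / 2 * ‖y' - y‖ ^ 2)) (𝓝[>] 0)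
      (𝓝 (f y' - f y - (1 - 0) * (μ / 2 * ‖y' - y‖ ^ 2))) := by
    apply Tendsto.mono_left _ nhdsWithin_le_nhds
    apply Continuous.tendsto
    fun_prop
  have h3 : ∀ᶠ t : ℝ in 𝓝[>] 0, t⁻¹ * (f (y + t • (y' - y)) - f y)
      ≤ f y' - f y - (1 - t) * (μ / 2 * ‖y' - y‖ ^ 2) := by
    filter_upwards [Ioo_mem_nhdsGT (show (0 : ℝ) < 1 by norm_num)] with t ht
    have h4 := hf.2 (Set.mem_univ y) (Set.mem_univ y') 
      (sub_nonneg.2 ht.2.le) ht.1.le (sub_add_cancel 1 t)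
    have h5 : (1 - t) • y + t • y' = y + t • (y' - y) := by
      rw [sub_smul, one_smul, smul_sub]; abel
    rw [h5, norm_sub_rev] at h4
    simp only [smul_eq_mul] at h4
    rw [inv_mul_le_iff₀ ht.1]
    nlinarith
  have := le_of_tendsto_of_tendsto h1 h2 h3
  linarith

theorem strongConvexOn_gradient_monotone {f : E → ℝ} {μ : ℝ} (hf : StrongConvexOn Set.univ μ f)
    {y y' g g' : E} (hg : HasGradientAt f g y) (hg' : HasGradientAt f g' y') :
    μ * ‖y' - y‖ ^ 2 ≤ inner ℝ (g' - g) (y' - y) := by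
  have h1 := strongConvexOn_first_order hf hg y'
  have h2 := strongConvexOn_first_order hf hg' y
  rw [norm_sub_rev, ← neg_sub y' y, inner_neg_right] at h2
  rw [inner_sub_left]
  linarith

/-- Strong monotonicity of the gradient between y and y + tu, divided by t², passes to the limit t →
0. Only differentiability of the gradient at y is needed. -/
theorem strongConvexOn_hessian_lower {f : E → ℝ} {μ : ℝ} (hf : StrongConvexOn Set.univ μ f)
    {g : E → E} (hg : ∀ y, HasGradientAt f (g y) y) {y : E} {H : E →L[ℝ] E}
    (hH : HasFDerivAt g H y) (u : E) : μ * ‖u‖ ^ 2 ≤ inner ℝ (H u) u := by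
  have h1 : HasDerivAt (fun t : ℝ => inner ℝ (g (y + t • u)) u) (inner ℝ (H u) u) 0 := by
    have h2 : HasDerivAt (fun t : ℝ => y + t • u) u 0 := by
      simpa using ((hasDerivAt_id (0 : ℝ)).smul_const u).const_add y
    have h3 : HasFDerivAt g H (y + (0 : ℝ) • u) := by simpa using hH
    simpa using (h3.comp_hasDerivAt (0 : ℝ) h2).inner ℝ (hasDerivAt_const (0 : ℝ) u)
  have h4 := h1.tendsto_slope_zero_right
  refine ge_of_tendsto h4 ?_
  filter_upwards [self_mem_nhdsWithin] with t ht
  have ht : 0 < t := ht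
  have h5 := strongConvexOn_gradient_monotone hf (hg y) (hg (y + t • u))
  simp only [add_sub_cancel_left, norm_smul, real_inner_smul_right, inner_sub_left,
    Real.norm_of_nonneg ht.le] at h5
  simp only [zero_add, zero_smul, add_zero, smul_eq_mul]
  rw [le_inv_mul_iff₀ ht]
  have : t * (t * (μ * ‖u‖ ^ 2)) ≤ t * (inner ℝ (g (y + t • u)) u - inner ℝ (g y) u) := by
    nlinarith
  exact le_of_mul_le_mul_left this ht

/-- Symmetry of the second derivative, carried over by the Riesz identification of gradients with
differentials. -/
theorem hessian_symmetric {f : E → ℝ} {g : E → E} (hg : ∀ y, HasGradientAt f (g y) y) {y : E}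
    {H : E →L[ℝ] E} (hH : HasFDerivAt g H y) (u w : E) :
    inner ℝ (H u) w = inner ℝ u (H w) := by
  have h := second_derivative_symmetric (𝕜 := ℝ) (f := f)
    (f' := fun y => (InnerProductSpace.toDual ℝ E) (g y))
    (f'' := ((InnerProductSpace.toDual ℝ E).toContinuousLinearEquiv.toContinuousLinearMap).comp H)
    (fun y => (hg y).hasFDerivAt)
    (((InnerProductSpace.toDual ℝ E).toContinuousLinearEquiv.hasFDerivAt).comp y hH) u w
  simp at h
  rw [h, real_inner_comm]

end Convex

/-! ### Quadratic Taylor remainders and differentiation under the integral sign. -/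

section Taylor

/-- First order Taylor expansion with a quadratic remainder. -/
theorem norm_sub_sub_le_of_fderiv_lip {E F : Type*} [NormedAddCommGroup E] [NormedSpace ℝ E]
    [NormedAddCommGroup F] [NormedSpace ℝ F] {f : E → F} {f' : E → E →L[ℝ] F}
    (hf : ∀ z, HasFDerivAt f (f' z) z) {z d : E} {c : ℝ}
    (hlip : ∀ t : ℝ, 0 ≤ t → t ≤ 1 → ‖f' (z + t • d) d - f' z d‖ ≤ c) :
    ‖f (z + d) - f z - f' z d‖ ≤ c := by
  -- Subtracting the linear part along the segment leaves a curve with derivative bounded by c; the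
  -- mean value inequality on [0, 1] finishes.
  have h2 : ∀ t : ℝ, HasDerivAt (fun t : ℝ => f (z + t • d) - t • f' z d)
      (f' (z + t • d) d - f' z d) t := by
    intro t
    have h3 : HasDerivAt (fun t : ℝ => z + t • d) d t := by
      simpa using ((hasDerivAt_id t).smul_const d).const_add z
    have h4 := (hf (z + t • d)).comp_hasDerivAt t h3
    have h5 : HasDerivAt (fun t : ℝ => t • f' z d) (f' z d) t := by
      simpa using (hasDerivAt_id t).smul_const (f' z d)
    exact h4.sub h5
  have := norm_image_sub_le_of_norm_deriv_le_segment_01' (C := c)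
    (f := fun t : ℝ => f (z + t • d) - t • f' z d)
    (fun t _ => (h2 t).hasDerivWithinAt) (fun t ht => hlip t ht.1 ht.2.le)
  simp only [one_smul, zero_smul, add_zero, sub_zero] at this
  rwa [sub_right_comm] at this

theorem hasFDerivAt_of_quadratic {E F : Type*} [NormedAddCommGroup E] [NormedSpace ℝ E]
    [NormedAddCommGroup F] [NormedSpace ℝ F] {f : E → F} {f' : E →L[ℝ] F} {x : E} {c : ℝ}
    (h : ∀ d, ‖f (x + d) - f x - f' d‖ ≤ c * ‖d‖ ^ 2) : HasFDerivAt f f' x := by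
  rw [hasFDerivAt_iff_isLittleO_nhds_zero]
  refine Asymptotics.IsBigO.trans_isLittleO (g := fun d : E => ‖d‖ ^ 2)
    (Asymptotics.IsBigO.of_bound c (Eventually.of_forall fun d => ?_)) ?_
  · simpa using h d
  · exact (Asymptotics.isLittleO_norm_pow_id one_lt_two)

/-- The derivative is a limit along a sequence of difference quotients. This is how derivatives in
(x, y) inherit measurability in the sample. -/
theorem tendsto_slope_of_quadratic {E F : Type*} [NormedAddCommGroup E] [NormedSpace ℝ E]
    [NormedAddCommGroup F] [NormedSpace ℝ F] {f : E → F} {f' : E →L[ℝ] F} {x : E} {c : ℝ}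
    (h : ∀ d, ‖f (x + d) - f x - f' d‖ ≤ c * ‖d‖ ^ 2) (d : E) :
    Tendsto (fun n : ℕ => (n + 1 : ℝ) • (f (x + (n + 1 : ℝ)⁻¹ • d) - f x)) atTop (𝓝 (f' d)) := by
  rw [tendsto_iff_norm_sub_tendsto_zero]
  have hlim : Tendsto (fun n : ℕ => c * ‖d‖ ^ 2 * (1 / ((n : ℝ) + 1))) atTop (𝓝 0) := by
    simpa using tendsto_one_div_add_atTop_nhds_zero_nat.const_mul (c * ‖d‖ ^ 2)
  refine squeeze_zero (fun _ => norm_nonneg _) (fun n => ?_) hlim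
  have hn : (0 : ℝ) < n + 1 := by positivity
  have h1 := h ((n + 1 : ℝ)⁻¹ • d)
  have h2 : (n + 1 : ℝ) • (f (x + (n + 1 : ℝ)⁻¹ • d) - f x) - f' d
      = (n + 1 : ℝ) • (f (x + (n + 1 : ℝ)⁻¹ • d) - f x - f' ((n + 1 : ℝ)⁻¹ • d)) := by
    rw [smul_sub _ _ (f' _), map_smul, smul_smul, mul_inv_cancel₀ hn.ne', one_smul]
  rw [h2, norm_smul, Real.norm_of_nonneg hn.le]
  calc _ ≤ (n + 1 : ℝ) * (c * ‖(n + 1 : ℝ)⁻¹ • d‖ ^ 2) := by gcongr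
    _ = _ := by
      rw [norm_smul, norm_inv, Real.norm_of_nonneg hn.le]; field_simp

theorem measurable_deriv_of_quadratic {Z E F : Type*} [MeasurableSpace Z]
    [NormedAddCommGroup E] [NormedSpace ℝ E] [NormedAddCommGroup F]
    [NormedSpace ℝ F] [MeasurableSpace F] [BorelSpace F] [SecondCountableTopology F]
    {φ : Z → E → F} {ψ : Z → E →L[ℝ] F} {x : E} {c : ℝ}
    (hmeas : ∀ x, Measurable (fun z => φ z x))
    (h : ∀ z d, ‖φ z (x + d) - φ z x - ψ z d‖ ≤ c * ‖d‖ ^ 2) (d : E) :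
    Measurable (fun z => ψ z d) := by
  refine measurable_of_tendsto_metrizable
    (f := fun (n : ℕ) z => (n + 1 : ℝ) • (φ z (x + (n + 1 : ℝ)⁻¹ • d) - φ z x))
    (fun n => ((hmeas _).sub (hmeas _)).const_smul _) ?_
  exact tendsto_pi_nhds.2 fun z => tendsto_slope_of_quadratic (h z) d

/-- Differentiation under the integral sign, for integrands with a uniform quadratic Taylor
remainder. -/
theorem integrable_deriv_of_quadratic {Z E F : Type*} [MeasurableSpace Z] {ν : Measure Z}
    [IsProbabilityMeasure ν] [NormedAddCommGroup E] [NormedSpace ℝ E] [NormedAddCommGroup F]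
    [NormedSpace ℝ F] {φ : Z → E → F} {ψ : Z → E →L[ℝ] F} {x : E} {c : ℝ}
    (hint : ∀ x, Integrable (fun z => φ z x) ν)
    (h : ∀ z d, ‖φ z (x + d) - φ z x - ψ z d‖ ≤ c * ‖d‖ ^ 2) (d : E) :
    Integrable (fun z => ψ z d) ν := by
  have hmeas : AEStronglyMeasurable (fun z => ψ z d) ν :=
    aestronglyMeasurable_of_tendsto_ae (u := atTop)
      (f := fun (n : ℕ) z => (n + 1 : ℝ) • (φ z (x + (n + 1 : ℝ)⁻¹ • d) - φ z x))
      (fun n => ((hint _).sub (hint _)).aestronglyMeasurable.const_smul _)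
      (Eventually.of_forall fun z => tendsto_slope_of_quadratic (h z) d)
  refine Integrable.mono' ((((hint (x + d)).norm.add (hint x).norm).add
    (integrable_const (c * ‖d‖ ^ 2)))) hmeas (Eventually.of_forall fun z => ?_)
  have h1 := h z d
  have h2 : ψ z d = (φ z (x + d) - φ z x) - (φ z (x + d) - φ z x - ψ z d) := by abel
  calc ‖ψ z d‖ = ‖(φ z (x + d) - φ z x) - (φ z (x + d) - φ z x - ψ z d)‖ := by rw [← h2]
    _ ≤ ‖φ z (x + d) - φ z x‖ + ‖φ z (x + d) - φ z x - ψ z d‖ := norm_sub_le _ _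
    _ ≤ ‖φ z (x + d)‖ + ‖φ z x‖ + c * ‖d‖ ^ 2 := by gcongr; exact norm_sub_le _ _

theorem norm_integral_sub_le_of_quadratic {Z E F : Type*} [MeasurableSpace Z] {ν : Measure Z}
    [IsProbabilityMeasure ν] [NormedAddCommGroup E] [NormedSpace ℝ E] [NormedAddCommGroup F]
    [NormedSpace ℝ F] {φ : Z → E → F} {ψ : Z → F} {x x' : E} {c : ℝ}
    (hint : ∀ x, Integrable (fun z => φ z x) ν) (hψ : Integrable ψ ν)
    (h : ∀ z, ‖φ z x' - φ z x - ψ z‖ ≤ c) :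
    ‖(∫ z, φ z x' ∂ν) - (∫ z, φ z x ∂ν) - ∫ z, ψ z ∂ν‖ ≤ c := by
  rw [← integral_sub (hint _) (hint _), ← integral_sub (f := fun z => φ z x' - φ z x)
    ((hint _).sub (hint _)) hψ]
  have := norm_integral_le_of_norm_le_const (μ := ν) (Eventually.of_forall h)
  simpa using this

/-- The remainder bound is uniform in the sample, so it survives integration. The derivative is
built vector by vector, as d ↦ ∫ ψ z d; finite dimension makes it continuous, and measurability of ψ
as an operator-valued map is never needed. -/
theorem exists_hasFDerivAt_integral {Z E F : Type*} [MeasurableSpace Z] {ν : Measure Z}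
    [IsProbabilityMeasure ν] [NormedAddCommGroup E] [NormedSpace ℝ E] [FiniteDimensional ℝ E]
    [NormedAddCommGroup F] [NormedSpace ℝ F] {φ : Z → E → F} {ψ : Z → E →L[ℝ] F} {x : E} {c : ℝ}
    (hint : ∀ x, Integrable (fun z => φ z x) ν)
    (h : ∀ z d, ‖φ z (x + d) - φ z x - ψ z d‖ ≤ c * ‖d‖ ^ 2) :
    ∃ Ψ : E →L[ℝ] F, (∀ d, Ψ d = ∫ z, ψ z d ∂ν) ∧
      HasFDerivAt (fun x => ∫ z, φ z x ∂ν) Ψ x := by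
  have hi := integrable_deriv_of_quadratic hint h
  let Ψ : E →ₗ[ℝ] F :=
    { toFun := fun d => ∫ z, ψ z d ∂ν
      map_add' := fun a b => by simp only [map_add]; exact integral_add (hi a) (hi b)
      map_smul' := fun r a => by simp only [map_smul, RingHom.id_apply]; exact integral_smul _ _ }
  refine ⟨LinearMap.toContinuousLinearMap Ψ, fun d => rfl, ?_⟩
  refine hasFDerivAt_of_quadratic (c := c) fun d => ?_
  exact norm_integral_sub_le_of_quadratic hint (hi d) (fun z => h z d)

end Taylor

/-! ### Measurability and integrals of vectors tested against inner products. -/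

section Inner

variable {Z E : Type*} [MeasurableSpace Z] {ν : Measure Z} [NormedAddCommGroup E]
  [InnerProductSpace ℝ E] [FiniteDimensional ℝ E] {φ : Z → E}

theorem eq_sum_inner_smul (v : E) :
    v = ∑ i, inner ℝ v (stdOrthonormalBasis ℝ E i) • stdOrthonormalBasis ℝ E i := by
  conv_lhs => rw [← (stdOrthonormalBasis ℝ E).sum_repr' v]
  simp [real_inner_comm]

theorem measurable_of_inner [MeasurableSpace E] [BorelSpace E]
    (h : ∀ e, Measurable fun z => inner ℝ (φ z) e) : Measurable φ := by
  rw [funext fun z => eq_sum_inner_smul (φ z)]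
  exact Finset.measurable_sum _ fun i _ => (h _).smul_const _

theorem integrable_of_inner (h : ∀ e, Integrable (fun z => inner ℝ (φ z) e) ν) :
    Integrable φ ν := by
  rw [funext fun z => eq_sum_inner_smul (φ z)]
  exact integrable_finsetSum _ fun i _ => (h _).smul_const _

theorem integral_eq_of_inner (h : ∀ e, Integrable (fun z => inner ℝ (φ z) e) ν) {a : E}
    (ha : ∀ e, inner ℝ a e = ∫ z, inner ℝ (φ z) e ∂ν) : ∫ z, φ z ∂ν = a := by
  refine ext_inner_right ℝ fun e => ?_
  rw [ha, real_inner_comm, ← integral_inner (integrable_of_inner h)]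
  simp only [real_inner_comm]

end Inner

end SSGD

namespace SSGD

open Filter Topology

/-! ### Partial gradients and joint Lipschitz continuity. -/

section Partial

variable {p q : ℕ}

theorem hasGradientAt_gradX {h : Vec p → Vec q → ℝ} {x : Vec p} {y : Vec q}
    {h' : Vec p × Vec q →L[ℝ] ℝ} (hh : HasFDerivAt (fun z : Vec p × Vec q => h z.1 z.2) h' (x, y)) :
    HasGradientAt (fun x' => h x' y) (gradX h x y) x := by
  have h1 : HasFDerivAt (fun x' : Vec p => (x', y)) (ContinuousLinearMap.inl ℝ (Vec p) (Vec q)) x :=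
    hasFDerivAt_prodMk_left x y
  have h2 := hh.comp x h1
  exact h2.differentiableAt.hasGradientAt

theorem hasGradientAt_gradY {h : Vec p → Vec q → ℝ} {x : Vec p} {y : Vec q}
    {h' : Vec p × Vec q →L[ℝ] ℝ} (hh : HasFDerivAt (fun z : Vec p × Vec q => h z.1 z.2) h' (x, y)) :
    HasGradientAt (fun y' => h x y') (gradY h x y) y := by
  have h1 : HasFDerivAt (fun y' : Vec q => (x, y')) (ContinuousLinearMap.inr ℝ (Vec p) (Vec q)) y :=
    hasFDerivAt_prodMk_right x y
  have h2 := hh.comp y h1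
  exact h2.differentiableAt.hasGradientAt

theorem fderiv_partial_apply {F : Type*} [NormedAddCommGroup F] [NormedSpace ℝ F]
    {h : Vec p → Vec q → F} {x : Vec p} {y : Vec q}
    {h' : Vec p × Vec q →L[ℝ] F} (hh : HasFDerivAt (fun z : Vec p × Vec q => h z.1 z.2) h' (x, y))
    (d : Vec p × Vec q) :
    h' d = fderiv ℝ (fun x' => h x' y) x d.1 + fderiv ℝ (fun y' => h x y') y d.2 := by
  have h1 : HasFDerivAt (fun x' : Vec p => (x', y)) (ContinuousLinearMap.inl ℝ (Vec p) (Vec q)) x :=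
    hasFDerivAt_prodMk_left x y
  have h3 : HasFDerivAt (fun y' : Vec q => (x, y')) (ContinuousLinearMap.inr ℝ (Vec p) (Vec q)) y :=
    hasFDerivAt_prodMk_right x y
  have e1 : fderiv ℝ (fun x' => h x' y) x = h'.comp (ContinuousLinearMap.inl ℝ (Vec p) (Vec q)) :=
    (HasFDerivAt.comp (g := fun z : Vec p × Vec q => h z.1 z.2) x hh h1).fderiv
  have e2 : fderiv ℝ (fun y' => h x y') y = h'.comp (ContinuousLinearMap.inr ℝ (Vec p) (Vec q)) :=
    (HasFDerivAt.comp (g := fun z : Vec p × Vec q => h z.1 z.2) y hh h3).fderiv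
  rw [e1, e2]
  simp [← map_add]

theorem fderiv_apply_eq_inner {h : Vec p → Vec q → ℝ} {x : Vec p} {y : Vec q}
    {h' : Vec p × Vec q →L[ℝ] ℝ} (hh : HasFDerivAt (fun z : Vec p × Vec q => h z.1 z.2) h' (x, y))
    (d : Vec p × Vec q) : h' d = inner ℝ (gradX h x y) d.1 + inner ℝ (gradY h x y) d.2 := by
  rw [fderiv_partial_apply hh, (hasGradientAt_gradX hh).fderiv_apply,
    (hasGradientAt_gradY hh).fderiv_apply]

theorem lipXY_norm_sub_le {E : Type*} [NormedAddCommGroup E] {c : ℝ} {φ : Vec p → Vec q → E}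
    (h : LipXY c φ) (x : Vec p) (y : Vec q) (z : Vec p × Vec q) (t : ℝ) (ht : 0 ≤ t) :
    ‖φ (x + t • z.1) (y + t • z.2) - φ x y‖ ≤ c * (t * (‖z.1‖ + ‖z.2‖)) := by
  refine (h _ _ _ _).trans_eq ?_
  simp only [add_sub_cancel_left, norm_smul, Real.norm_of_nonneg ht]
  ring

theorem LipXY.continuous {E : Type*} [NormedAddCommGroup E] {c : ℝ} {φ : Vec p → Vec q → E}
    (h : LipXY c φ) : Continuous fun z : Vec p × Vec q => φ z.1 z.2 := by
  -- The factor 2 converts the sum norm of `LipXY` to the sup norm of the product; the absolute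
  -- value is there because the sign of c is not known.
  refine (LipschitzWith.of_dist_le_mul (K := (2 * |c|).toNNReal) fun z z' => ?_).continuous
  rw [dist_eq_norm, dist_eq_norm, Real.coe_toNNReal _ (by positivity)]
  have h1 : ‖z.1 - z'.1‖ ≤ ‖z - z'‖ := norm_fst_le (z - z')
  have h2 : ‖z.2 - z'.2‖ ≤ ‖z - z'‖ := norm_snd_le (z - z')
  calc _ ≤ c * (‖z.1 - z'.1‖ + ‖z.2 - z'.2‖) := h _ _ _ _
    _ ≤ |c| * (‖z - z'‖ + ‖z - z'‖) := by
      gcongr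
      exact le_abs_self c
    _ = _ := by ring

theorem norm_fst_add_norm_snd_sq_le (d : Vec p × Vec q) :
    (‖d.1‖ + ‖d.2‖) ^ 2 ≤ 4 * ‖d‖ ^ 2 := by
  have h1 := norm_fst_le d
  have h2 := norm_snd_le d
  have : ‖d.1‖ + ‖d.2‖ ≤ 2 * ‖d‖ := by linarith
  calc _ ≤ (2 * ‖d‖) ^ 2 := by gcongr
    _ = _ := by ring

end Partial

namespace Problem

variable {p q : ℕ} {Ξ Z : Type*} [MeasurableSpace Ξ] [MeasurableSpace Z]
  {P : Problem p q Ξ Z} {μ L M τ ρ σf σg σg1 σg2 : ℝ}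

/-! ### Facts about individual samples -/

theorem Smooth.hasFDerivAt_F (hS : P.Smooth L M τ ρ) (ξ : Ξ) (z : Vec p × Vec q) :
    HasFDerivAt (fun z : Vec p × Vec q => P.F ξ z.1 z.2)
      (fderiv ℝ (fun z : Vec p × Vec q => P.F ξ z.1 z.2) z) z :=
  (hS.differentiable_F ξ z).hasFDerivAt

theorem Smooth.hasFDerivAt_gradY_G (hS : P.Smooth L M τ ρ) (ζ : Z) (z : Vec p × Vec q) :
    HasFDerivAt (fun z : Vec p × Vec q => gradY (P.G ζ) z.1 z.2)
      (fderiv ℝ (fun z : Vec p × Vec q => gradY (P.G ζ) z.1 z.2) z) z :=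
  (hS.differentiable_gradY_G ζ z).hasFDerivAt

theorem Smooth.hasGradientAt_G (hS : P.Smooth L M τ ρ) (ζ : Z) (x : Vec p) (y : Vec q) :
    HasGradientAt (fun y' => P.G ζ x y') (gradY (P.G ζ) x y) y :=
  (hS.differentiable_G ζ x y).hasGradientAt

theorem Smooth.hasFDerivAt_hessYY_G (hS : P.Smooth L M τ ρ) (ζ : Z) (x : Vec p) (y : Vec q) :
    HasFDerivAt (fun y' => gradY (P.G ζ) x y') (hessYY (P.G ζ) x y) y := by
  have h3 : HasFDerivAt (fun y' : Vec q => (x, y')) (ContinuousLinearMap.inr ℝ (Vec p) (Vec q)) y :=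
    hasFDerivAt_prodMk_right x y
  exact (HasFDerivAt.comp (g := fun z : Vec p × Vec q => gradY (P.G ζ) z.1 z.2) y
    (hS.hasFDerivAt_gradY_G ζ (x, y)) h3).differentiableAt.hasFDerivAt

theorem Smooth.hasFDerivAt_mixedXY_G (hS : P.Smooth L M τ ρ) (ζ : Z) (x : Vec p) (y : Vec q) :
    HasFDerivAt (fun x' => gradY (P.G ζ) x' y)
      (ContinuousLinearMap.adjoint (mixedXY (P.G ζ) x y)) x := by
  have h3 : HasFDerivAt (fun x' : Vec p => (x', y)) (ContinuousLinearMap.inl ℝ (Vec p) (Vec q)) x :=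
    hasFDerivAt_prodMk_left x y
  rw [mixedXY, ContinuousLinearMap.adjoint_adjoint]
  exact (HasFDerivAt.comp (g := fun z : Vec p × Vec q => gradY (P.G ζ) z.1 z.2) x
    (hS.hasFDerivAt_gradY_G ζ (x, y)) h3).differentiableAt.hasFDerivAt

theorem Smooth.norm_gradY_F_le (hS : P.Smooth L M τ ρ) (hM : 0 ≤ M) (ξ : Ξ) (x : Vec p)
    (y : Vec q) : ‖gradY (P.F ξ) x y‖ ≤ M := by
  have h1 := hasGradientAt_gradY (hS.hasFDerivAt_F ξ (x, y))
  have h2 := h1.hasFDerivAt.le_of_lip' hM (Eventually.of_forall fun y' => by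
    simpa using hS.lip_F ξ x y' y)
  simpa using h2

theorem Smooth.norm_hessYY_G_le (hS : P.Smooth L M τ ρ) (hL : 0 ≤ L) (ζ : Z) (x : Vec p)
    (y : Vec q) : ‖hessYY (P.G ζ) x y‖ ≤ L :=
  (hS.hasFDerivAt_hessYY_G ζ x y).le_of_lip' hL (Eventually.of_forall fun y' => by
    simpa using hS.lip_gradY_G ζ x x y' y)

theorem Smooth.norm_mixedXY_G_le (hS : P.Smooth L M τ ρ) (hL : 0 ≤ L) (ζ : Z) (x : Vec p)
    (y : Vec q) : ‖mixedXY (P.G ζ) x y‖ ≤ L := by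
  have := (hS.hasFDerivAt_mixedXY_G ζ x y).le_of_lip' hL (Eventually.of_forall fun x' => by
    simpa using hS.lip_gradY_G ζ x' x y y)
  rwa [LinearIsometryEquiv.norm_map] at this

theorem Smooth.hessYY_G_symm (hS : P.Smooth L M τ ρ) (ζ : Z) (x : Vec p) (y u w : Vec q) :
    inner ℝ (hessYY (P.G ζ) x y u) w = inner ℝ u (hessYY (P.G ζ) x y w) :=
  hessian_symmetric (fun y => hS.hasGradientAt_G ζ x y) (hS.hasFDerivAt_hessYY_G ζ x y) u w

theorem Smooth.le_hessYY_G (hS : P.Smooth L M τ ρ) (hC : P.StronglyConvex μ) (ζ : Z) (x : Vec p)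
    (y u : Vec q) : μ * ‖u‖ ^ 2 ≤ inner ℝ (hessYY (P.G ζ) x y u) u :=
  strongConvexOn_hessian_lower (hC ζ x) (fun y => hS.hasGradientAt_G ζ x y)
    (hS.hasFDerivAt_hessYY_G ζ x y) u

/-- The differential splits into two partial gradients, each L-Lipschitz. Bounding t by 1 along the
segment gives up the usual factor 1/2, which only affects constants. -/
theorem Smooth.expand_F (hS : P.Smooth L M τ ρ) (hL : 0 ≤ L) (ξ : Ξ) (z d : Vec p × Vec q) :
    ‖P.F ξ (z.1 + d.1) (z.2 + d.2) - P.F ξ z.1 z.2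
      - (inner ℝ (gradX (P.F ξ) z.1 z.2) d.1 + inner ℝ (gradY (P.F ξ) z.1 z.2) d.2)‖
      ≤ L * (‖d.1‖ + ‖d.2‖) ^ 2 := by
  have h1 : ∀ z d, fderiv ℝ (fun z : Vec p × Vec q => P.F ξ z.1 z.2) z d = _ :=
    fun z d => fderiv_apply_eq_inner (hS.hasFDerivAt_F ξ z) d
  have h2 := norm_sub_sub_le_of_fderiv_lip (fun z => hS.hasFDerivAt_F ξ z) (z := z) (d := d)
    (c := L * (‖d.1‖ + ‖d.2‖) ^ 2) ?_
  · rw [h1] at h2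
    exact h2
  intro t ht ht1
  rw [h1, h1, add_sub_add_comm, ← inner_sub_left, ← inner_sub_left]
  have hx := lipXY_norm_sub_le (hS.lip_gradX_F ξ) z.1 z.2 d t ht
  have hy := lipXY_norm_sub_le (hS.lip_gradY_F ξ) z.1 z.2 d t ht
  set r := ‖d.1‖ + ‖d.2‖ with hr
  have hr0 : 0 ≤ r := by positivity
  have h3 : L * (t * r) ≤ L * r := by
    have : t * r ≤ 1 * r := by gcongr
    nlinarith
  calc _ ≤ L * (t * r) * ‖d.1‖ + L * (t * r) * ‖d.2‖ := by
        refine (norm_add_le _ _).trans (add_le_add ?_ ?_)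
        · exact (norm_inner_le_norm _ _).trans (mul_le_mul_of_nonneg_right hx (norm_nonneg _))
        · exact (norm_inner_le_norm _ _).trans (mul_le_mul_of_nonneg_right hy (norm_nonneg _))
    _ = L * (t * r) * r := by rw [hr]; ring
    _ ≤ L * r * r := by gcongr
    _ = _ := by ring

theorem Smooth.expand_gradY_G (hS : P.Smooth L M τ ρ) (hτ : 0 ≤ τ) (hρ : 0 ≤ ρ) (ζ : Z)
    (z d : Vec p × Vec q) :
    ‖gradY (P.G ζ) (z.1 + d.1) (z.2 + d.2) - gradY (P.G ζ) z.1 z.2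
      - (ContinuousLinearMap.adjoint (mixedXY (P.G ζ) z.1 z.2) d.1 + hessYY (P.G ζ) z.1 z.2 d.2)‖
      ≤ (τ + ρ) * (‖d.1‖ + ‖d.2‖) ^ 2 := by
  have h1 : ∀ z d, fderiv ℝ (fun z : Vec p × Vec q => gradY (P.G ζ) z.1 z.2) z d
      = ContinuousLinearMap.adjoint (mixedXY (P.G ζ) z.1 z.2) d.1
        + hessYY (P.G ζ) z.1 z.2 d.2 := fun z d => by
    rw [fderiv_partial_apply (hS.hasFDerivAt_gradY_G ζ z) d, mixedXY,
      ContinuousLinearMap.adjoint_adjoint]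
    rfl
  have h2 := norm_sub_sub_le_of_fderiv_lip (fun z => hS.hasFDerivAt_gradY_G ζ z) (z := z) (d := d)
    (c := (τ + ρ) * (‖d.1‖ + ‖d.2‖) ^ 2) ?_
  · rw [h1] at h2
    exact h2
  intro t ht ht1
  rw [h1, h1, add_sub_add_comm, ← sub_apply, ← sub_apply,
    ← map_sub]
  have hx := lipXY_norm_sub_le (hS.lip_mixedXY_G ζ) z.1 z.2 d t ht
  have hy := lipXY_norm_sub_le (hS.lip_hessYY_G ζ) z.1 z.2 d t ht
  set r := ‖d.1‖ + ‖d.2‖ with hr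
  have hr0 : 0 ≤ r := by positivity
  have h3 : t * r ≤ r := by nlinarith
  rw [← LinearIsometryEquiv.norm_map (ContinuousLinearMap.adjoint (𝕜 := ℝ))] at hx
  calc _ ≤ τ * (t * r) * ‖d.1‖ + ρ * (t * r) * ‖d.2‖ := by
        refine (norm_add_le _ _).trans (add_le_add ?_ ?_)
        · exact (ContinuousLinearMap.le_opNorm _ _).trans
            (mul_le_mul_of_nonneg_right hx (norm_nonneg _))
        · exact (ContinuousLinearMap.le_opNorm _ _).trans
            (mul_le_mul_of_nonneg_right hy (norm_nonneg _))
    _ ≤ τ * r * r + ρ * r * r := by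
        have : ‖d.1‖ ≤ r := by rw [hr]; linarith [norm_nonneg d.2]
        have : ‖d.2‖ ≤ r := by rw [hr]; linarith [norm_nonneg d.1]
        gcongr
    _ = _ := by ring

theorem Smooth.expand_G (hS : P.Smooth L M τ ρ) (hL : 0 ≤ L) (ζ : Z) (x : Vec p) (y d : Vec q) :
    ‖P.G ζ x (y + d) - P.G ζ x y - inner ℝ (gradY (P.G ζ) x y) d‖ ≤ L * ‖d‖ ^ 2 := by
  have h2 := norm_sub_sub_le_of_fderiv_lip
    (fun y => (hS.hasGradientAt_G ζ x y).hasFDerivAt) (z := y) (d := d) (c := L * ‖d‖ ^ 2) ?_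
  · simpa using h2
  intro t ht ht1
  simp only [InnerProductSpace.toDual_apply_apply]
  rw [← inner_sub_left]
  have hy := hS.lip_gradY_G ζ x x (y + t • d) y
  simp only [sub_self, norm_zero, zero_add, add_sub_cancel_left, norm_smul,
    Real.norm_of_nonneg ht] at hy
  calc _ ≤ L * (t * ‖d‖) * ‖d‖ :=
        (norm_inner_le_norm _ _).trans (mul_le_mul_of_nonneg_right hy (norm_nonneg _))
    _ ≤ L * (1 * ‖d‖) * ‖d‖ := by gcongr
    _ = _ := by ring

end Problem

end SSGD

namespace SSGD

open Filter Topology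

namespace Problem

variable {p q : ℕ} {Ξ Z : Type*} [MeasurableSpace Ξ] [MeasurableSpace Z]
  {P : Problem p q Ξ Z} {μ L M τ ρ σf σg σg1 σg2 : ℝ}

/-- The standing assumptions, with the signs of the constants. -/
structure Standing (P : Problem p q Ξ Z) (μ L M τ ρ σf σg σg1 σg2 : ℝ) : Prop
    extends P.Assumptions μ L M τ ρ σf σg σg1 σg2 where
  μ_pos : 0 < μ
  μ_le : μ ≤ L
  M_nonneg : 0 ≤ M
  τ_nonneg : 0 ≤ τ
  ρ_nonneg : 0 ≤ ρ

theorem Standing.L_pos (h : P.Standing μ L M τ ρ σf σg σg1 σg2) : 0 < L :=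
  h.μ_pos.trans_le h.μ_le

/-! ### Measurability and expectations of the sample derivatives -/

/-- The sample expansion in the form required for differentiation under the integral; 4 is the price
of replacing the sum norm by the sup norm. -/
theorem Standing.quadratic_F (h : P.Standing μ L M τ ρ σf σg σg1 σg2) (ξ : Ξ)
    (z d : Vec p × Vec q) :
    ‖P.F ξ (z + d).1 (z + d).2 - P.F ξ z.1 z.2
      - fderiv ℝ (fun z : Vec p × Vec q => P.F ξ z.1 z.2) z d‖ ≤ 4 * L * ‖d‖ ^ 2 := by
  rw [fderiv_apply_eq_inner (h.smooth.hasFDerivAt_F ξ z)]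
  refine (h.smooth.expand_F h.L_pos.le ξ z d).trans ?_
  have := mul_le_mul_of_nonneg_left (norm_fst_add_norm_snd_sq_le d) h.L_pos.le
  linarith

theorem Standing.quadratic_G (h : P.Standing μ L M τ ρ σf σg σg1 σg2) (ζ : Z) (x : Vec p)
    (y d : Vec q) :
    ‖P.G ζ x (y + d) - P.G ζ x y - InnerProductSpace.toDual ℝ _ (gradY (P.G ζ) x y) d‖
      ≤ L * ‖d‖ ^ 2 := by
  simpa using h.smooth.expand_G h.L_pos.le ζ x y d

theorem Standing.fderiv_gradY_G (h : P.Standing μ L M τ ρ σf σg σg1 σg2) (ζ : Z)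
    (z d : Vec p × Vec q) :
    fderiv ℝ (fun z : Vec p × Vec q => gradY (P.G ζ) z.1 z.2) z d
      = ContinuousLinearMap.adjoint (mixedXY (P.G ζ) z.1 z.2) d.1
        + hessYY (P.G ζ) z.1 z.2 d.2 := by
  rw [fderiv_partial_apply (h.smooth.hasFDerivAt_gradY_G ζ z) d, mixedXY,
    ContinuousLinearMap.adjoint_adjoint]
  rfl

theorem Standing.quadratic_gradY_G (h : P.Standing μ L M τ ρ σf σg σg1 σg2) (ζ : Z)
    (z d : Vec p × Vec q) :
    ‖gradY (P.G ζ) (z + d).1 (z + d).2 - gradY (P.G ζ) z.1 z.2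
      - fderiv ℝ (fun z : Vec p × Vec q => gradY (P.G ζ) z.1 z.2) z d‖
      ≤ 4 * (τ + ρ) * ‖d‖ ^ 2 := by
  rw [h.fderiv_gradY_G]
  refine (h.smooth.expand_gradY_G h.τ_nonneg h.ρ_nonneg ζ z d).trans ?_
  have := mul_le_mul_of_nonneg_left (norm_fst_add_norm_snd_sq_le d)
    (add_nonneg h.τ_nonneg h.ρ_nonneg)
  linarith

theorem Standing.measurable_gradX_F (h : P.Standing μ L M τ ρ σf σg σg1 σg2) (x : Vec p)
    (y : Vec q) : Measurable fun ξ => gradX (P.F ξ) x y := by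
  refine measurable_of_inner fun e => ?_
  have := measurable_deriv_of_quadratic (φ := fun ξ (z : Vec p × Vec q) => P.F ξ z.1 z.2)
    (fun z => h.wellPosed.measurable_F z.1 z.2) (fun ξ d => h.quadratic_F ξ (x, y) d) (e, 0)
  simpa only [fderiv_apply_eq_inner (h.smooth.hasFDerivAt_F _ (x, y)), inner_zero_right,
    add_zero] using this

theorem Standing.measurable_gradY_F (h : P.Standing μ L M τ ρ σf σg σg1 σg2) (x : Vec p)
    (y : Vec q) : Measurable fun ξ => gradY (P.F ξ) x y := by
  refine measurable_of_inner fun e => ?_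
  have := measurable_deriv_of_quadratic (φ := fun ξ (z : Vec p × Vec q) => P.F ξ z.1 z.2)
    (fun z => h.wellPosed.measurable_F z.1 z.2) (fun ξ d => h.quadratic_F ξ (x, y) d) (0, e)
  simpa only [fderiv_apply_eq_inner (h.smooth.hasFDerivAt_F _ (x, y)), inner_zero_right,
    zero_add] using this

theorem Standing.measurable_gradY_G (h : P.Standing μ L M τ ρ σf σg σg1 σg2) (x : Vec p)
    (y : Vec q) : Measurable fun ζ => gradY (P.G ζ) x y := by
  refine measurable_of_inner fun e => ?_
  simpa using measurable_deriv_of_quadratic (φ := fun ζ y => P.G ζ x y)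
    (fun y => h.wellPosed.measurable_G x y) (fun ζ d => h.quadratic_G ζ x y d) e

theorem Standing.measurable_fderiv_gradY_G (h : P.Standing μ L M τ ρ σf σg σg1 σg2)
    (z d : Vec p × Vec q) :
    Measurable fun ζ => fderiv ℝ (fun z : Vec p × Vec q => gradY (P.G ζ) z.1 z.2) z d :=
  measurable_deriv_of_quadratic (φ := fun ζ (z : Vec p × Vec q) => gradY (P.G ζ) z.1 z.2)
    (fun z => h.measurable_gradY_G z.1 z.2) (fun ζ d => h.quadratic_gradY_G ζ z d) d

theorem Standing.measurable_hessYY_G (h : P.Standing μ L M τ ρ σf σg σg1 σg2) (x : Vec p)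
    (y u : Vec q) : Measurable fun ζ => hessYY (P.G ζ) x y u := by
  simpa [h.fderiv_gradY_G] using h.measurable_fderiv_gradY_G (x, y) (0, u)

/-- What is measurable as a limit of difference quotients is the Jacobian, the adjoint of `mixedXY`;
measurability is transferred by moving the adjoint across the inner product. -/
theorem Standing.measurable_mixedXY_G (h : P.Standing μ L M τ ρ σf σg σg1 σg2) (x : Vec p)
    (y u : Vec q) : Measurable fun ζ => mixedXY (P.G ζ) x y u := by
  refine measurable_of_inner fun e => ?_
  have := h.measurable_fderiv_gradY_G (x, y) (e, 0)
  simp only [h.fderiv_gradY_G, map_zero, add_zero] at this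
  have h2 : Measurable fun ζ =>
      inner ℝ u (ContinuousLinearMap.adjoint (mixedXY (P.G ζ) x y) e) := this.const_inner
  simpa only [ContinuousLinearMap.adjoint_inner_right] using h2

theorem Standing.integrable_gradY_G (h : P.Standing μ L M τ ρ σf σg σg1 σg2) (x : Vec p)
    (y : Vec q) : Integrable (fun ζ => gradY (P.G ζ) x y) P.lawG := by
  have := P.probG
  refine integrable_of_inner fun e => ?_
  simpa using integrable_deriv_of_quadratic (φ := fun ζ y => P.G ζ x y)
    (fun y => h.wellPosed.integrable_G x y) (fun ζ d => h.quadratic_G ζ x y d) e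

theorem Standing.hasGradientAt_g (h : P.Standing μ L M τ ρ σf σg σg1 σg2) (x : Vec p)
    (y : Vec q) : HasGradientAt (fun y' => P.g x y') (∫ ζ, gradY (P.G ζ) x y ∂P.lawG) y := by
  have := P.probG
  obtain ⟨Ψ, h1, h2⟩ := exists_hasFDerivAt_integral (φ := fun ζ y => P.G ζ x y)
    (fun y => h.wellPosed.integrable_G x y) (fun ζ d => h.quadratic_G ζ x y d)
  rw [hasGradientAt_iff_hasFDerivAt]
  have h3 : InnerProductSpace.toDual ℝ _ (∫ ζ, gradY (P.G ζ) x y ∂P.lawG) = Ψ := ?_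
  · rw [h3]
    exact h2
  ext e
  rw [h1]
  simp only [InnerProductSpace.toDual_apply_apply]
  rw [real_inner_comm, ← integral_inner (h.integrable_gradY_G x y)]
  simp only [real_inner_comm]

theorem Standing.integral_gradY_G (h : P.Standing μ L M τ ρ σf σg σg1 σg2) (x : Vec p)
    (y : Vec q) : ∫ ζ, gradY (P.G ζ) x y ∂P.lawG = gradY P.g x y :=
  (h.hasGradientAt_g x y).gradient.symm

theorem Standing.hasFDerivAt_f (h : P.Standing μ L M τ ρ σf σg σg1 σg2) (x : Vec p) (y : Vec q) :
    ∃ Ψ : Vec p × Vec q →L[ℝ] ℝ, HasFDerivAt (fun z : Vec p × Vec q => P.f z.1 z.2) Ψ (x, y) ∧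
      ∀ d, Integrable (fun ξ => inner ℝ (gradX (P.F ξ) x y) d.1
          + inner ℝ (gradY (P.F ξ) x y) d.2) P.lawF ∧
        Ψ d = ∫ ξ, inner ℝ (gradX (P.F ξ) x y) d.1 + inner ℝ (gradY (P.F ξ) x y) d.2 ∂P.lawF := by
  have := P.probF
  have hint : ∀ z : Vec p × Vec q, Integrable (fun ξ => P.F ξ z.1 z.2) P.lawF :=
    fun z => h.wellPosed.integrable_F z.1 z.2
  obtain ⟨Ψ, h1, h2⟩ := exists_hasFDerivAt_integral
    (φ := fun ξ (z : Vec p × Vec q) => P.F ξ z.1 z.2) hint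
    (fun ξ d => h.quadratic_F ξ (x, y) d)
  have h3 := integrable_deriv_of_quadratic (φ := fun ξ (z : Vec p × Vec q) => P.F ξ z.1 z.2) hint
    (fun ξ d => h.quadratic_F ξ (x, y) d)
  simp only [fderiv_apply_eq_inner (h.smooth.hasFDerivAt_F _ (x, y))] at h1 h3
  exact ⟨Ψ, h2, fun d => ⟨h3 d, h1 d⟩⟩

theorem Standing.integrable_gradX_F (h : P.Standing μ L M τ ρ σf σg σg1 σg2) (x : Vec p)
    (y : Vec q) : Integrable (fun ξ => gradX (P.F ξ) x y) P.lawF := by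
  obtain ⟨Ψ, -, h2⟩ := h.hasFDerivAt_f x y
  exact integrable_of_inner fun e => by simpa using (h2 (e, 0)).1

theorem Standing.integrable_gradY_F (h : P.Standing μ L M τ ρ σf σg σg1 σg2) (x : Vec p)
    (y : Vec q) : Integrable (fun ξ => gradY (P.F ξ) x y) P.lawF := by
  obtain ⟨Ψ, -, h2⟩ := h.hasFDerivAt_f x y
  exact integrable_of_inner fun e => by simpa using (h2 (0, e)).1

theorem Standing.integral_gradX_F (h : P.Standing μ L M τ ρ σf σg σg1 σg2) (x : Vec p)
    (y : Vec q) : ∫ ξ, gradX (P.F ξ) x y ∂P.lawF = gradX P.f x y := by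
  obtain ⟨Ψ, h1, h2⟩ := h.hasFDerivAt_f x y
  refine integral_eq_of_inner (fun e => (h.integrable_gradX_F x y).inner_const e) fun e => ?_
  have h3 := (h2 (e, 0)).2
  rw [fderiv_apply_eq_inner h1] at h3
  simpa using h3

theorem Standing.integral_gradY_F (h : P.Standing μ L M τ ρ σf σg σg1 σg2) (x : Vec p)
    (y : Vec q) : ∫ ξ, gradY (P.F ξ) x y ∂P.lawF = gradY P.f x y := by
  obtain ⟨Ψ, h1, h2⟩ := h.hasFDerivAt_f x y
  refine integral_eq_of_inner (fun e => (h.integrable_gradY_F x y).inner_const e) fun e => ?_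
  have h3 := (h2 (0, e)).2
  rw [fderiv_apply_eq_inner h1] at h3
  simpa using h3

theorem Standing.hasFDerivAt_gradY_g (h : P.Standing μ L M τ ρ σf σg σg1 σg2) (x : Vec p)
    (y : Vec q) :
    ∃ Ψ : Vec p × Vec q →L[ℝ] Vec q,
      HasFDerivAt (fun z : Vec p × Vec q => gradY P.g z.1 z.2) Ψ (x, y) ∧
      ∀ d, Integrable (fun ζ => ContinuousLinearMap.adjoint (mixedXY (P.G ζ) x y) d.1
          + hessYY (P.G ζ) x y d.2) P.lawG ∧
        Ψ d = ∫ ζ, ContinuousLinearMap.adjoint (mixedXY (P.G ζ) x y) d.1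
          + hessYY (P.G ζ) x y d.2 ∂P.lawG := by
  have := P.probG
  have hint : ∀ z : Vec p × Vec q, Integrable (fun ζ => gradY (P.G ζ) z.1 z.2) P.lawG :=
    fun z => h.integrable_gradY_G z.1 z.2
  obtain ⟨Ψ, h1, h2⟩ := exists_hasFDerivAt_integral
    (φ := fun ζ (z : Vec p × Vec q) => gradY (P.G ζ) z.1 z.2) hint
    (fun ζ d => h.quadratic_gradY_G ζ (x, y) d)
  have h3 := integrable_deriv_of_quadratic
    (φ := fun ζ (z : Vec p × Vec q) => gradY (P.G ζ) z.1 z.2) hint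
    (fun ζ d => h.quadratic_gradY_G ζ (x, y) d)
  simp only [h.fderiv_gradY_G] at h1 h3
  simp only [h.integral_gradY_G] at h2
  exact ⟨Ψ, h2, fun d => ⟨h3 d, h1 d⟩⟩

theorem Standing.integrable_hessYY_G (h : P.Standing μ L M τ ρ σf σg σg1 σg2) (x : Vec p)
    (y u : Vec q) : Integrable (fun ζ => hessYY (P.G ζ) x y u) P.lawG := by
  obtain ⟨Ψ, -, h2⟩ := h.hasFDerivAt_gradY_g x y
  simpa using (h2 (0, u)).1

theorem Standing.integral_hessYY_G (h : P.Standing μ L M τ ρ σf σg σg1 σg2) (x : Vec p)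
    (y u : Vec q) : ∫ ζ, hessYY (P.G ζ) x y u ∂P.lawG = hessYY P.g x y u := by
  obtain ⟨Ψ, h1, h2⟩ := h.hasFDerivAt_gradY_g x y
  have h3 := (h2 (0, u)).2
  rw [fderiv_partial_apply h1] at h3
  simp only [map_zero, zero_add] at h3
  exact h3.symm

theorem Standing.integrable_adjoint_mixedXY_G (h : P.Standing μ L M τ ρ σf σg σg1 σg2) (x : Vec p)
    (y : Vec q) (e : Vec p) :
    Integrable (fun ζ => ContinuousLinearMap.adjoint (mixedXY (P.G ζ) x y) e) P.lawG := by
  obtain ⟨Ψ, -, h2⟩ := h.hasFDerivAt_gradY_g x y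
  simpa using (h2 (e, 0)).1

theorem Standing.integral_adjoint_mixedXY_G (h : P.Standing μ L M τ ρ σf σg σg1 σg2) (x : Vec p)
    (y : Vec q) (e : Vec p) :
    ∫ ζ, ContinuousLinearMap.adjoint (mixedXY (P.G ζ) x y) e ∂P.lawG
      = ContinuousLinearMap.adjoint (mixedXY P.g x y) e := by
  obtain ⟨Ψ, h1, h2⟩ := h.hasFDerivAt_gradY_g x y
  have h3 := (h2 (e, 0)).2
  rw [fderiv_partial_apply h1] at h3
  simp only [map_zero, add_zero] at h3
  rw [← h3]
  conv_rhs => rw [mixedXY, ContinuousLinearMap.adjoint_adjoint]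

theorem Standing.integrable_inner_mixedXY_G (h : P.Standing μ L M τ ρ σf σg σg1 σg2) (x : Vec p)
    (y u : Vec q) (e : Vec p) :
    Integrable (fun ζ => inner ℝ (mixedXY (P.G ζ) x y u) e) P.lawG := by
  simpa only [ContinuousLinearMap.adjoint_inner_right] using
    (h.integrable_adjoint_mixedXY_G x y e).const_inner (𝕜 := ℝ) u

theorem Standing.integrable_mixedXY_G (h : P.Standing μ L M τ ρ σf σg σg1 σg2) (x : Vec p)
    (y u : Vec q) : Integrable (fun ζ => mixedXY (P.G ζ) x y u) P.lawG :=
  integrable_of_inner fun e => h.integrable_inner_mixedXY_G x y u e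

theorem Standing.integral_mixedXY_G (h : P.Standing μ L M τ ρ σf σg σg1 σg2) (x : Vec p)
    (y u : Vec q) : ∫ ζ, mixedXY (P.G ζ) x y u ∂P.lawG = mixedXY P.g x y u := by
  refine integral_eq_of_inner (fun e => h.integrable_inner_mixedXY_G x y u e) fun e => ?_
  rw [← ContinuousLinearMap.adjoint_inner_right, ← h.integral_adjoint_mixedXY_G,
    ← integral_inner (h.integrable_adjoint_mixedXY_G x y e)]
  simp only [ContinuousLinearMap.adjoint_inner_right]

/-! ### Regularity of the mean functions -/

theorem norm_integral_sub_le {S E : Type*} [MeasurableSpace S] {ν : Measure S}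
    [IsProbabilityMeasure ν] [NormedAddCommGroup E] [NormedSpace ℝ E] {φ ψ : S → E} {c : ℝ}
    (hφ : Integrable φ ν) (hψ : Integrable ψ ν) (h : ∀ s, ‖φ s - ψ s‖ ≤ c) :
    ‖∫ s, φ s ∂ν - ∫ s, ψ s ∂ν‖ ≤ c := by
  rw [← integral_sub hφ hψ]
  simpa using norm_integral_le_of_norm_le_const (μ := ν) (Eventually.of_forall h)

theorem Standing.lip_gradX_f (h : P.Standing μ L M τ ρ σf σg σg1 σg2) :
    LipXY L (gradX P.f) := fun x₁ x₂ y₁ y₂ => by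
  have := P.probF
  rw [← h.integral_gradX_F, ← h.integral_gradX_F]
  exact norm_integral_sub_le (h.integrable_gradX_F _ _) (h.integrable_gradX_F _ _)
    fun ξ => h.smooth.lip_gradX_F ξ _ _ _ _

theorem Standing.lip_gradY_f (h : P.Standing μ L M τ ρ σf σg σg1 σg2) :
    LipXY L (gradY P.f) := fun x₁ x₂ y₁ y₂ => by
  have := P.probF
  rw [← h.integral_gradY_F, ← h.integral_gradY_F]
  exact norm_integral_sub_le (h.integrable_gradY_F _ _) (h.integrable_gradY_F _ _)
    fun ξ => h.smooth.lip_gradY_F ξ _ _ _ _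

theorem Standing.lip_gradY_g (h : P.Standing μ L M τ ρ σf σg σg1 σg2) :
    LipXY L (gradY P.g) := fun x₁ x₂ y₁ y₂ => by
  have := P.probG
  rw [← h.integral_gradY_G, ← h.integral_gradY_G]
  exact norm_integral_sub_le (h.integrable_gradY_G _ _) (h.integrable_gradY_G _ _)
    fun ζ => h.smooth.lip_gradY_G ζ _ _ _ _

/-- The samplewise Lipschitz bound is averaged after applying the operators to a fixed vector, so no
integral of operators occurs. -/
theorem Standing.lip_hessYY_g (h : P.Standing μ L M τ ρ σf σg σg1 σg2) :
    LipXY ρ (hessYY P.g) := fun x₁ x₂ y₁ y₂ => by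
  have := P.probG
  have := h.ρ_nonneg
  refine ContinuousLinearMap.opNorm_le_bound _ (by positivity) fun u => ?_
  rw [sub_apply, ← h.integral_hessYY_G, ← h.integral_hessYY_G]
  refine norm_integral_sub_le (h.integrable_hessYY_G _ _ _) (h.integrable_hessYY_G _ _ _)
    fun ζ => ?_
  rw [← sub_apply]
  exact ContinuousLinearMap.le_of_opNorm_le _ (h.smooth.lip_hessYY_G ζ _ _ _ _) u

theorem Standing.lip_mixedXY_g (h : P.Standing μ L M τ ρ σf σg σg1 σg2) :
    LipXY τ (mixedXY P.g) := fun x₁ x₂ y₁ y₂ => by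
  have := P.probG
  have := h.τ_nonneg
  refine ContinuousLinearMap.opNorm_le_bound _ (by positivity) fun u => ?_
  rw [sub_apply, ← h.integral_mixedXY_G, ← h.integral_mixedXY_G]
  refine norm_integral_sub_le (h.integrable_mixedXY_G _ _ _) (h.integrable_mixedXY_G _ _ _)
    fun ζ => ?_
  rw [← sub_apply]
  exact ContinuousLinearMap.le_of_opNorm_le _ (h.smooth.lip_mixedXY_G ζ _ _ _ _) u

theorem Standing.norm_gradY_f_le (h : P.Standing μ L M τ ρ σf σg σg1 σg2) (x : Vec p)
    (y : Vec q) : ‖gradY P.f x y‖ ≤ M := by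
  have := P.probF
  rw [← h.integral_gradY_F]
  simpa using norm_integral_le_of_norm_le_const (μ := P.lawF)
    (Eventually.of_forall fun ξ => h.smooth.norm_gradY_F_le h.M_nonneg ξ x y)

theorem Standing.norm_hessYY_g_apply_le (h : P.Standing μ L M τ ρ σf σg σg1 σg2) (x : Vec p)
    (y u : Vec q) : ‖hessYY P.g x y u‖ ≤ L * ‖u‖ := by
  have := P.probG
  rw [← h.integral_hessYY_G]
  simpa using norm_integral_le_of_norm_le_const (μ := P.lawG) (Eventually.of_forall fun ζ =>
    ContinuousLinearMap.le_of_opNorm_le _ (h.smooth.norm_hessYY_G_le h.L_pos.le ζ x y) u)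

theorem Standing.norm_mixedXY_g_apply_le (h : P.Standing μ L M τ ρ σf σg σg1 σg2) (x : Vec p)
    (y u : Vec q) : ‖mixedXY P.g x y u‖ ≤ L * ‖u‖ := by
  have := P.probG
  rw [← h.integral_mixedXY_G]
  simpa using norm_integral_le_of_norm_le_const (μ := P.lawG) (Eventually.of_forall fun ζ =>
    ContinuousLinearMap.le_of_opNorm_le _ (h.smooth.norm_mixedXY_G_le h.L_pos.le ζ x y) u)

theorem Standing.strongConvexOn_g (h : P.Standing μ L M τ ρ σf σg σg1 σg2) (x : Vec p) :
    StrongConvexOn Set.univ μ fun y => P.g x y := by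
  have := P.probG
  refine ⟨convex_univ, fun y _ y' _ a b ha hb hab => ?_⟩
  have h1 : ∀ ζ, P.G ζ x (a • y + b • y')
      ≤ a * P.G ζ x y + b * P.G ζ x y' - a * b * (μ / 2 * ‖y - y'‖ ^ 2) :=
    fun ζ => (h.stronglyConvex ζ x).2 (Set.mem_univ y) (Set.mem_univ y') ha hb hab
  have hi := fun y => h.wellPosed.integrable_G x y
  have h2 := integral_mono (hi (a • y + b • y'))
    ((((hi y).const_mul a).add ((hi y').const_mul b)).sub
      (integrable_const (a * b * (μ / 2 * ‖y - y'‖ ^ 2)))) h1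
  simp only [Pi.sub_apply, Pi.add_apply] at h2
  rw [integral_sub (f := fun ζ => a * P.G ζ x y + b * P.G ζ x y')
    (((hi y).const_mul a).add ((hi y').const_mul b)) (integrable_const _),
    integral_add ((hi y).const_mul a) ((hi y').const_mul b)] at h2
  simp only [integral_const_mul, integral_const, probReal_univ, one_smul] at h2
  exact h2

theorem Standing.hasGradientAt_gradY_g (h : P.Standing μ L M τ ρ σf σg σg1 σg2) (x : Vec p)
    (y : Vec q) : HasGradientAt (fun y' => P.g x y') (gradY P.g x y) y := by
  rw [← h.integral_gradY_G]
  exact h.hasGradientAt_g x y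

theorem Standing.hasFDerivAt_hessYY_g (h : P.Standing μ L M τ ρ σf σg σg1 σg2) (x : Vec p)
    (y : Vec q) : HasFDerivAt (fun y' => gradY P.g x y') (hessYY P.g x y) y := by
  obtain ⟨Ψ, h1, -⟩ := h.hasFDerivAt_gradY_g x y
  have h3 : HasFDerivAt (fun y' : Vec q => (x, y')) (ContinuousLinearMap.inr ℝ (Vec p) (Vec q)) y :=
    hasFDerivAt_prodMk_right x y
  exact (HasFDerivAt.comp (g := fun z : Vec p × Vec q => gradY P.g z.1 z.2) y
    h1 h3).differentiableAt.hasFDerivAt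

theorem Standing.hessYY_g_symm (h : P.Standing μ L M τ ρ σf σg σg1 σg2) (x : Vec p)
    (y u w : Vec q) : inner ℝ (hessYY P.g x y u) w = inner ℝ u (hessYY P.g x y w) :=
  hessian_symmetric (fun y => h.hasGradientAt_gradY_g x y) (h.hasFDerivAt_hessYY_g x y) u w

theorem Standing.le_hessYY_g (h : P.Standing μ L M τ ρ σf σg σg1 σg2) (x : Vec p)
    (y u : Vec q) : μ * ‖u‖ ^ 2 ≤ inner ℝ (hessYY P.g x y u) u :=
  strongConvexOn_hessian_lower (h.strongConvexOn_g x) (fun y => h.hasGradientAt_gradY_g x y)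
    (h.hasFDerivAt_hessYY_g x y) u

theorem Standing.expand_f (h : P.Standing μ L M τ ρ σf σg σg1 σg2) (x dx : Vec p)
    (y dy : Vec q) :
    ‖P.f (x + dx) (y + dy) - P.f x y - (inner ℝ (gradX P.f x y) dx + inner ℝ (gradY P.f x y) dy)‖
      ≤ L * (‖dx‖ + ‖dy‖) ^ 2 := by
  have := P.probF
  obtain ⟨Ψ, h1, h2⟩ := h.hasFDerivAt_f x y
  have h3 := (h2 (dx, dy)).2
  rw [fderiv_apply_eq_inner h1] at h3
  rw [h3]
  exact norm_integral_sub_le_of_quadratic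
    (φ := fun ξ (z : Vec p × Vec q) => P.F ξ z.1 z.2) (x := (x, y)) (x' := (x + dx, y + dy))
    (fun z => h.wellPosed.integrable_F z.1 z.2) (h2 (dx, dy)).1
    (fun ξ => h.smooth.expand_F h.L_pos.le ξ (x, y) (dx, dy))

theorem Standing.expand_gradY_g (h : P.Standing μ L M τ ρ σf σg σg1 σg2) (x dx : Vec p)
    (y dy : Vec q) :
    ‖gradY P.g (x + dx) (y + dy) - gradY P.g x y
      - (ContinuousLinearMap.adjoint (mixedXY P.g x y) dx + hessYY P.g x y dy)‖
      ≤ (τ + ρ) * (‖dx‖ + ‖dy‖) ^ 2 := by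
  have := P.probG
  rw [← h.integral_adjoint_mixedXY_G, ← h.integral_hessYY_G,
    ← integral_add (h.integrable_adjoint_mixedXY_G _ _ _) (h.integrable_hessYY_G _ _ _),
    ← h.integral_gradY_G, ← h.integral_gradY_G]
  exact norm_integral_sub_le_of_quadratic
    (φ := fun ζ (z : Vec p × Vec q) => gradY (P.G ζ) z.1 z.2) (x := (x, y))
    (x' := (x + dx, y + dy)) (fun z => h.integrable_gradY_G z.1 z.2)
    ((h.integrable_adjoint_mixedXY_G _ _ _).add (h.integrable_hessYY_G _ _ _))
    (fun ζ => h.smooth.expand_gradY_G h.τ_nonneg h.ρ_nonneg ζ (x, y) (dx, dy))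

end Problem

end SSGD

namespace SSGD

open Filter Topology

namespace Problem

variable {p q : ℕ} {Ξ Z : Type*} [MeasurableSpace Ξ] [MeasurableSpace Z]
  {P : Problem p q Ξ Z} {μ L M τ ρ σf σg σg1 σg2 : ℝ}

/-! ### The lower level solution -/

/-- The gradient step has derivative I − β∇_y²g, of norm at most 1 − βμ; apply the mean value
inequality. -/
theorem Standing.norm_gradient_step_sub_le (h : P.Standing μ L M τ ρ σf σg σg1 σg2) {β : ℝ}
    (hβ : 0 ≤ β) (hβ' : β * (μ + L) ≤ 2) (x : Vec p) (y y' : Vec q) :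
    ‖(y - β • gradY P.g x y) - (y' - β • gradY P.g x y')‖ ≤ (1 - β * μ) * ‖y - y'‖ := by
  refine Convex.norm_image_sub_le_of_norm_hasFDerivWithin_le (𝕜 := ℝ) (s := Set.univ)
    (f := fun y => y - β • gradY P.g x y)
    (f' := fun y => ContinuousLinearMap.id ℝ (Vec q) - β • hessYY P.g x y)
    (fun y _ => ((hasFDerivAt_id y).sub
      ((h.hasFDerivAt_hessYY_g x y).const_smul β)).hasFDerivWithinAt) (fun y _ => ?_)
    convex_univ (Set.mem_univ y') (Set.mem_univ y)
  have h1 : 0 ≤ 1 - β * μ := by nlinarith [h.μ_le]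
  refine ContinuousLinearMap.opNorm_le_bound _ h1 fun u => ?_
  simpa using norm_sub_smul_apply_le (hessYY P.g x y) (h.hessYY_g_symm x y) (h.le_hessYY_g x y)
    (h.norm_hessYY_g_apply_le x y) hβ hβ' u

/-- Fixed points of the gradient step are zeros of the gradient, and with step 1/L the map is a
contraction. -/
theorem Standing.exists_gradY_g_eq_zero (h : P.Standing μ L M τ ρ σf σg σg1 σg2) (x : Vec p) :
    ∃ y, gradY P.g x y = 0 := by
  have hL := h.L_pos
  have hμ := h.μ_pos
  have h1 : 0 ≤ 1 - 1 / L * μ := by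
    rw [sub_nonneg, one_div_mul_eq_div, div_le_one hL]; exact h.μ_le
  have h2 : 1 - 1 / L * μ < 1 := by
    have : 0 < 1 / L * μ := by positivity
    linarith
  have hc : ContractingWith (1 - 1 / L * μ).toNNReal fun y => y - (1 / L) • gradY P.g x y := by
    refine ⟨by rw [← NNReal.coe_lt_coe, Real.coe_toNNReal _ h1]; exact_mod_cast h2,
      LipschitzWith.of_dist_le_mul fun y y' => ?_⟩
    rw [dist_eq_norm, dist_eq_norm, Real.coe_toNNReal _ h1]
    refine h.norm_gradient_step_sub_le (by positivity) ?_ x y y'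
    rw [one_div_mul_eq_div, div_le_iff₀ hL]
    linarith [h.μ_le]
  have h3 : _ - (1 / L) • gradY P.g x _ = _ := hc.fixedPoint_isFixedPt
  refine ⟨ContractingWith.fixedPoint _ hc, ?_⟩
  rw [sub_eq_self, smul_eq_zero] at h3
  exact h3.resolve_left (by positivity)

/-- A zero of the gradient is a global minimiser by strong convexity, so the choice defining `yStar`
is not vacuous; Fermat's rule then applies to the chosen minimiser. -/
theorem Standing.gradY_g_yStar (h : P.Standing μ L M τ ρ σf σg σg1 σg2) (x : Vec p) :
    gradY P.g x (P.yStar x) = 0 := by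
  obtain ⟨y₀, hy₀⟩ := h.exists_gradY_g_eq_zero x
  have h1 : ∀ y', P.g x y₀ ≤ P.g x y' := fun y' => by
    have := strongConvexOn_first_order (h.strongConvexOn_g x) (h.hasGradientAt_gradY_g x y₀) y'
    rw [hy₀, inner_zero_left] at this
    have h3 : 0 ≤ μ / 2 * ‖y' - y₀‖ ^ 2 := by have := h.μ_pos; positivity
    linarith
  have h2 : ∀ y', P.g x (P.yStar x) ≤ P.g x y' :=
    Classical.epsilon_spec (p := fun y => ∀ y', P.g x y ≤ P.g x y') ⟨y₀, h1⟩
  have h3 : IsLocalMin (fun y => P.g x y) (P.yStar x) := Eventually.of_forall h2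
  have h4 := h3.hasFDerivAt_eq_zero (h.hasGradientAt_gradY_g x _).hasFDerivAt
  simpa using h4

theorem Standing.le_norm_gradY_g_sub (h : P.Standing μ L M τ ρ σf σg σg1 σg2) (x : Vec p)
    (y y' : Vec q) : μ * ‖y' - y‖ ≤ ‖gradY P.g x y' - gradY P.g x y‖ := by
  have h1 := strongConvexOn_gradient_monotone (h.strongConvexOn_g x)
    (h.hasGradientAt_gradY_g x y) (h.hasGradientAt_gradY_g x y')
  have h2 := real_inner_le_norm (gradY P.g x y' - gradY P.g x y) (y' - y)
  by_cases h0 : y' - y = 0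
  · rw [h0, norm_zero, mul_zero]; positivity
  have h3 : 0 < ‖y' - y‖ := norm_pos_iff.2 h0
  refine le_of_mul_le_mul_right ?_ h3
  nlinarith

/-- At fixed x, strong monotonicity compares y*(x) with y*(x'). The gradient at (x, y*(x')) is small
because it vanishes at (x', y*(x')). -/
theorem Standing.norm_yStar_sub_le (h : P.Standing μ L M τ ρ σf σg σg1 σg2) (x x' : Vec p) :
    ‖P.yStar x - P.yStar x'‖ ≤ L / μ * ‖x - x'‖ := by
  have h1 := h.le_norm_gradY_g_sub x (P.yStar x') (P.yStar x)
  rw [h.gradY_g_yStar, ← h.gradY_g_yStar x', norm_sub_rev (gradY _ _ _)] at h1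
  have h2 := h.lip_gradY_g x x' (P.yStar x') (P.yStar x')
  rw [sub_self, norm_zero, add_zero] at h2
  rw [div_mul_eq_mul_div, le_div_iff₀ h.μ_pos]
  linarith

/-! ### The solution of the linear system -/

/-- The solution `v` of `∇_y² g(x, y) v = ∇_y f(x, y)`. -/
noncomputable def vStar (P : Problem p q Ξ Z) (x : Vec p) (y : Vec q) : Vec q :=
  Classical.epsilon fun v => hessYY P.g x y v = gradY P.f x y

theorem Standing.le_norm_hessYY_g (h : P.Standing μ L M τ ρ σf σg σg1 σg2) (x : Vec p)
    (y u : Vec q) : μ * ‖u‖ ≤ ‖hessYY P.g x y u‖ := by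
  have h1 := h.le_hessYY_g x y u
  have h2 := real_inner_le_norm (hessYY P.g x y u) u
  by_cases h0 : u = 0
  · simp [h0]
  have h3 : 0 < ‖u‖ := norm_pos_iff.2 h0
  refine le_of_mul_le_mul_right ?_ h3
  nlinarith

/-- The lower bound μ makes the Hessian injective, hence surjective in finite dimension. -/
theorem Standing.hessYY_g_vStar (h : P.Standing μ L M τ ρ σf σg σg1 σg2) (x : Vec p)
    (y : Vec q) : hessYY P.g x y (P.vStar x y) = gradY P.f x y := by
  have h1 : Function.Injective (hessYY P.g x y : Vec q →ₗ[ℝ] Vec q) := by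
    rw [injective_iff_map_eq_zero]
    intro u hu
    have h2 := h.le_norm_hessYY_g x y u
    have h3 : hessYY P.g x y u = 0 := hu
    rw [h3, norm_zero] at h2
    have h4 : ‖u‖ ≤ 0 := nonpos_of_mul_nonpos_right h2 h.μ_pos
    exact norm_le_zero_iff.1 h4
  obtain ⟨v, hv⟩ := LinearMap.injective_iff_surjective.1 h1 (gradY P.f x y)
  exact Classical.epsilon_spec (p := fun v => hessYY P.g x y v = gradY P.f x y) ⟨v, hv⟩

theorem Standing.norm_vStar_le (h : P.Standing μ L M τ ρ σf σg σg1 σg2) (x : Vec p)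
    (y : Vec q) : ‖P.vStar x y‖ ≤ M / μ := by
  have h1 := h.le_norm_hessYY_g x y (P.vStar x y)
  rw [h.hessYY_g_vStar] at h1
  rw [le_div_iff₀ h.μ_pos]
  linarith [h.norm_gradY_f_le x y]

/-- Perturbation of a linear system: if Hv = c and H'v' = c', then H(v − v') = (c − c') − (H −
H')v', with ‖v'‖ ≤ M/μ and H bounded below by μ. The Hessian perturbation makes the constant of
order κ². -/
theorem Standing.lip_vStar (h : P.Standing μ L M τ ρ σf σg σg1 σg2) :
    LipXY (L / μ + ρ * M / μ ^ 2) P.vStar := fun x x' y y' => by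
  have hμ := h.μ_pos
  have h1 := h.le_norm_hessYY_g x y (P.vStar x y - P.vStar x' y')
  have h2 : hessYY P.g x y (P.vStar x y - P.vStar x' y')
      = (gradY P.f x y - gradY P.f x' y')
        - (hessYY P.g x y - hessYY P.g x' y') (P.vStar x' y') := by
    rw [map_sub, h.hessYY_g_vStar, sub_apply, h.hessYY_g_vStar]; abel
  have h3 := h.lip_gradY_f x x' y y'
  have h4 : ‖(hessYY P.g x y - hessYY P.g x' y') (P.vStar x' y')‖
      ≤ ρ * (‖x - x'‖ + ‖y - y'‖) * (M / μ) := by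
    refine (ContinuousLinearMap.le_of_opNorm_le _ (h.lip_hessYY_g x x' y y') _).trans ?_
    have := h.ρ_nonneg
    gcongr
    exact h.norm_vStar_le x' y'
  rw [h2] at h1
  have h5 := h1.trans ((norm_sub_le _ _).trans (add_le_add h3 h4))
  refine le_of_mul_le_mul_left (h5.trans_eq ?_) hμ
  field_simp

/-! ### The hypergradient -/

/-- The mean direction of the upper level step. -/
noncomputable def meanDir (P : Problem p q Ξ Z) (x : Vec p) (y v : Vec q) : Vec p :=
  gradX P.f x y - mixedXY P.g x y v

/-- The solution `v` of the linear system at `(x, y*(x))`. -/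
noncomputable def vSol (P : Problem p q Ξ Z) (x : Vec p) : Vec q := P.vStar x (P.yStar x)

/-- The gradient of the bilevel objective. -/
noncomputable def hyperGrad (P : Problem p q Ξ Z) (x : Vec p) : Vec p :=
  P.meanDir x (P.yStar x) (P.vSol x)

/-- The change of a product is split so that only v' multiplies the difference of the two Jacobians;
hence only v' must be bounded. -/
theorem Standing.norm_meanDir_sub_le (h : P.Standing μ L M τ ρ σf σg σg1 σg2)
    (x x' : Vec p) (y y' v v' : Vec q) (hv' : ‖v'‖ ≤ M / μ) :
    ‖P.meanDir x y v - P.meanDir x' y' v'‖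
      ≤ (L + τ * M / μ) * (‖x - x'‖ + ‖y - y'‖) + L * ‖v - v'‖ := by
  have h2 : P.meanDir x y v - P.meanDir x' y' v'
      = (gradX P.f x y - gradX P.f x' y') - (mixedXY P.g x y - mixedXY P.g x' y') v'
        - mixedXY P.g x y (v - v') := by
    rw [meanDir, meanDir, map_sub, sub_apply]; abel
  have h3 := h.lip_gradX_f x x' y y'
  have h4 : ‖(mixedXY P.g x y - mixedXY P.g x' y') v'‖
      ≤ τ * (‖x - x'‖ + ‖y - y'‖) * (M / μ) := by
    refine (ContinuousLinearMap.le_of_opNorm_le _ (h.lip_mixedXY_g x x' y y') _).trans ?_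
    have := h.τ_nonneg
    gcongr
  have h5 := h.norm_mixedXY_g_apply_le x y (v - v')
  rw [h2]
  calc _ ≤ L * (‖x - x'‖ + ‖y - y'‖) + τ * (‖x - x'‖ + ‖y - y'‖) * (M / μ) + L * ‖v - v'‖ :=
        (norm_sub_le _ _).trans (add_le_add ((norm_sub_le _ _).trans (add_le_add h3 h4)) h5)
    _ = _ := by ring

theorem Standing.norm_meanDir_sub_hyperGrad_le (h : P.Standing μ L M τ ρ σf σg σg1 σg2)
    (x : Vec p) (y v : Vec q) :
    ‖P.meanDir x y v - P.hyperGrad x‖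
      ≤ (L + τ * M / μ) * ‖y - P.yStar x‖ + L * ‖v - P.vSol x‖ := by
  have := h.norm_meanDir_sub_le x x y (P.yStar x) v (P.vSol x) (h.norm_vStar_le _ _)
  simpa [hyperGrad] using this

/-- The target of the linear system is off for two reasons: x has moved, and the system is posed at
y instead of y*(x'). Both are allowed for at once, so the estimate serves before the linear system
loop (x ≠ x') and after it (x = x'). -/
theorem Standing.norm_vSol_sub_vStar_le (h : P.Standing μ L M τ ρ σf σg σg1 σg2)
    (x x' : Vec p) (y : Vec q) :
    ‖P.vSol x - P.vStar x' y‖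
      ≤ (L / μ + ρ * M / μ ^ 2) * ((1 + L / μ) * ‖x - x'‖ + ‖y - P.yStar x'‖) := by
  refine (h.lip_vStar x x' (P.yStar x) y).trans ?_
  have hL := h.L_pos
  have hμ := h.μ_pos
  have hM := h.M_nonneg
  have hρ := h.ρ_nonneg
  have h1 : ‖P.yStar x - y‖ ≤ L / μ * ‖x - x'‖ + ‖y - P.yStar x'‖ := by
    have : P.yStar x - y = (P.yStar x - P.yStar x') - (y - P.yStar x') := by abel
    rw [this]
    exact (norm_sub_le _ _).trans (by gcongr; exact h.norm_yStar_sub_le x x')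
  exact mul_le_mul_of_nonneg_left (by linarith) (by positivity)

/-- Serves continuity and square integrability of the hypergradient; the descent estimate uses the
Taylor bound for Φ instead. -/
theorem Standing.norm_hyperGrad_sub_le (h : P.Standing μ L M τ ρ σf σg σg1 σg2)
    (x x' : Vec p) :
    ‖P.hyperGrad x - P.hyperGrad x'‖
      ≤ ((L + τ * M / μ) * (1 + L / μ) + L * ((L / μ + ρ * M / μ ^ 2) * (1 + L / μ)))
        * ‖x - x'‖ := by
  have hL := h.L_pos
  have hμ := h.μ_pos
  have hM := h.M_nonneg
  have hτ := h.τ_nonneg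
  have h1 := h.norm_meanDir_sub_le x x' (P.yStar x) (P.yStar x') (P.vSol x) (P.vSol x')
    (h.norm_vStar_le _ _)
  have h2 := h.norm_yStar_sub_le x x'
  have h3 := h.norm_vSol_sub_vStar_le x x' (P.yStar x')
  rw [sub_self, norm_zero, add_zero] at h3
  calc _ ≤ _ := h1
    _ ≤ (L + τ * M / μ) * (‖x - x'‖ + L / μ * ‖x - x'‖)
        + L * ((L / μ + ρ * M / μ ^ 2) * ((1 + L / μ) * ‖x - x'‖)) := by
      gcongr
      exact h3
    _ = _ := by ring

/-- Adjoint method without an implicit function theorem: y* is never differentiated, only its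
Lipschitz bound enters. Expanding f leaves ⟨∇_y f, dy⟩ with dy unknown to first order, and pairing
the expanded optimality condition with v(x) trades this term for one in dx. -/
theorem Standing.norm_Φ_sub_sub_le (h : P.Standing μ L M τ ρ σf σg σg1 σg2) (x dx : Vec p) :
    ‖P.Φ (x + dx) - P.Φ x - inner ℝ (P.hyperGrad x) dx‖
      ≤ (L + M / μ * (τ + ρ)) * (1 + L / μ) ^ 2 * ‖dx‖ ^ 2 := by
  have hL := h.L_pos
  have hμ := h.μ_pos
  have hM := h.M_nonneg
  have hτ := h.τ_nonneg
  have hρ := h.ρ_nonneg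
  set y := P.yStar x with hy
  set dy := P.yStar (x + dx) - y with hdy
  set v := P.vSol x with hv
  have hydy : y + dy = P.yStar (x + dx) := by rw [hdy]; abel
  have h1 := h.expand_f x dx y dy
  have h2 := h.expand_gradY_g x dx y dy
  have h3 : ‖dy‖ ≤ L / μ * ‖dx‖ := by
    simpa using h.norm_yStar_sub_le (x + dx) x
  have h4 : (‖dx‖ + ‖dy‖) ^ 2 ≤ (1 + L / μ) ^ 2 * ‖dx‖ ^ 2 := by
    rw [← mul_pow]; gcongr; linarith
  -- ∇_y g vanishes at both ends of the move, so its first order part is itself a quadratic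
  -- remainder.
  rw [hydy, h.gradY_g_yStar, hy, h.gradY_g_yStar, ← hy, sub_self, zero_sub, norm_neg] at h2
  -- Substitute ∇_y f = ∇_y²g v, and use symmetry of the Hessian to move it onto dy.
  have h5 : inner ℝ (gradY P.f x y) dy
      = inner ℝ v (ContinuousLinearMap.adjoint (mixedXY P.g x y) dx + hessYY P.g x y dy)
        - inner ℝ (mixedXY P.g x y v) dx := by
    rw [inner_add_right, ContinuousLinearMap.adjoint_inner_right, ← h.hessYY_g_symm, hv, vSol,
      h.hessYY_g_vStar]
    ring
  have h6 : ‖inner ℝ v (ContinuousLinearMap.adjoint (mixedXY P.g x y) dx + hessYY P.g x y dy)‖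
      ≤ M / μ * ((τ + ρ) * (‖dx‖ + ‖dy‖) ^ 2) :=
    (norm_inner_le_norm _ _).trans
      (mul_le_mul (h.norm_vStar_le _ _) h2 (norm_nonneg _) (by positivity))
  have h7 : P.Φ (x + dx) - P.Φ x - inner ℝ (P.hyperGrad x) dx
      = (P.f (x + dx) (y + dy) - P.f x y
          - (inner ℝ (gradX P.f x y) dx + inner ℝ (gradY P.f x y) dy))
        + inner ℝ v (ContinuousLinearMap.adjoint (mixedXY P.g x y) dx + hessYY P.g x y dy) := by
    rw [h5, hydy, hyperGrad, meanDir, inner_sub_left, Φ, Φ]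
    ring
  rw [h7]
  calc _ ≤ L * (‖dx‖ + ‖dy‖) ^ 2 + M / μ * ((τ + ρ) * (‖dx‖ + ‖dy‖) ^ 2) :=
        (norm_add_le _ _).trans (add_le_add h1 h6)
    _ = (L + M / μ * (τ + ρ)) * (‖dx‖ + ‖dy‖) ^ 2 := by ring
    _ ≤ (L + M / μ * (τ + ρ)) * ((1 + L / μ) ^ 2 * ‖dx‖ ^ 2) := by gcongr
    _ = _ := by ring

theorem Standing.hasGradientAt_Φ (h : P.Standing μ L M τ ρ σf σg σg1 σg2) (x : Vec p) :
    HasGradientAt P.Φ (P.hyperGrad x) x := by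
  rw [hasGradientAt_iff_hasFDerivAt]
  exact hasFDerivAt_of_quadratic fun d => by simpa using h.norm_Φ_sub_sub_le x d

theorem Standing.gradient_Φ (h : P.Standing μ L M τ ρ σf σg σg1 σg2) :
    gradient P.Φ = P.hyperGrad := funext fun x => (h.hasGradientAt_Φ x).gradient

theorem continuous_of_norm_sub_le {E F : Type*} [NormedAddCommGroup E] [NormedAddCommGroup F]
    {f : E → F} {c : ℝ} (hf : ∀ x x', ‖f x - f x'‖ ≤ c * ‖x - x'‖) : Continuous f :=
  (LipschitzWith.of_dist_le_mul (K := |c|.toNNReal) fun x x' => by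
    rw [dist_eq_norm, dist_eq_norm, Real.coe_toNNReal _ (abs_nonneg c)]
    exact (hf x x').trans (by gcongr; exact le_abs_self c)).continuous

theorem Standing.continuous_yStar (h : P.Standing μ L M τ ρ σf σg σg1 σg2) :
    Continuous P.yStar :=
  continuous_of_norm_sub_le h.norm_yStar_sub_le

theorem Standing.continuous_vStar (h : P.Standing μ L M τ ρ σf σg σg1 σg2) :
    Continuous fun z : Vec p × Vec q => P.vStar z.1 z.2 :=
  h.lip_vStar.continuous

theorem Standing.continuous_vSol (h : P.Standing μ L M τ ρ σf σg σg1 σg2) :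
    Continuous P.vSol := by
  refine continuous_of_norm_sub_le (c := (L / μ + ρ * M / μ ^ 2) * (1 + L / μ)) fun x x' => ?_
  have h3 := h.norm_vSol_sub_vStar_le x x' (P.yStar x')
  rw [sub_self, norm_zero, add_zero, ← mul_assoc] at h3
  exact h3

theorem Standing.continuous_hyperGrad (h : P.Standing μ L M τ ρ σf σg σg1 σg2) :
    Continuous P.hyperGrad :=
  continuous_of_norm_sub_le h.norm_hyperGrad_sub_le

end Problem

end SSGD

namespace SSGD

open Filter Topology

/-! ### Independence of the samples -/

section Sampling

variable {p q : ℕ} {Ξ Z Ω : Type*} [MeasurableSpace Ξ] [MeasurableSpace Z]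

/-- The σ-algebra generated by one of the samples. -/
abbrev sampleSigma (ξ : DrawF → Ω → Ξ) (ζ : DrawG → Ω → Z) : DrawF ⊕ DrawG → MeasurableSpace Ω :=
  Sum.elim (fun d => MeasurableSpace.comap (ξ d) inferInstance)
    (fun d => MeasurableSpace.comap (ζ d) inferInstance)

/-- The σ-algebra generated by a set of samples. -/
abbrev past (ξ : DrawF → Ω → Ξ) (ζ : DrawG → Ω → Z) (S : Set (DrawF ⊕ DrawG)) : MeasurableSpace Ω :=
  ⨆ i ∈ S, sampleSigma ξ ζ i

variable {ξ : DrawF → Ω → Ξ} {ζ : DrawG → Ω → Z}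

theorem past_mono {S S' : Set (DrawF ⊕ DrawG)} (h : S ⊆ S') : past ξ ζ S ≤ past ξ ζ S' :=
  biSup_mono h

theorem measurable_past_inl {S : Set (DrawF ⊕ DrawG)} {d : DrawF} (h : Sum.inl d ∈ S) :
    Measurable[past ξ ζ S] (ξ d) :=
  Measurable.mono (comap_measurable (ξ d)) (le_biSup (sampleSigma ξ ζ) h) le_rfl

theorem measurable_past_inr {S : Set (DrawF ⊕ DrawG)} {d : DrawG} (h : Sum.inr d ∈ S) :
    Measurable[past ξ ζ S] (ζ d) :=
  Measurable.mono (comap_measurable (ζ d)) (le_biSup (sampleSigma ξ ζ) h) le_rfl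

variable [MeasurableSpace Ω] {P : Problem p q Ξ Z} {Pr : Measure Ω}

theorem IsSampling.isProbabilityMeasure (h : IsSampling P Pr ξ ζ) : IsProbabilityMeasure Pr := by
  have := P.probF
  have h1 := h.lawF (.outer 0 0)
  refine ⟨?_⟩
  rw [← measure_univ (μ := P.lawF), ← h1.map_eq, Measure.map_apply h1.measurable .univ,
    Set.preimage_univ]

theorem IsSampling.sampleSigma_le (h : IsSampling P Pr ξ ζ) (i : DrawF ⊕ DrawG) :
    sampleSigma ξ ζ i ≤ ‹MeasurableSpace Ω› := by
  rcases i with d | d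
  · exact (h.lawF d).measurable.comap_le
  · exact (h.lawG d).measurable.comap_le

theorem IsSampling.past_le (h : IsSampling P Pr ξ ζ) (S : Set (DrawF ⊕ DrawG)) :
    past ξ ζ S ≤ ‹MeasurableSpace Ω› :=
  iSup₂_le fun i _ => h.sampleSigma_le i

/-- A finite intersection of events splits into a part depending on the family ξ and one depending
on the family ζ. Independence of the two families separates the parts, and independence within each
family factors them. -/
theorem IsSampling.iIndep (h : IsSampling P Pr ξ ζ) : iIndep (sampleSigma ξ ζ) Pr := by
  rw [iIndep_iff]
  intro s f hf
  have hF := (iIndepFun_iff_iIndep _ _ _).1 h.indepF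
  have hG := (iIndepFun_iff_iIndep _ _ _).1 h.indepG
  have h1 : ⋂ i ∈ s, f i
      = (⋂ d ∈ s.toLeft, f (Sum.inl d)) ∩ ⋂ d ∈ s.toRight, f (Sum.inr d) := by
    ext ω
    simp [Sum.forall]
  have h2 : MeasurableSet[MeasurableSpace.comap (fun ω d => ξ d ω) inferInstance]
      (⋂ d ∈ s.toLeft, f (Sum.inl d)) := by
    refine Finset.measurableSet_biInter _ fun d hd => ?_
    obtain ⟨t, ht, htf⟩ := hf (Sum.inl d) (by simpa using hd)
    exact ⟨(fun g => g d) ⁻¹' t, measurable_pi_apply d ht, htf⟩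
  have h3 : MeasurableSet[MeasurableSpace.comap (fun ω d => ζ d ω) inferInstance]
      (⋂ d ∈ s.toRight, f (Sum.inr d)) := by
    refine Finset.measurableSet_biInter _ fun d hd => ?_
    obtain ⟨t, ht, htf⟩ := hf (Sum.inr d) (by simpa using hd)
    exact ⟨(fun g => g d) ⁻¹' t, measurable_pi_apply d ht, htf⟩
  rw [h1, ((Indep_iff _ _ _).1 ((IndepFun_iff_Indep _ _ _).1 h.indepFG)) _ _ h2 h3,
    hF.meas_biInter fun d hd => hf (Sum.inl d) (by simpa using hd),
    hG.meas_biInter fun d hd => hf (Sum.inr d) (by simpa using hd)]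
  conv_rhs => rw [← Finset.toLeft_disjSum_toRight (u := s)]
  rw [Finset.prod_disjSum]

theorem IsSampling.indep (h : IsSampling P Pr ξ ζ) {S : Set (DrawF ⊕ DrawG)} {i : DrawF ⊕ DrawG}
    (hi : i ∉ S) : Indep (past ξ ζ S) (sampleSigma ξ ζ i) Pr := by
  have := indep_iSup_of_disjoint h.sampleSigma_le h.iIndep
    (S := S) (T := {i}) (Set.disjoint_singleton_right.2 hi)
  simpa [past] using this

end Sampling

/-! ### Centred noise -/

section Noise

variable {Ω : Type*} {m₀ mΩ : MeasurableSpace Ω} {Pr : Measure Ω} {n : ℕ}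

/-- `N` is square integrable with second moment at most `s`, and orthogonal to everything that is
measurable with respect to `m`. -/
structure Noise (Pr : Measure Ω) (m : MeasurableSpace Ω) (N : Ω → Vec n) (s : ℝ) : Prop where
  memLp : MemLp N 2 Pr
  orth : ∀ U : Ω → Vec n, Measurable[m] U → MemLp U 2 Pr → ∫ ω, inner ℝ (U ω) (N ω) ∂Pr = 0
  var : ∫ ω, ‖N ω‖ ^ 2 ∂Pr ≤ s

theorem integrable_norm_sq {U : Ω → Vec n} (hU : MemLp U 2 Pr) :
    Integrable (fun ω => ‖U ω‖ ^ 2) Pr := hU.integrable_norm_pow two_ne_zero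

theorem integrable_inner {U V : Ω → Vec n} (hU : MemLp U 2 Pr) (hV : MemLp V 2 Pr) :
    Integrable (fun ω => inner ℝ (U ω) (V ω)) Pr := by
  refine Integrable.mono' ((integrable_norm_sq hU).add (integrable_norm_sq hV))
    (hU.aestronglyMeasurable.inner hV.aestronglyMeasurable) (Eventually.of_forall fun ω => ?_)
  refine (norm_inner_le_norm _ _).trans ?_
  simp only [Pi.add_apply]
  nlinarith [sq_nonneg (‖U ω‖ - ‖V ω‖), sq_nonneg (‖U ω‖ + ‖V ω‖)]

theorem integral_norm_add_sq {U V : Ω → Vec n} (hU : MemLp U 2 Pr) (hV : MemLp V 2 Pr) :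
    ∫ ω, ‖U ω + V ω‖ ^ 2 ∂Pr
      = ∫ ω, ‖U ω‖ ^ 2 ∂Pr + 2 * ∫ ω, inner ℝ (U ω) (V ω) ∂Pr + ∫ ω, ‖V ω‖ ^ 2 ∂Pr := by
  simp only [norm_add_sq_real]
  rw [integral_add (f := fun ω => ‖U ω‖ ^ 2 + 2 * inner ℝ (U ω) (V ω))
    ((integrable_norm_sq hU).add ((integrable_inner hU hV).const_mul 2)) (integrable_norm_sq hV),
    integral_add (integrable_norm_sq hU) ((integrable_inner hU hV).const_mul 2),
    integral_const_mul]

theorem Noise.integral_norm_add_sq_le {m : MeasurableSpace Ω} {N : Ω → Vec n} {s : ℝ}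
    (hN : Noise Pr m N s) {U : Ω → Vec n} (hU : Measurable[m] U) (hU2 : MemLp U 2 Pr) :
    ∫ ω, ‖U ω + N ω‖ ^ 2 ∂Pr ≤ ∫ ω, ‖U ω‖ ^ 2 ∂Pr + s := by
  rw [integral_norm_add_sq hU2 hN.memLp, hN.orth U hU hU2]
  linarith [hN.var]

theorem Noise.zero (m : MeasurableSpace Ω) : Noise Pr m (fun _ => (0 : Vec n)) 0 where
  memLp := MemLp.zero
  orth U _ _ := by simp
  var := by simp

/-- N is known at the later stage m', to which N' is orthogonal, so the cross term vanishes and the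
variances add. -/
theorem Noise.add {m m' : MeasurableSpace Ω} (hm : m ≤ m') {N N' : Ω → Vec n} {s s' : ℝ}
    (hN : Noise Pr m N s) (hN' : Noise Pr m' N' s') (hNm : Measurable[m'] N) :
    Noise Pr m (fun ω => N ω + N' ω) (s + s') where
  memLp := hN.memLp.add hN'.memLp
  orth U hU hU2 := by
    simp only [inner_add_right]
    rw [integral_add (integrable_inner hU2 hN.memLp) (integrable_inner hU2 hN'.memLp),
      hN.orth U hU hU2, hN'.orth U (hU.mono hm le_rfl) hU2, add_zero]
  var := (hN'.integral_norm_add_sq_le hNm hN.memLp).trans (by linarith [hN.var])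

theorem Noise.smul {m : MeasurableSpace Ω} {N : Ω → Vec n} {s : ℝ} (hN : Noise Pr m N s) (c : ℝ) :
    Noise Pr m (fun ω => c • N ω) (c ^ 2 * s) where
  memLp := hN.memLp.const_smul c
  orth U hU hU2 := by
    simp only [inner_smul_right]
    rw [integral_const_mul, hN.orth U hU hU2, mul_zero]
  var := by
    simp only [norm_smul, mul_pow, Real.norm_eq_abs, sq_abs]
    rw [integral_const_mul]
    exact mul_le_mul_of_nonneg_left hN.var (sq_nonneg c)

variable {A S : Type*} [MeasurableSpace A] [MeasurableSpace S] {ν : Measure S}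

/-- A family of random elements `φ a`, with means and variances. -/
structure Oracle (ν : Measure S) (φ : A → S → Vec n) (mean : A → Vec n) : Prop where
  measurable : Measurable (Function.uncurry φ)
  measurable_mean : Measurable mean
  integrable : ∀ a, Integrable (φ a) ν
  integral_eq : ∀ a, ∫ s, φ a s ∂ν = mean a
  integrable_sq : ∀ a, Integrable (fun s => ‖φ a s - mean a‖ ^ 2) ν

/-- Freezing lemma in place of conditional expectations: a fresh sample is independent of the past,
so joint laws are products, and integrating over the sample first gives mean zero and variance at
most V for each frozen argument. -/
theorem Oracle.noise_of_indep [IsProbabilityMeasure Pr] {φ : A → S → Vec n} {mean : A → Vec n}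
    (hφ : Oracle ν φ mean) (hm : m₀ ≤ mΩ) {X : Ω → S}
    (hX : MeasurePreserving X Pr ν) (hind : Indep m₀ (MeasurableSpace.comap X inferInstance) Pr)
    {a : Ω → A} (ha : Measurable[m₀] a) {V : ℝ}
    (hV : ∀ ω, ∫ s, ‖φ (a ω) s - mean (a ω)‖ ^ 2 ∂ν ≤ V) :
    Noise Pr m₀ (fun ω => φ (a ω) (X ω) - mean (a ω)) V := by
  have hν : IsProbabilityMeasure ν := by
    rw [← hX.map_eq]; exact Measure.isProbabilityMeasure_map hX.aemeasurable
  have hΨ : Measurable fun b : A × S => φ b.1 b.2 - mean b.1 :=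
    hφ.measurable.sub (hφ.measurable_mean.comp measurable_fst)
  have hΨ2 : Measurable fun b : A × S => ‖φ b.1 b.2 - mean b.1‖ ^ 2 := hΨ.norm.pow_const 2
  have ha' : Measurable a := ha.mono hm le_rfl
  -- Stated for any past quantity b: the variance needs b = a, the orthogonality needs b = (U, a).
  have hprod : ∀ {B : Type _} [MeasurableSpace B] {b : Ω → B} (_ : Measurable[m₀] b),
      Pr.map (fun ω => (b ω, X ω)) = (Pr.map b).prod ν := by
    intro B _ b hb
    have h1 : IndepFun b X Pr :=
      (IndepFun_iff_Indep _ _ _).2 (indep_of_indep_of_le_left hind hb.comap_le)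
    rw [(indepFun_iff_map_prod_eq_prod_map_map (hb.mono hm le_rfl).aemeasurable
      hX.aemeasurable).1 h1, hX.map_eq]
  have hpa : IsProbabilityMeasure (Pr.map a) := Measure.isProbabilityMeasure_map ha'.aemeasurable
  have haX : Measurable fun ω => (a ω, X ω) := ha'.prodMk hX.measurable
  have hsm : StronglyMeasurable fun b : A => ∫ s, ‖φ b s - mean b‖ ^ 2 ∂ν :=
    StronglyMeasurable.integral_prod_right (f := fun b s => ‖φ b s - mean b‖ ^ 2)
      hΨ2.stronglyMeasurable
  have hint : Integrable (fun b : A × S => ‖φ b.1 b.2 - mean b.1‖ ^ 2) ((Pr.map a).prod ν) := by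
    rw [integrable_prod_iff hΨ2.aestronglyMeasurable]
    refine ⟨Eventually.of_forall fun b => hφ.integrable_sq b, ?_⟩
    simp only [norm_pow, norm_norm]
    -- The variance is bounded by V only at values taken by a, hence almost everywhere for the law
    -- of a but not at every argument.
    refine Integrable.mono' (integrable_const V) hsm.aestronglyMeasurable ?_
    rw [ae_map_iff ha'.aemeasurable (measurableSet_le hsm.measurable.norm measurable_const)]
    refine Eventually.of_forall fun ω => ?_
    rw [Real.norm_of_nonneg (integral_nonneg fun s => by positivity)]
    exact hV ω
  have hint' : Integrable (fun ω => ‖φ (a ω) (X ω) - mean (a ω)‖ ^ 2) Pr := by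
    rw [← hprod ha] at hint
    exact hint.comp_measurable haX
  have hmem : MemLp (fun ω => φ (a ω) (X ω) - mean (a ω)) 2 Pr :=
    (memLp_two_iff_integrable_sq_norm (hΨ.comp haX).aestronglyMeasurable).2 hint'
  refine ⟨hmem, fun U hU hU2 => ?_, ?_⟩
  · have hb : Measurable[m₀] fun ω => (U ω, a ω) := hU.prodMk ha
    have hb' : Measurable fun ω => (U ω, a ω) := hb.mono hm le_rfl
    have hbX : Measurable fun ω => ((U ω, a ω), X ω) := hb'.prodMk hX.measurable
    have hf : Measurable fun b : (Vec n × A) × S =>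
        (inner ℝ b.1.1 (φ b.1.2 b.2 - mean b.1.2) : ℝ) :=
      (measurable_fst.comp measurable_fst).inner
        (hΨ.comp ((measurable_snd.comp measurable_fst).prodMk measurable_snd))
    have h1 := integrable_inner hU2 hmem
    have h2 : Integrable (fun b : (Vec n × A) × S =>
        (inner ℝ b.1.1 (φ b.1.2 b.2 - mean b.1.2) : ℝ)) ((Pr.map fun ω => (U ω, a ω)).prod ν) := by
      rw [← hprod hb, integrable_map_measure hf.aestronglyMeasurable hbX.aemeasurable]
      exact h1
    have hpb : IsProbabilityMeasure (Pr.map fun ω => (U ω, a ω)) :=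
      Measure.isProbabilityMeasure_map hb'.aemeasurable
    calc ∫ ω, inner ℝ (U ω) (φ (a ω) (X ω) - mean (a ω)) ∂Pr
        = ∫ b, inner ℝ b.1.1 (φ b.1.2 b.2 - mean b.1.2) ∂(Pr.map fun ω => ((U ω, a ω), X ω)) :=
          (integral_map hbX.aemeasurable hf.aestronglyMeasurable).symm
      _ = ∫ b, ∫ s, inner ℝ b.1 (φ b.2 s - mean b.2) ∂ν ∂(Pr.map fun ω => (U ω, a ω)) := by
          rw [hprod hb, integral_prod _ h2]
      _ = 0 := by
          refine integral_eq_zero_of_ae (Eventually.of_forall fun b => ?_)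
          have h3 : Integrable (fun s => φ b.2 s - mean b.2) ν :=
            (hφ.integrable b.2).sub (integrable_const _)
          simp only [Pi.zero_apply]
          rw [integral_inner h3, integral_sub (hφ.integrable b.2) (integrable_const _),
            hφ.integral_eq]
          simp
  · calc ∫ ω, ‖φ (a ω) (X ω) - mean (a ω)‖ ^ 2 ∂Pr
        = ∫ b, ‖φ b.1 b.2 - mean b.1‖ ^ 2 ∂(Pr.map fun ω => (a ω, X ω)) :=
          (integral_map haX.aemeasurable hΨ2.aestronglyMeasurable).symm
      _ = ∫ b, ∫ s, ‖φ b s - mean b‖ ^ 2 ∂ν ∂(Pr.map a) := by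
          rw [hprod ha, integral_prod _ hint]
      _ = ∫ ω, ∫ s, ‖φ (a ω) s - mean (a ω)‖ ^ 2 ∂ν ∂Pr :=
          integral_map ha'.aemeasurable hsm.aestronglyMeasurable
      _ ≤ ∫ _, V ∂Pr := by
          refine integral_mono_of_nonneg (Eventually.of_forall fun ω =>
            integral_nonneg fun s => by positivity) (integrable_const V)
            (Eventually.of_forall hV)
      _ = V := by simp

theorem Oracle.measurable_sum {φ : A → S → Vec n} {mean : A → Vec n} (hφ : Oracle ν φ mean)
    {m : ℕ → MeasurableSpace Ω} (hmono : Monotone m) {X : ℕ → Ω → S}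
    (hXm : ∀ i, Measurable[m (i + 1)] (X i)) {a : Ω → A} (ha : Measurable[m 0] a) (k : ℕ) :
    Measurable[m k] fun ω => ∑ i ∈ Finset.range k, (φ (a ω) (X i ω) - mean (a ω)) := by
  refine Finset.measurable_sum _ fun i hi => ?_
  have h1 : Measurable[m k] (X i) :=
    (hXm i).mono (hmono (Nat.succ_le_of_lt (Finset.mem_range.1 hi))) le_rfl
  have h2 : Measurable[m k] a := ha.mono (hmono (Nat.zero_le k)) le_rfl
  exact (hφ.measurable.comp (h2.prodMk h1)).sub (hφ.measurable_mean.comp h2)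

/-- The average over a batch of fresh samples deviates from its mean by a centred noise. -/
theorem Oracle.noise_batchMean [IsProbabilityMeasure Pr] {φ : A → S → Vec n} {mean : A → Vec n}
    (hφ : Oracle ν φ mean) {m : ℕ → MeasurableSpace Ω} (hmono : Monotone m) (hm : ∀ i, m i ≤ mΩ)
    {X : ℕ → Ω → S} (hX : ∀ i, MeasurePreserving (X i) Pr ν)
    (hXm : ∀ i, Measurable[m (i + 1)] (X i))
    (hind : ∀ i, Indep (m i) (MeasurableSpace.comap (X i) inferInstance) Pr)
    {a : Ω → A} (ha : Measurable[m 0] a) {V : ℝ}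
    (hV : ∀ ω, ∫ s, ‖φ (a ω) s - mean (a ω)‖ ^ 2 ∂ν ≤ V) {k : ℕ} (hk : 1 ≤ k) :
    Noise Pr (m 0) (fun ω => batchMean k (fun i => φ (a ω) (X i ω)) - mean (a ω)) (V / k) := by
  -- The σ-algebras m i grow by one sample at a time, so the deviations are added one by one by
  -- `Noise.add`.
  have h1 : ∀ k : ℕ, Noise Pr (m 0)
      (fun ω => ∑ i ∈ Finset.range k, (φ (a ω) (X i ω) - mean (a ω))) (k * V) := by
    intro k
    induction k with
    | zero => simpa using Noise.zero (m 0)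
    | succ k ih =>
      have h2 := hφ.noise_of_indep (hm k) (hX k) (hind k)
        (ha.mono (hmono (Nat.zero_le k)) le_rfl) hV
      have h3 := Noise.add (hmono (Nat.zero_le k)) ih h2 (hφ.measurable_sum hmono hXm ha k)
      simp only [Finset.sum_range_succ]
      convert h3 using 1
      push_cast; ring
  have hk' : (0 : ℝ) < k := by exact_mod_cast hk
  have h2 := (h1 k).smul (k : ℝ)⁻¹
  convert h2 using 1
  · ext1 ω
    rw [Finset.sum_sub_distrib, smul_sub, batchMean, Finset.sum_const, Finset.card_range,
      ← Nat.cast_smul_eq_nsmul ℝ, smul_smul, inv_mul_cancel₀ hk'.ne', one_smul]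
  · field_simp

end Noise

end SSGD

namespace SSGD

open Filter Topology

namespace Problem

variable {p q : ℕ} {Ξ Z : Type*} [MeasurableSpace Ξ] [MeasurableSpace Z]
  {P : Problem p q Ξ Z} {μ L M τ ρ σf σg σg1 σg2 : ℝ}

/-! ### The stochastic oracles -/

/-- Carathéodory functions are jointly measurable; needed because an oracle is evaluated at a random
point. -/
theorem measurable_uncurry_of_continuous {A S : Type*} [TopologicalSpace A]
    [TopologicalSpace.MetrizableSpace A] [SecondCountableTopology A] [MeasurableSpace A]
    [OpensMeasurableSpace A] [MeasurableSpace S] {n : ℕ} {φ : A → S → Vec n}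
    (hc : ∀ s, Continuous fun a => φ a s) (hm : ∀ a, Measurable (φ a)) :
    Measurable (Function.uncurry φ) :=
  measurable_uncurry_of_continuous_of_measurable (u := φ) hc hm

theorem continuous_fst_pair {n : ℕ} {φ : Vec p → Vec q → Vec n} {c : ℝ} (h : LipXY c φ) :
    Continuous fun a : Vec p × Vec q × Vec q => φ a.1 a.2.1 :=
  h.continuous.comp (continuous_fst.prodMk (continuous_fst.comp continuous_snd))

theorem continuous_apply_of_lipXY {m : ℕ} {A : Vec p → Vec q → Vec q →L[ℝ] Vec m} {c : ℝ}
    (hA : LipXY c A) : Continuous fun a : Vec p × Vec q × Vec q => A a.1 a.2.1 a.2.2 :=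
  (hA.continuous.comp (continuous_fst.prodMk (continuous_fst.comp continuous_snd))).clm_apply
    (continuous_snd.comp continuous_snd)

theorem Standing.oracle_gradX_F (h : P.Standing μ L M τ ρ σf σg σg1 σg2) :
    Oracle P.lawF (fun (a : Vec p × Vec q × Vec q) ξ => gradX (P.F ξ) a.1 a.2.1)
      (fun a => gradX P.f a.1 a.2.1) where
  measurable := measurable_uncurry_of_continuous
    (fun ξ => continuous_fst_pair (h.smooth.lip_gradX_F ξ)) fun _ => h.measurable_gradX_F _ _
  measurable_mean := (continuous_fst_pair h.lip_gradX_f).measurable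
  integrable _ := h.integrable_gradX_F _ _
  integral_eq _ := h.integral_gradX_F _ _
  integrable_sq _ := (h.boundedVariance.gradX_F _ _).1

theorem Standing.oracle_gradY_F (h : P.Standing μ L M τ ρ σf σg σg1 σg2) :
    Oracle P.lawF (fun (a : Vec p × Vec q × Vec q) ξ => gradY (P.F ξ) a.1 a.2.1)
      (fun a => gradY P.f a.1 a.2.1) where
  measurable := measurable_uncurry_of_continuous
    (fun ξ => continuous_fst_pair (h.smooth.lip_gradY_F ξ)) fun _ => h.measurable_gradY_F _ _
  measurable_mean := (continuous_fst_pair h.lip_gradY_f).measurable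
  integrable _ := h.integrable_gradY_F _ _
  integral_eq _ := h.integral_gradY_F _ _
  integrable_sq _ := (h.boundedVariance.gradY_F _ _).1

theorem Standing.oracle_gradY_G (h : P.Standing μ L M τ ρ σf σg σg1 σg2) :
    Oracle P.lawG (fun (a : Vec p × Vec q × Vec q) ζ => gradY (P.G ζ) a.1 a.2.1)
      (fun a => gradY P.g a.1 a.2.1) where
  measurable := measurable_uncurry_of_continuous
    (fun ζ => continuous_fst_pair (h.smooth.lip_gradY_G ζ)) fun _ => h.measurable_gradY_G _ _
  measurable_mean := (continuous_fst_pair h.lip_gradY_g).measurable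
  integrable _ := h.integrable_gradY_G _ _
  integral_eq _ := h.integral_gradY_G _ _
  integrable_sq _ := (h.boundedVariance.gradY_G _ _).1

/-- The factor ‖u‖² is the reason why v must remain bounded along the algorithm. -/
theorem varianceLE_apply {S : Type*} [MeasurableSpace S] {ν : Measure S} {n : ℕ}
    {A : S → Vec q →L[ℝ] Vec n} {A₀ : Vec q →L[ℝ] Vec n} {s : ℝ} (hA : VarianceLE ν A A₀ s)
    (u : Vec q) (hm : Measurable fun ω => A ω u) :
    Integrable (fun ω => ‖A ω u - A₀ u‖ ^ 2) ν ∧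
      ∫ ω, ‖A ω u - A₀ u‖ ^ 2 ∂ν ≤ ‖u‖ ^ 2 * s ^ 2 := by
  have h1 : ∀ ω, ‖A ω u - A₀ u‖ ^ 2 ≤ ‖u‖ ^ 2 * ‖A ω - A₀‖ ^ 2 := fun ω => by
    rw [← sub_apply, ← mul_pow, mul_comm ‖u‖]
    gcongr
    exact ContinuousLinearMap.le_opNorm _ _
  have h2 : Integrable (fun ω => ‖u‖ ^ 2 * ‖A ω - A₀‖ ^ 2) ν := hA.1.const_mul _
  have h3 : Integrable (fun ω => ‖A ω u - A₀ u‖ ^ 2) ν :=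
    h2.mono' ((hm.sub_const _).norm.pow_const 2).aestronglyMeasurable
      (Eventually.of_forall fun ω => by
        rw [Real.norm_of_nonneg (by positivity)]; exact h1 ω)
  refine ⟨h3, (integral_mono h3 h2 h1).trans ?_⟩
  rw [integral_const_mul]
  exact mul_le_mul_of_nonneg_left hA.2 (by positivity)

theorem Standing.oracle_mixedXY_G (h : P.Standing μ L M τ ρ σf σg σg1 σg2) :
    Oracle P.lawG (fun (a : Vec p × Vec q × Vec q) ζ => mixedXY (P.G ζ) a.1 a.2.1 a.2.2)
      (fun a => mixedXY P.g a.1 a.2.1 a.2.2) where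
  measurable := measurable_uncurry_of_continuous
    (fun ζ => continuous_apply_of_lipXY (h.smooth.lip_mixedXY_G ζ))
    fun _ => h.measurable_mixedXY_G _ _ _
  measurable_mean := (continuous_apply_of_lipXY h.lip_mixedXY_g).measurable
  integrable _ := h.integrable_mixedXY_G _ _ _
  integral_eq _ := h.integral_mixedXY_G _ _ _
  integrable_sq _ := (varianceLE_apply (h.boundedVariance.mixedXY_G _ _) _
    (h.measurable_mixedXY_G _ _ _)).1

theorem Standing.oracle_hessYY_G (h : P.Standing μ L M τ ρ σf σg σg1 σg2) :
    Oracle P.lawG (fun (a : Vec p × Vec q × Vec q) ζ => hessYY (P.G ζ) a.1 a.2.1 a.2.2)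
      (fun a => hessYY P.g a.1 a.2.1 a.2.2) where
  measurable := measurable_uncurry_of_continuous
    (fun ζ => continuous_apply_of_lipXY (h.smooth.lip_hessYY_G ζ))
    fun _ => h.measurable_hessYY_G _ _ _
  measurable_mean := (continuous_apply_of_lipXY h.lip_hessYY_g).measurable
  integrable _ := h.integrable_hessYY_G _ _ _
  integral_eq _ := h.integral_hessYY_G _ _ _
  integrable_sq _ := (varianceLE_apply (h.boundedVariance.hessYY_G _ _) _
    (h.measurable_hessYY_G _ _ _)).1

end Problem

/-! ### Batches of fresh samples -/

section Batch

variable {p q : ℕ} {Ξ Z Ω : Type*} [MeasurableSpace Ξ] [MeasurableSpace Z]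
  {ξ : DrawF → Ω → Ξ} {ζ : DrawG → Ω → Z}

theorem monotone_past_batch {d : ℕ → DrawF ⊕ DrawG} (S : Set (DrawF ⊕ DrawG)) :
    Monotone fun i => past ξ ζ (S ∪ d '' Set.Iio i) := fun _ _ hij =>
  past_mono (Set.union_subset_union_right _ (Set.image_mono (Set.Iio_subset_Iio hij)))

theorem notMem_past_batch {d : ℕ → DrawF ⊕ DrawG} (hd : Function.Injective d)
    {S : Set (DrawF ⊕ DrawG)} (hS : ∀ i, d i ∉ S) (i : ℕ) : d i ∉ S ∪ d '' Set.Iio i := by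
  rintro (h | ⟨j, hj, hji⟩)
  · exact hS i h
  · exact absurd (hd hji) (ne_of_lt hj)

theorem measurable_batchMean {A B : Type*} [MeasurableSpace A] {n : ℕ} [MeasurableSpace B] {m : MeasurableSpace Ω}
    {φ : A → B → Vec n} (hφ : Measurable (Function.uncurry φ)) {X : ℕ → Ω → B}
    (hX : ∀ i, Measurable[m] (X i)) {a : Ω → A} (ha : Measurable[m] a) (k : ℕ) :
    Measurable[m] fun ω => batchMean k (fun i => φ (a ω) (X i ω)) := by
  have h1 : Measurable[m] fun ω => ∑ i ∈ Finset.range k, φ (a ω) (X i ω) :=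
    Finset.measurable_sum _ fun i _ => hφ.comp (ha.prodMk (hX i))
  exact h1.const_smul (k : ℝ)⁻¹

variable [MeasurableSpace Ω] {P : Problem p q Ξ Z} {Pr : Measure Ω}
  {A : Type*} [MeasurableSpace A] {n : ℕ}

theorem IsSampling.noise_batchMean_F (h : IsSampling P Pr ξ ζ) {φ : A → Ξ → Vec n}
    {mean : A → Vec n} (hφ : Oracle P.lawF φ mean) {d : ℕ → DrawF}
    (hd : Function.Injective d) {S : Set (DrawF ⊕ DrawG)} (hS : ∀ i, Sum.inl (d i) ∉ S)
    {a : Ω → A} (ha : Measurable[past ξ ζ S] a) {V : ℝ}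
    (hV : ∀ ω, ∫ s, ‖φ (a ω) s - mean (a ω)‖ ^ 2 ∂P.lawF ≤ V) {k : ℕ} (hk : 1 ≤ k) :
    Noise Pr (past ξ ζ S)
      (fun ω => batchMean k (fun i => φ (a ω) (ξ (d i) ω)) - mean (a ω)) (V / k) := by
  have := h.isProbabilityMeasure
  -- Stage i of the filtration adds the samples of the batch with index below i, so stage 0 is the
  -- given past.
  have h0 : past ξ ζ (S ∪ (fun i => Sum.inl (d i)) '' Set.Iio 0) = past ξ ζ S := by simp
  rw [← h0]
  rw [← h0] at ha
  exact hφ.noise_batchMean (m := fun i => past ξ ζ (S ∪ (fun i => Sum.inl (d i)) '' Set.Iio i))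
    (monotone_past_batch S) (fun i => h.past_le _) (fun i => h.lawF (d i))
    (fun i => measurable_past_inl (Or.inr ⟨i, Nat.lt_succ_self i, rfl⟩))
    (fun i => h.indep (notMem_past_batch (Sum.inl_injective.comp hd) hS i)) ha hV hk

theorem IsSampling.noise_batchMean_G (h : IsSampling P Pr ξ ζ) {φ : A → Z → Vec n}
    {mean : A → Vec n} (hφ : Oracle P.lawG φ mean) {d : ℕ → DrawG}
    (hd : Function.Injective d) {S : Set (DrawF ⊕ DrawG)} (hS : ∀ i, Sum.inr (d i) ∉ S)
    {a : Ω → A} (ha : Measurable[past ξ ζ S] a) {V : ℝ}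
    (hV : ∀ ω, ∫ s, ‖φ (a ω) s - mean (a ω)‖ ^ 2 ∂P.lawG ≤ V) {k : ℕ} (hk : 1 ≤ k) :
    Noise Pr (past ξ ζ S)
      (fun ω => batchMean k (fun i => φ (a ω) (ζ (d i) ω)) - mean (a ω)) (V / k) := by
  have := h.isProbabilityMeasure
  have h0 : past ξ ζ (S ∪ (fun i => Sum.inr (d i)) '' Set.Iio 0) = past ξ ζ S := by simp
  rw [← h0]
  rw [← h0] at ha
  exact hφ.noise_batchMean (m := fun i => past ξ ζ (S ∪ (fun i => Sum.inr (d i)) '' Set.Iio i))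
    (monotone_past_batch S) (fun i => h.past_le _) (fun i => h.lawG (d i))
    (fun i => measurable_past_inr (Or.inr ⟨i, Nat.lt_succ_self i, rfl⟩))
    (fun i => h.indep (notMem_past_batch (Sum.inr_injective.comp hd) hS i)) ha hV hk

end Batch

end SSGD

namespace SSGD

open Filter Topology

/-! ### Each kind of step as a mean step plus noise. -/

section Steps

variable {p q : ℕ} {Ξ Z Ω : Type*} [MeasurableSpace Ξ] [MeasurableSpace Z]
  {mΩ : MeasurableSpace Ω} {P : Problem p q Ξ Z} {Pr : Measure Ω} {μ L M τ ρ σf σg σg1 σg2 : ℝ}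
  {ξ : DrawF → Ω → Ξ} {ζ : DrawG → Ω → Z} {a : Params}

/-- A random state of the algorithm that is determined by the information in `m`. -/
structure RandState (Pr : Measure Ω) (m : MeasurableSpace Ω) (B : ℝ) (s : Ω → State p q) :
    Prop where
  measurable : Measurable[m] fun ω => ((s ω).x, (s ω).y, (s ω).v)
  memLp_x : MemLp (fun ω => (s ω).x) 2 Pr
  memLp_y : MemLp (fun ω => (s ω).y) 2 Pr
  norm_v_le : ∀ ω, ‖(s ω).v‖ ≤ B

theorem RandState.mono {m m' : MeasurableSpace Ω} {B : ℝ} {s : Ω → State p q}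
    (hs : RandState Pr m B s) (h : m ≤ m') : RandState Pr m' B s :=
  { hs with measurable := hs.measurable.mono h le_rfl }

theorem RandState.measurable_x {m : MeasurableSpace Ω} {B : ℝ} {s : Ω → State p q}
    (hs : RandState Pr m B s) : Measurable[m] fun ω => (s ω).x := measurable_fst.comp hs.measurable

theorem RandState.measurable_y {m : MeasurableSpace Ω} {B : ℝ} {s : Ω → State p q}
    (hs : RandState Pr m B s) : Measurable[m] fun ω => (s ω).y :=
  measurable_fst.comp (measurable_snd.comp hs.measurable)

theorem RandState.measurable_v {m : MeasurableSpace Ω} {B : ℝ} {s : Ω → State p q}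
    (hs : RandState Pr m B s) : Measurable[m] fun ω => (s ω).v :=
  measurable_snd.comp (measurable_snd.comp hs.measurable)

theorem memLp_of_norm_le [IsFiniteMeasure Pr] {n k l : ℕ} {f : Ω → Vec n} (hf : Measurable f)
    {X : Ω → Vec k} {Y : Ω → Vec l} (hX : MemLp X 2 Pr) (hY : MemLp Y 2 Pr) {c₀ c₁ c₂ : ℝ}
    (h : ∀ ω, ‖f ω‖ ≤ c₀ + c₁ * ‖X ω‖ + c₂ * ‖Y ω‖) : MemLp f 2 Pr :=
  MemLp.mono' (((memLp_const c₀).add (hX.norm.const_mul c₁)).add (hY.norm.const_mul c₂))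
    hf.aestronglyMeasurable (Eventually.of_forall h)

theorem memLp_comp_of_lip [IsFiniteMeasure Pr] {n k : ℕ} {f : Vec k → Vec n} {c : ℝ}
    (hf : ∀ x x', ‖f x - f x'‖ ≤ c * ‖x - x'‖) {X : Ω → Vec k} (hXm : Measurable X)
    (hX : MemLp X 2 Pr) : MemLp (fun ω => f (X ω)) 2 Pr := by
  refine memLp_of_norm_le ((Problem.continuous_of_norm_sub_le hf).measurable.comp hXm) hX hX
    (c₀ := ‖f 0‖) (c₁ := c) (c₂ := 0) fun ω => ?_
  have h1 := hf (X ω) 0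
  rw [sub_zero] at h1
  have h2 : f (X ω) = f 0 + (f (X ω) - f 0) := by abel
  calc ‖f (X ω)‖ = ‖f 0 + (f (X ω) - f 0)‖ := by rw [← h2]
    _ ≤ ‖f 0‖ + c * ‖X ω‖ := (norm_add_le _ _).trans (by gcongr)
    _ = _ := by ring

theorem memLp_comp_of_lipXY [IsFiniteMeasure Pr] {n : ℕ} {f : Vec p → Vec q → Vec n} {c : ℝ}
    (hf : LipXY c f) {X : Ω → Vec p} {Y : Ω → Vec q} (hXm : Measurable X) (hYm : Measurable Y)
    (hX : MemLp X 2 Pr) (hY : MemLp Y 2 Pr) : MemLp (fun ω => f (X ω) (Y ω)) 2 Pr := by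
  refine memLp_of_norm_le (hf.continuous.measurable.comp (hXm.prodMk hYm)) hX hY
    (c₀ := ‖f 0 0‖) (c₁ := c) (c₂ := c) fun ω => ?_
  have h1 := hf (X ω) 0 (Y ω) 0
  rw [sub_zero, sub_zero] at h1
  have h2 : f (X ω) (Y ω) = f 0 0 + (f (X ω) (Y ω) - f 0 0) := by abel
  calc ‖f (X ω) (Y ω)‖ = ‖f 0 0 + (f (X ω) (Y ω) - f 0 0)‖ := by rw [← h2]
    _ ≤ ‖f 0 0‖ + c * (‖X ω‖ + ‖Y ω‖) := (norm_add_le _ _).trans (by gcongr)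
    _ = _ := by ring

theorem memLp_of_bound_const [IsFiniteMeasure Pr] {n : ℕ} {f : Ω → Vec n} (hf : Measurable f)
    {c : ℝ} (h : ∀ ω, ‖f ω‖ ≤ c) : MemLp f 2 Pr :=
  MemLp.of_bound hf.aestronglyMeasurable c (Eventually.of_forall h)

theorem RandState.memLp_meanDir {m : MeasurableSpace Ω} (hm : m ≤ mΩ) [IsFiniteMeasure Pr]
    (h : P.Standing μ L M τ ρ σf σg σg1 σg2) {B : ℝ} {s : Ω → State p q}
    (hs : RandState Pr m B s) :
    MemLp (fun ω => P.meanDir (s ω).x (s ω).y (s ω).v) 2 Pr := by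
  have hs' := hs.mono hm
  have h1 := h.oracle_mixedXY_G.measurable_mean.comp hs'.measurable
  have h2 : MemLp (fun ω => gradX P.f (s ω).x (s ω).y) 2 Pr :=
    memLp_comp_of_lipXY h.lip_gradX_f hs'.measurable_x hs'.measurable_y hs.memLp_x hs.memLp_y
  refine h2.sub (memLp_of_bound_const (c := L * B) h1 fun ω => ?_)
  exact (h.norm_mixedXY_g_apply_le _ _ _).trans
    (mul_le_mul_of_nonneg_left (hs.norm_v_le ω) h.L_pos.le)

theorem sq_norm_mul_le {n : ℕ} {v : Vec n} {B s : ℝ} (hv : ‖v‖ ≤ B) :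
    ‖v‖ ^ 2 * s ^ 2 ≤ B ^ 2 * s ^ 2 := by
  have := norm_nonneg v
  gcongr

/-- The step uses two batches. Their noises are added by first enlarging the past by the ξ-samples,
with respect to which the ζ-batch is still fresh. -/
theorem RandState.upperStep (hI : IsSampling P Pr ξ ζ) (h : P.Standing μ L M τ ρ σf σg σg1 σg2)
    {S S' : Set (DrawF ⊕ DrawG)} {B : ℝ} {s : Ω → State p q} (hs : RandState Pr (past ξ ζ S) B s)
    {dF : ℕ → DrawF} {dG : ℕ → DrawG} (hdF : Function.Injective dF) (hdG : Function.Injective dG)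
    (hSS : S ⊆ S') (hF : ∀ i, Sum.inl (dF i) ∉ S) (hF' : ∀ i, Sum.inl (dF i) ∈ S')
    (hG : ∀ i, Sum.inr (dG i) ∉ S) (hG' : ∀ i, Sum.inr (dG i) ∈ S')
    (hDf : 1 ≤ a.Df) (hDg : 1 ≤ a.Dg) :
    RandState Pr (past ξ ζ S') B
      (fun ω => upperStep P a (fun i => ξ (dF i) ω) (fun i => ζ (dG i) ω) (s ω)) ∧
    ∃ N : Ω → Vec p, Noise Pr (past ξ ζ S) N (σf ^ 2 / a.Df + B ^ 2 * σg1 ^ 2 / a.Dg) ∧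
      ∀ ω, (SSGD.upperStep P a (fun i => ξ (dF i) ω) (fun i => ζ (dG i) ω) (s ω)).x
        = (s ω).x - a.α • (P.meanDir (s ω).x (s ω).y (s ω).v + N ω) := by
  have := hI.isProbabilityMeasure
  have hmS := past_mono (ξ := ξ) (ζ := ζ) hSS
  have hle := hI.past_le S
  set S₁ : Set (DrawF ⊕ DrawG) := S ∪ Set.range (fun i => Sum.inl (dF i)) with hS₁
  have hSS₁ : S ⊆ S₁ := Set.subset_union_left
  have hmS₁ := past_mono (ξ := ξ) (ζ := ζ) hSS₁
  have hG₁ : ∀ i, Sum.inr (dG i) ∉ S₁ := fun i hi => by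
    rcases hi with hi | ⟨j, hj⟩
    · exact hG i hi
    · simp at hj
  have n1 := hI.noise_batchMean_F h.oracle_gradX_F hdF hF hs.measurable (V := σf ^ 2)
    (fun ω => (h.boundedVariance.gradX_F _ _).2) hDf
  have n2 := hI.noise_batchMean_G h.oracle_mixedXY_G hdG hG₁ (hs.measurable.mono hmS₁ le_rfl)
    (V := B ^ 2 * σg1 ^ 2)
    (fun ω => (Problem.varianceLE_apply (h.boundedVariance.mixedXY_G _ _) _
      (h.measurable_mixedXY_G _ _ _)).2.trans (sq_norm_mul_le (hs.norm_v_le ω))) hDg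
  have m1 : Measurable[past ξ ζ S₁] fun ω => batchMean a.Df (fun i =>
      gradX (P.F (ξ (dF i) ω)) (s ω).x (s ω).y) - gradX P.f (s ω).x (s ω).y :=
    (measurable_batchMean h.oracle_gradX_F.measurable
      (fun i => measurable_past_inl (Or.inr ⟨i, rfl⟩)) (hs.measurable.mono hmS₁ le_rfl) _).sub
      (h.oracle_gradX_F.measurable_mean.comp (hs.measurable.mono hmS₁ le_rfl))
  have n3 := n1.add hmS₁ (n2.smul (-1)) m1
  have hxm : Measurable[past ξ ζ S'] fun ω =>
      (SSGD.upperStep P a (fun i => ξ (dF i) ω) (fun i => ζ (dG i) ω) (s ω)).x :=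
    (hs.measurable_x.mono hmS le_rfl).sub
      (((measurable_batchMean h.oracle_gradX_F.measurable (fun i => measurable_past_inl (hF' i))
        (hs.measurable.mono hmS le_rfl) _).sub
        (measurable_batchMean h.oracle_mixedXY_G.measurable (fun i => measurable_past_inr (hG' i))
          (hs.measurable.mono hmS le_rfl) _)).const_smul a.α)
  have hx : ∀ ω, (SSGD.upperStep P a (fun i => ξ (dF i) ω) (fun i => ζ (dG i) ω) (s ω)).x
      = (s ω).x - a.α • (P.meanDir (s ω).x (s ω).y (s ω).v +
        ((batchMean a.Df (fun i => gradX (P.F (ξ (dF i) ω)) (s ω).x (s ω).y)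
          - gradX P.f (s ω).x (s ω).y)
        + (-1 : ℝ) • (batchMean a.Dg (fun i => mixedXY (P.G (ζ (dG i) ω)) (s ω).x (s ω).y (s ω).v)
          - mixedXY P.g (s ω).x (s ω).y (s ω).v))) := by
    intro ω
    simp only [SSGD.upperStep, Problem.meanDir]
    congr 2
    module
  refine ⟨⟨hxm.prodMk ((hs.measurable_y.mono hmS le_rfl).prodMk
    (hs.measurable_v.mono hmS le_rfl)), ?_, hs.memLp_y, hs.norm_v_le⟩, _, ?_, hx⟩
  · simp only [hx]
    exact hs.memLp_x.sub (((hs.memLp_meanDir hle h).add n3.memLp).const_smul a.α)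
  · convert n3 using 1
    ring

theorem RandState.lowerStep (hI : IsSampling P Pr ξ ζ) (h : P.Standing μ L M τ ρ σf σg σg1 σg2)
    {S S' : Set (DrawF ⊕ DrawG)} {B : ℝ} {s : Ω → State p q} (hs : RandState Pr (past ξ ζ S) B s)
    {dG : ℕ → DrawG} (hdG : Function.Injective dG) (hSS : S ⊆ S')
    (hG : ∀ i, Sum.inr (dG i) ∉ S) (hG' : ∀ i, Sum.inr (dG i) ∈ S') (hD : 1 ≤ a.S) :
    RandState Pr (past ξ ζ S') B (fun ω => lowerStep P a (fun i => ζ (dG i) ω) (s ω)) ∧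
    ∃ N : Ω → Vec q, Noise Pr (past ξ ζ S) N (σg ^ 2 / a.S) ∧
      ∀ ω, (SSGD.lowerStep P a (fun i => ζ (dG i) ω) (s ω)).y
        = (s ω).y - a.β • (gradY P.g (s ω).x (s ω).y + N ω) := by
  have := hI.isProbabilityMeasure
  have hmS := past_mono (ξ := ξ) (ζ := ζ) hSS
  have hle := hI.past_le S
  have n1 := hI.noise_batchMean_G h.oracle_gradY_G hdG hG hs.measurable (V := σg ^ 2)
    (fun ω => (h.boundedVariance.gradY_G _ _).2) hD
  have hym : Measurable[past ξ ζ S'] fun ω =>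
      (SSGD.lowerStep P a (fun i => ζ (dG i) ω) (s ω)).y :=
    (hs.measurable_y.mono hmS le_rfl).sub
      ((measurable_batchMean h.oracle_gradY_G.measurable (fun i => measurable_past_inr (hG' i))
          (hs.measurable.mono hmS le_rfl) _).const_smul a.β)
  have hy : ∀ ω, (SSGD.lowerStep P a (fun i => ζ (dG i) ω) (s ω)).y
      = (s ω).y - a.β • (gradY P.g (s ω).x (s ω).y +
        (batchMean a.S (fun i => gradY (P.G (ζ (dG i) ω)) (s ω).x (s ω).y)
          - gradY P.g (s ω).x (s ω).y)) := by
    intro ω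
    simp only [SSGD.lowerStep, add_sub_cancel]
  refine ⟨⟨(hs.measurable_x.mono hmS le_rfl).prodMk (hym.prodMk
    (hs.measurable_v.mono hmS le_rfl)), hs.memLp_x, ?_, hs.norm_v_le⟩, _, n1, hy⟩
  simp only [hy]
  have hs' := hs.mono hle
  exact hs.memLp_y.sub (((memLp_comp_of_lipXY h.lip_gradY_g hs'.measurable_x hs'.measurable_y
    hs.memLp_x hs.memLp_y).add n1.memLp).const_smul a.β)

theorem norm_batchMean_le {n k : ℕ} (hk : 1 ≤ k) {φ : ℕ → Vec n} {c : ℝ} (h : ∀ i, ‖φ i‖ ≤ c) :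
    ‖batchMean k φ‖ ≤ c := by
  have hk' : (0 : ℝ) < k := by exact_mod_cast hk
  rw [batchMean, norm_smul, norm_inv, Real.norm_of_nonneg hk'.le, inv_mul_le_iff₀ hk']
  refine (norm_sum_le_of_le _ fun i _ => h i).trans ?_
  simp

/-- The ball of radius M/μ is invariant for every realisation: each sampled I − ηH shrinks it by 1 −
ημ, and the added gradient has norm at most ηM = ημ · M/μ. -/
theorem norm_linearStep_le (h : P.Standing μ L M τ ρ σf σg σg1 σg2) (hη : 0 ≤ a.η)
    (hη' : a.η * (μ + L) ≤ 2) (hDf : 1 ≤ a.Df) (hD : 1 ≤ a.D) (xi : ℕ → Ξ) (zi : ℕ → Z)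
    {s : State p q} (hv : ‖s.v‖ ≤ M / μ) : ‖(linearStep P a xi zi s).v‖ ≤ M / μ := by
  have hμ := h.μ_pos
  have h1 : ∀ i, ‖s.v - a.η • hessYY (P.G (zi i)) s.x s.y s.v‖ ≤ (1 - a.η * μ) * (M / μ) := by
    intro i
    have h2 := norm_sub_smul_apply_le (hessYY (P.G (zi i)) s.x s.y)
      (h.smooth.hessYY_G_symm (zi i) s.x s.y)
      (h.smooth.le_hessYY_G h.stronglyConvex (zi i) s.x s.y)
      (ContinuousLinearMap.le_of_opNorm_le _ (h.smooth.norm_hessYY_G_le h.L_pos.le (zi i) s.x s.y))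
      hη hη' s.v
    refine h2.trans (mul_le_mul_of_nonneg_left hv ?_)
    nlinarith [h.μ_le]
  have hk' : (0 : ℝ) < a.D := by exact_mod_cast hD
  -- Writing v as its own batch average puts the contraction inside the average, sample by sample.
  have h2 : (linearStep P a xi zi s).v
      = batchMean a.D (fun i => s.v - a.η • hessYY (P.G (zi i)) s.x s.y s.v)
        + a.η • batchMean a.Df (fun i => gradY (P.F (xi i)) s.x s.y) := by
    simp only [linearStep, batchMean]
    rw [Finset.sum_sub_distrib, smul_sub, Finset.sum_const, Finset.card_range,
      ← Nat.cast_smul_eq_nsmul ℝ, smul_smul (a.D : ℝ)⁻¹, inv_mul_cancel₀ hk'.ne', one_smul,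
      ← Finset.smul_sum, smul_comm]
  rw [h2]
  calc _ ≤ (1 - a.η * μ) * (M / μ) + a.η * M := by
        refine (norm_add_le _ _).trans (add_le_add (norm_batchMean_le hD h1) ?_)
        rw [norm_smul, Real.norm_of_nonneg hη]
        exact mul_le_mul_of_nonneg_left (norm_batchMean_le hDf fun i =>
          h.smooth.norm_gradY_F_le h.M_nonneg _ _ _) hη
    _ = M / μ := by field_simp; ring

theorem RandState.linearStep (hI : IsSampling P Pr ξ ζ) (h : P.Standing μ L M τ ρ σf σg σg1 σg2)
    {S S' : Set (DrawF ⊕ DrawG)} {s : Ω → State p q}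
    (hs : RandState Pr (past ξ ζ S) (M / μ) s)
    {dF : ℕ → DrawF} {dG : ℕ → DrawG} (hdF : Function.Injective dF) (hdG : Function.Injective dG)
    (hSS : S ⊆ S') (hF : ∀ i, Sum.inl (dF i) ∉ S) (hF' : ∀ i, Sum.inl (dF i) ∈ S')
    (hG : ∀ i, Sum.inr (dG i) ∉ S) (hG' : ∀ i, Sum.inr (dG i) ∈ S') (hη : 0 ≤ a.η)
    (hη' : a.η * (μ + L) ≤ 2) (hDf : 1 ≤ a.Df) (hD : 1 ≤ a.D) :
    RandState Pr (past ξ ζ S') (M / μ)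
      (fun ω => linearStep P a (fun i => ξ (dF i) ω) (fun i => ζ (dG i) ω) (s ω)) ∧
    ∃ N : Ω → Vec q, Noise Pr (past ξ ζ S) N (σf ^ 2 / a.Df + (M / μ) ^ 2 * σg2 ^ 2 / a.D) ∧
      ∀ ω, (SSGD.linearStep P a (fun i => ξ (dF i) ω) (fun i => ζ (dG i) ω) (s ω)).v
        = (s ω).v - a.η • hessYY P.g (s ω).x (s ω).y (s ω).v
          + a.η • gradY P.f (s ω).x (s ω).y + a.η • N ω := by
  have := hI.isProbabilityMeasure
  have hmS := past_mono (ξ := ξ) (ζ := ζ) hSS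
  set S₁ : Set (DrawF ⊕ DrawG) := S ∪ Set.range (fun i => Sum.inl (dF i)) with hS₁
  have hSS₁ : S ⊆ S₁ := Set.subset_union_left
  have hmS₁ := past_mono (ξ := ξ) (ζ := ζ) hSS₁
  have hG₁ : ∀ i, Sum.inr (dG i) ∉ S₁ := fun i hi => by
    rcases hi with hi | ⟨j, hj⟩
    · exact hG i hi
    · simp at hj
  have n1 := hI.noise_batchMean_F h.oracle_gradY_F hdF hF hs.measurable (V := σf ^ 2)
    (fun ω => (h.boundedVariance.gradY_F _ _).2) hDf
  have n2 := hI.noise_batchMean_G h.oracle_hessYY_G hdG hG₁ (hs.measurable.mono hmS₁ le_rfl)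
    (V := (M / μ) ^ 2 * σg2 ^ 2)
    (fun ω => (Problem.varianceLE_apply (h.boundedVariance.hessYY_G _ _) _
      (h.measurable_hessYY_G _ _ _)).2.trans (sq_norm_mul_le (hs.norm_v_le ω))) hD
  have m1 : Measurable[past ξ ζ S₁] fun ω => batchMean a.Df (fun i =>
      gradY (P.F (ξ (dF i) ω)) (s ω).x (s ω).y) - gradY P.f (s ω).x (s ω).y :=
    (measurable_batchMean h.oracle_gradY_F.measurable
      (fun i => measurable_past_inl (Or.inr ⟨i, rfl⟩)) (hs.measurable.mono hmS₁ le_rfl) _).sub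
      (h.oracle_gradY_F.measurable_mean.comp (hs.measurable.mono hmS₁ le_rfl))
  have n3 := n1.add hmS₁ (n2.smul (-1)) m1
  have hvm : Measurable[past ξ ζ S'] fun ω =>
      (SSGD.linearStep P a (fun i => ξ (dF i) ω) (fun i => ζ (dG i) ω) (s ω)).v :=
    ((hs.measurable_v.mono hmS le_rfl).sub
      ((measurable_batchMean h.oracle_hessYY_G.measurable (fun i => measurable_past_inr (hG' i))
          (hs.measurable.mono hmS le_rfl) _).const_smul a.η)).add
      ((measurable_batchMean h.oracle_gradY_F.measurable (fun i => measurable_past_inl (hF' i))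
        (hs.measurable.mono hmS le_rfl) _).const_smul a.η)
  refine ⟨⟨(hs.measurable_x.mono hmS le_rfl).prodMk ((hs.measurable_y.mono hmS le_rfl).prodMk hvm),
    hs.memLp_x, hs.memLp_y, fun ω => norm_linearStep_le h hη hη' hDf hD _ _ (hs.norm_v_le ω)⟩,
    fun ω => (batchMean a.Df (fun i => gradY (P.F (ξ (dF i) ω)) (s ω).x (s ω).y)
          - gradY P.f (s ω).x (s ω).y)
        + (-1 : ℝ) • (batchMean a.D (fun i => hessYY (P.G (ζ (dG i) ω)) (s ω).x (s ω).y (s ω).v)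
          - hessYY P.g (s ω).x (s ω).y (s ω).v), ?_, fun ω => ?_⟩
  · convert n3 using 1
    ring
  · simp only [SSGD.linearStep]
    module

end Steps

end SSGD

namespace SSGD

open Filter Topology

/-! ### Mean squared errors and their change in one step. -/

section Errors

variable {p q : ℕ} {Ξ Z Ω : Type*} [MeasurableSpace Ξ] [MeasurableSpace Z]
  {mΩ : MeasurableSpace Ω} {P : Problem p q Ξ Z} {Pr : Measure Ω} {μ L M τ ρ σf σg σg1 σg2 : ℝ}
  {ξ : DrawF → Ω → Ξ} {ζ : DrawG → Ω → Z} {a : Params}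

/-- The mean squared error of the lower level iterate. -/
noncomputable def errY (P : Problem p q Ξ Z) (Pr : Measure Ω) (s : Ω → State p q) : ℝ :=
  ∫ ω, ‖(s ω).y - P.yStar (s ω).x‖ ^ 2 ∂Pr

/-- The mean squared error of `v` as a solution of the linear system at `(x, y*(x))`. -/
noncomputable def errV (P : Problem p q Ξ Z) (Pr : Measure Ω) (s : Ω → State p q) : ℝ :=
  ∫ ω, ‖(s ω).v - P.vSol (s ω).x‖ ^ 2 ∂Pr

/-- The mean squared error of `v` as a solution of the linear system at `(x, y)`. -/
noncomputable def errLin (P : Problem p q Ξ Z) (Pr : Measure Ω) (s : Ω → State p q) : ℝ :=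
  ∫ ω, ‖(s ω).v - P.vStar (s ω).x (s ω).y‖ ^ 2 ∂Pr

/-- The mean squared norm of the hypergradient. -/
noncomputable def sqGrad (P : Problem p q Ξ Z) (Pr : Measure Ω) (s : Ω → State p q) : ℝ :=
  ∫ ω, ‖P.hyperGrad (s ω).x‖ ^ 2 ∂Pr

/-- The mean squared bias of the upper level direction. -/
noncomputable def errDir (P : Problem p q Ξ Z) (Pr : Measure Ω) (s : Ω → State p q) : ℝ :=
  ∫ ω, ‖P.meanDir (s ω).x (s ω).y (s ω).v - P.hyperGrad (s ω).x‖ ^ 2 ∂Pr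

/-- The mean squared displacement in the upper level variable. -/
noncomputable def moveX (Pr : Measure Ω) (s s' : Ω → State p q) : ℝ :=
  ∫ ω, ‖(s' ω).x - (s ω).x‖ ^ 2 ∂Pr

theorem norm_add_sq_le_young {n : ℕ} (u w : Vec n) {θ : ℝ} (hθ : 0 < θ) :
    ‖u + w‖ ^ 2 ≤ (1 + θ) * ‖u‖ ^ 2 + (1 + 1 / θ) * ‖w‖ ^ 2 := by
  have h1 : ‖u + w‖ ^ 2 ≤ (‖u‖ + ‖w‖) ^ 2 := by gcongr; exact norm_add_le u w
  have h2 : 2 * (‖u‖ * ‖w‖) ≤ θ * ‖u‖ ^ 2 + 1 / θ * ‖w‖ ^ 2 := by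
    have h3 : θ * ‖u‖ ^ 2 + 1 / θ * ‖w‖ ^ 2 - 2 * (‖u‖ * ‖w‖)
        = 1 / θ * (θ * ‖u‖ - ‖w‖) ^ 2 := by field_simp; ring
    have h4 : 0 ≤ 1 / θ * (θ * ‖u‖ - ‖w‖) ^ 2 := by positivity
    linarith
  linarith

theorem integral_norm_add_sq_le_young {n : ℕ} {U W : Ω → Vec n} (hU : MemLp U 2 Pr)
    (hW : MemLp W 2 Pr) {θ : ℝ} (hθ : 0 < θ) :
    ∫ ω, ‖U ω + W ω‖ ^ 2 ∂Pr
      ≤ (1 + θ) * ∫ ω, ‖U ω‖ ^ 2 ∂Pr + (1 + 1 / θ) * ∫ ω, ‖W ω‖ ^ 2 ∂Pr := by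
  rw [← integral_const_mul, ← integral_const_mul, ← integral_add
    ((integrable_norm_sq hU).const_mul _) ((integrable_norm_sq hW).const_mul _)]
  exact integral_mono (integrable_norm_sq (hU.add hW))
    (((integrable_norm_sq hU).const_mul _).add ((integrable_norm_sq hW).const_mul _))
    fun ω => norm_add_sq_le_young _ _ hθ

theorem integral_sq_le_mul {n k : ℕ} {U : Ω → Vec n} {W : Ω → Vec k} (hW : MemLp W 2 Pr) {c : ℝ}
    (h : ∀ ω, ‖U ω‖ ≤ c * ‖W ω‖) :
    ∫ ω, ‖U ω‖ ^ 2 ∂Pr ≤ c ^ 2 * ∫ ω, ‖W ω‖ ^ 2 ∂Pr := by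
  rw [← integral_const_mul]
  refine integral_mono_of_nonneg (Eventually.of_forall fun ω => by positivity)
    ((integrable_norm_sq hW).const_mul _) (Eventually.of_forall fun ω => ?_)
  simp only
  rw [← mul_pow]
  have := norm_nonneg (U ω)
  gcongr
  exact h ω

variable [IsFiniteMeasure Pr]

theorem RandState.memLp_yStar (h : P.Standing μ L M τ ρ σf σg σg1 σg2) {B : ℝ}
    {s : Ω → State p q} (hs : RandState Pr mΩ B s) :
    MemLp (fun ω => P.yStar (s ω).x) 2 Pr :=
  memLp_comp_of_lip h.norm_yStar_sub_le hs.measurable_x hs.memLp_x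

theorem RandState.memLp_errY (h : P.Standing μ L M τ ρ σf σg σg1 σg2) {B : ℝ}
    {s : Ω → State p q} (hs : RandState Pr mΩ B s) :
    MemLp (fun ω => (s ω).y - P.yStar (s ω).x) 2 Pr :=
  hs.memLp_y.sub (hs.memLp_yStar h)

theorem RandState.memLp_v {B : ℝ} {s : Ω → State p q} (hs : RandState Pr mΩ B s) :
    MemLp (fun ω => (s ω).v) 2 Pr :=
  memLp_of_bound_const hs.measurable_v hs.norm_v_le

theorem RandState.memLp_vSol (h : P.Standing μ L M τ ρ σf σg σg1 σg2) {B : ℝ}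
    {s : Ω → State p q} (hs : RandState Pr mΩ B s) :
    MemLp (fun ω => P.vSol (s ω).x) 2 Pr :=
  memLp_of_bound_const (h.continuous_vSol.measurable.comp hs.measurable_x)
    fun _ => h.norm_vStar_le _ _

theorem RandState.memLp_vStar (h : P.Standing μ L M τ ρ σf σg σg1 σg2) {B : ℝ}
    {s : Ω → State p q} (hs : RandState Pr mΩ B s) :
    MemLp (fun ω => P.vStar (s ω).x (s ω).y) 2 Pr := by
  have h1 := h.continuous_vStar.measurable.comp (hs.measurable_x.prodMk hs.measurable_y)
  simp only [Function.comp_def] at h1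
  exact memLp_of_bound_const h1 fun _ => h.norm_vStar_le _ _

theorem RandState.memLp_hyperGrad (h : P.Standing μ L M τ ρ σf σg σg1 σg2) {B : ℝ}
    {s : Ω → State p q} (hs : RandState Pr mΩ B s) :
    MemLp (fun ω => P.hyperGrad (s ω).x) 2 Pr :=
  memLp_comp_of_lip h.norm_hyperGrad_sub_le hs.measurable_x hs.memLp_x

theorem RandState.integrable_Φ (h : P.Standing μ L M τ ρ σf σg σg1 σg2) {B : ℝ}
    {s : Ω → State p q} (hs : RandState Pr mΩ B s) : Integrable (fun ω => P.Φ (s ω).x) Pr := by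
  have hc : Continuous P.Φ :=
    continuous_iff_continuousAt.2 fun x => (h.hasGradientAt_Φ x).differentiableAt.continuousAt
  set c := (L + M / μ * (τ + ρ)) * (1 + L / μ) ^ 2
  refine Integrable.mono' (((integrable_const |P.Φ 0|).add
    (((hs.memLp_x.integrable one_le_two).norm.const_mul ‖P.hyperGrad 0‖))).add
      ((integrable_norm_sq hs.memLp_x).const_mul c))
    (hc.measurable.comp hs.measurable_x).aestronglyMeasurable (Eventually.of_forall fun ω => ?_)
  have h1 := h.norm_Φ_sub_sub_le 0 (s ω).x
  rw [zero_add] at h1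
  have h2 := norm_inner_le_norm (𝕜 := ℝ) (P.hyperGrad 0) (s ω).x
  simp only [Pi.add_apply, Real.norm_eq_abs] at h1 h2 ⊢
  rw [abs_le] at h1 h2 ⊢
  have h3 := abs_le.1 (le_refl |P.Φ 0|)
  constructor <;> linarith [h1.1, h1.2, h2.1, h2.2, h3.1, h3.2]

theorem errDir_le (h : P.Standing μ L M τ ρ σf σg σg1 σg2) {B : ℝ}
    {s : Ω → State p q} (hs : RandState Pr mΩ B s) :
    errDir P Pr s ≤ 2 * (L + τ * M / μ) ^ 2 * errY P Pr s + 2 * L ^ 2 * errV P Pr s := by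
  have i1 := integrable_norm_sq (hs.memLp_errY h)
  have i2 := integrable_norm_sq (hs.memLp_v.sub (hs.memLp_vSol h))
  simp only [Pi.sub_apply] at i2
  rw [errY, errV, ← integral_const_mul, ← integral_const_mul,
    ← integral_add (i1.const_mul _) (i2.const_mul _)]
  refine integral_mono_of_nonneg (Eventually.of_forall fun ω => by positivity)
    ((i1.const_mul _).add (i2.const_mul _)) (Eventually.of_forall fun ω => ?_)
  have h1 := h.norm_meanDir_sub_hyperGrad_le (s ω).x (s ω).y (s ω).v
  set u := (L + τ * M / μ) * ‖(s ω).y - P.yStar (s ω).x‖ with hu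
  set w := L * ‖(s ω).v - P.vSol (s ω).x‖ with hw
  calc ‖P.meanDir (s ω).x (s ω).y (s ω).v - P.hyperGrad (s ω).x‖ ^ 2 ≤ (u + w) ^ 2 := by gcongr
    _ ≤ 2 * u ^ 2 + 2 * w ^ 2 := by nlinarith [sq_nonneg (u - w)]
    _ = _ := by rw [hu, hw]; ring

/-- Both v and its target lie in the ball of radius M/μ. This trivial bound controls w while the
initial error of y is still large. -/
theorem errV_le (h : P.Standing μ L M τ ρ σf σg σg1 σg2) {s : Ω → State p q}
    [IsProbabilityMeasure Pr] (hs : RandState Pr mΩ (M / μ) s) :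
    errV P Pr s ≤ (2 * (M / μ)) ^ 2 := by
  have h1 : ∀ ω, ‖(s ω).v - P.vSol (s ω).x‖ ^ 2 ≤ (2 * (M / μ)) ^ 2 := fun ω => by
    have h2 : ‖(s ω).v - P.vSol (s ω).x‖ ≤ 2 * (M / μ) := by
      have := h.norm_vStar_le (s ω).x (P.yStar (s ω).x)
      refine (norm_sub_le _ _).trans ?_
      have := hs.norm_v_le ω
      rw [Problem.vSol]
      linarith
    gcongr
  calc errV P Pr s ≤ ∫ _, (2 * (M / μ)) ^ 2 ∂Pr :=
        integral_mono_of_nonneg (Eventually.of_forall fun ω => by positivity) (integrable_const _)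
          (Eventually.of_forall h1)
    _ = _ := by simp

/-! ### One step -/

/-- y*(x) is fixed by the mean gradient step, which contracts; the deviation after it is determined
by the past, so the noise only adds its variance. -/
theorem errY_contract (h : P.Standing μ L M τ ρ σf σg σg1 σg2) {m : MeasurableSpace Ω}
    (hm : m ≤ mΩ) {B β V : ℝ} (hβ : 0 ≤ β) (hβ' : β * (μ + L) ≤ 2)
    {s s' : Ω → State p q} (hs : RandState Pr m B s) {N : Ω → Vec q} (hN : Noise Pr m N V)
    (hx : ∀ ω, (s' ω).x = (s ω).x)
    (hy : ∀ ω, (s' ω).y = (s ω).y - β • (gradY P.g (s ω).x (s ω).y + N ω)) :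
    errY P Pr s' ≤ (1 - β * μ) ^ 2 * errY P Pr s + β ^ 2 * V := by
  have hs' := hs.mono hm
  set U : Ω → Vec q := fun ω =>
    ((s ω).y - β • gradY P.g (s ω).x (s ω).y) - P.yStar (s ω).x with hU
  have hg : MemLp (fun ω => gradY P.g (s ω).x (s ω).y) 2 Pr :=
    memLp_comp_of_lipXY h.lip_gradY_g hs'.measurable_x hs'.measurable_y hs.memLp_x hs.memLp_y
  have hUm : Measurable[m] U :=
    (hs.measurable_y.sub ((h.oracle_gradY_G.measurable_mean.comp hs.measurable).const_smul β)).sub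
      (h.continuous_yStar.measurable.comp hs.measurable_x)
  have hU2 : MemLp U 2 Pr := (hs.memLp_y.sub (hg.const_smul β)).sub (hs'.memLp_yStar h)
  have h1 := (hN.smul (-β)).integral_norm_add_sq_le hUm hU2
  have h2 : ∀ ω, (s' ω).y - P.yStar (s' ω).x = U ω + (-β) • N ω := fun ω => by
    rw [hx, hy, hU]; module
  have h3 : ∀ ω, ‖U ω‖ ≤ (1 - β * μ) * ‖(s ω).y - P.yStar (s ω).x‖ := fun ω => by
    have := h.norm_gradient_step_sub_le hβ hβ' (s ω).x (s ω).y (P.yStar (s ω).x)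
    rwa [h.gradY_g_yStar, smul_zero, sub_zero] at this
  have h4 : 0 ≤ 1 - β * μ := by nlinarith [h.μ_le]
  have h5 := integral_sq_le_mul (hs'.memLp_errY h) h3
  simp only [errY, h2]
  rw [neg_sq] at h1
  exact h1.trans (add_le_add h5 le_rfl)

/-- The fixed point of the mean step is `vStar` at the current (x, y), not the solution at y*(x);
this is why `errLin` and `errV` are distinguished. -/
theorem errLin_contract (h : P.Standing μ L M τ ρ σf σg σg1 σg2) {m : MeasurableSpace Ω}
    (hm : m ≤ mΩ) {B η V : ℝ} (hη : 0 ≤ η) (hη' : η * (μ + L) ≤ 2)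
    {s s' : Ω → State p q} (hs : RandState Pr m B s) {N : Ω → Vec q} (hN : Noise Pr m N V)
    (hx : ∀ ω, (s' ω).x = (s ω).x) (hy : ∀ ω, (s' ω).y = (s ω).y)
    (hv : ∀ ω, (s' ω).v = (s ω).v - η • hessYY P.g (s ω).x (s ω).y (s ω).v
          + η • gradY P.f (s ω).x (s ω).y + η • N ω) :
    errLin P Pr s' ≤ (1 - η * μ) ^ 2 * errLin P Pr s + η ^ 2 * V := by
  have hs' := hs.mono hm
  set U : Ω → Vec q := fun ω => ((s ω).v - η • hessYY P.g (s ω).x (s ω).y (s ω).v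
    + η • gradY P.f (s ω).x (s ω).y) - P.vStar (s ω).x (s ω).y with hU
  have hHm := h.oracle_hessYY_G.measurable_mean.comp hs.measurable
  have hvm := h.continuous_vStar.measurable.comp (hs.measurable_x.prodMk hs.measurable_y)
  have hbm := h.oracle_gradY_F.measurable_mean.comp hs.measurable
  simp only [Function.comp_def] at hHm hvm hbm
  have hUm : Measurable[m] U :=
    ((hs.measurable_v.sub (hHm.const_smul η)).add (hbm.const_smul η)).sub hvm
  have hUe : ∀ ω, U ω = ((s ω).v - P.vStar (s ω).x (s ω).y)
      - η • hessYY P.g (s ω).x (s ω).y ((s ω).v - P.vStar (s ω).x (s ω).y) := fun ω => by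
    rw [map_sub, h.hessYY_g_vStar, hU]; module
  have h3 : ∀ ω, ‖U ω‖ ≤ (1 - η * μ) * ‖(s ω).v - P.vStar (s ω).x (s ω).y‖ := fun ω => by
    rw [hUe]
    exact norm_sub_smul_apply_le _ (h.hessYY_g_symm _ _) (h.le_hessYY_g _ _)
      (h.norm_hessYY_g_apply_le _ _) hη hη' _
  have hd : MemLp (fun ω => (s ω).v - P.vStar (s ω).x (s ω).y) 2 Pr :=
    hs'.memLp_v.sub (hs'.memLp_vStar h)
  have hU2 : MemLp U 2 Pr := memLp_of_norm_le (hUm.mono hm le_rfl) hd hd (c₀ := 0)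
    (c₁ := 1 - η * μ) (c₂ := 0) fun ω => by simpa using h3 ω
  have h1 := (hN.smul η).integral_norm_add_sq_le hUm hU2
  have h2 : ∀ ω, (s' ω).v - P.vStar (s' ω).x (s' ω).y = U ω + η • N ω := fun ω => by
    rw [hx, hy, hv, hU]; module
  have h4 : 0 ≤ 1 - η * μ := by nlinarith [h.μ_le]
  have h5 := integral_sq_le_mul hd h3
  simp only [errLin, h2]
  exact h1.trans (add_le_add h5 le_rfl)

theorem moveX_le (h : P.Standing μ L M τ ρ σf σg σg1 σg2) {m : MeasurableSpace Ω}
    (hm : m ≤ mΩ) {B α V : ℝ} {s s' : Ω → State p q} (hs : RandState Pr m B s) {N : Ω → Vec p}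
    (hN : Noise Pr m N V)
    (hx : ∀ ω, (s' ω).x = (s ω).x - α • (P.meanDir (s ω).x (s ω).y (s ω).v + N ω)) :
    moveX Pr s s' ≤ α ^ 2 * (2 * sqGrad P Pr s + 2 * errDir P Pr s + V) := by
  have hs' := hs.mono hm
  have h1 := hs.memLp_meanDir hm h
  have h2 := hs'.memLp_hyperGrad h
  have hmm : Measurable[m] fun ω => P.meanDir (s ω).x (s ω).y (s ω).v := by
    have e1 := h.oracle_gradX_F.measurable_mean.comp hs.measurable
    have e2 := h.oracle_mixedXY_G.measurable_mean.comp hs.measurable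
    exact e1.sub e2
  have h3 := hN.integral_norm_add_sq_le hmm h1
  have h4 : ∫ ω, ‖P.meanDir (s ω).x (s ω).y (s ω).v‖ ^ 2 ∂Pr
      ≤ 2 * sqGrad P Pr s + 2 * errDir P Pr s := by
    have := integral_norm_add_sq_le_young h2 (h1.sub h2) one_pos
    simp only [Pi.sub_apply, add_sub_cancel] at this
    rw [sqGrad, errDir]
    linarith
  have h5 : ∀ ω, ‖(s' ω).x - (s ω).x‖ ^ 2
      = α ^ 2 * ‖P.meanDir (s ω).x (s ω).y (s ω).v + N ω‖ ^ 2 := fun ω => by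
    rw [hx, sub_sub_cancel_left, norm_neg, norm_smul, mul_pow, Real.norm_eq_abs, sq_abs]
  simp only [moveX, h5]
  rw [integral_const_mul]
  exact mul_le_mul_of_nonneg_left (by linarith) (sq_nonneg α)

/-- With mean direction d, the Taylor bound has first order term −α⟨∇Φ, d⟩ = (α/2)(‖d − ∇Φ‖² − ‖∇Φ‖²
− ‖d‖²), up to a noise term that integrates to zero because ∇Φ(x) is determined by the past. -/
theorem integral_Φ_descent (h : P.Standing μ L M τ ρ σf σg σg1 σg2) {m : MeasurableSpace Ω}
    (hm : m ≤ mΩ) {B α V : ℝ} (hα : 0 ≤ α) {s s' : Ω → State p q} (hs : RandState Pr m B s)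
    (hs' : RandState Pr mΩ B s') {N : Ω → Vec p} (hN : Noise Pr m N V)
    (hx : ∀ ω, (s' ω).x = (s ω).x - α • (P.meanDir (s ω).x (s ω).y (s ω).v + N ω)) :
    ∫ ω, P.Φ (s' ω).x ∂Pr ≤ ∫ ω, P.Φ (s ω).x ∂Pr - α / 2 * sqGrad P Pr s
      + α / 2 * errDir P Pr s
      + (L + M / μ * (τ + ρ)) * (1 + L / μ) ^ 2 * moveX Pr s s' := by
  have hs0 := hs.mono hm
  set c := (L + M / μ * (τ + ρ)) * (1 + L / μ) ^ 2
  have h1 := hs.memLp_meanDir hm h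
  have h2 := hs0.memLp_hyperGrad h
  have hgm : Measurable[m] fun ω => P.hyperGrad (s ω).x :=
    h.continuous_hyperGrad.measurable.comp hs.measurable_x
  have horth := hN.orth _ hgm h2
  have i1 := hs0.integrable_Φ h
  have i2 := integrable_norm_sq h2
  have i3 := integrable_norm_sq (h1.sub h2)
  have i4 := integrable_norm_sq (hs'.memLp_x.sub hs.memLp_x)
  have i5 := integrable_inner h2 hN.memLp
  simp only [Pi.sub_apply] at i3 i4
  have hpt : ∀ ω, P.Φ (s' ω).x ≤ P.Φ (s ω).x - α / 2 * ‖P.hyperGrad (s ω).x‖ ^ 2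
      + α / 2 * ‖P.meanDir (s ω).x (s ω).y (s ω).v - P.hyperGrad (s ω).x‖ ^ 2
      + c * ‖(s' ω).x - (s ω).x‖ ^ 2 - α * inner ℝ (P.hyperGrad (s ω).x) (N ω) := by
    intro ω
    have h3 := h.norm_Φ_sub_sub_le (s ω).x ((s' ω).x - (s ω).x)
    rw [add_sub_cancel, Real.norm_eq_abs] at h3
    have h4 := (abs_le.1 h3).2
    have h5 : inner ℝ (P.hyperGrad (s ω).x) ((s' ω).x - (s ω).x)
        = -α * inner ℝ (P.hyperGrad (s ω).x) (P.meanDir (s ω).x (s ω).y (s ω).v)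
          - α * inner ℝ (P.hyperGrad (s ω).x) (N ω) := by
      rw [hx, sub_sub_cancel_left, inner_neg_right, real_inner_smul_right, inner_add_right]
      ring
    have h6 := norm_sub_sq_real (P.meanDir (s ω).x (s ω).y (s ω).v) (P.hyperGrad (s ω).x)
    rw [real_inner_comm] at h6
    -- The favourable term −(α/2)‖d‖² is discarded; the displacement is controlled separately
    -- through `moveX_le`.
    have h7 : 0 ≤ α / 2 * ‖P.meanDir (s ω).x (s ω).y (s ω).v‖ ^ 2 := by positivity
    rw [h6]
    nlinarith
  have j1 := i1.sub (i2.const_mul (α / 2))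
  have j2 := j1.add (i3.const_mul (α / 2))
  have j3 := j2.add (i4.const_mul c)
  have j4 := j3.sub (i5.const_mul α)
  have h8 := integral_mono (hs'.integrable_Φ h) j4 hpt
  rw [integral_sub' j3 (i5.const_mul α), integral_add' j2 (i4.const_mul c),
    integral_add' j1 (i3.const_mul (α / 2)), integral_sub' i1 (i2.const_mul (α / 2)),
    integral_const_mul, integral_const_mul, integral_const_mul, integral_const_mul, horth,
    mul_zero, sub_zero] at h8
  exact h8

/-- Change of the lower level error under a move of `x`. -/
theorem errY_move (h : P.Standing μ L M τ ρ σf σg σg1 σg2) {B θ : ℝ} (hθ : 0 < θ)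
    {s s' : Ω → State p q} (hs : RandState Pr mΩ B s) (hs' : RandState Pr mΩ B s')
    (hy : ∀ ω, (s' ω).y = (s ω).y) :
    errY P Pr s' ≤ (1 + θ) * errY P Pr s + (1 + 1 / θ) * ((L / μ) ^ 2 * moveX Pr s s') := by
  have h1 := hs.memLp_yStar h
  have h2 := hs'.memLp_yStar h
  have h3 := integral_norm_add_sq_le_young (hs.memLp_errY h) (h1.sub h2) hθ
  have h4 := integral_sq_le_mul (U := fun ω => P.yStar (s ω).x - P.yStar (s' ω).x)
    (hs'.memLp_x.sub hs.memLp_x)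
    (fun ω => by
      rw [Pi.sub_apply, norm_sub_rev (s' ω).x]; exact h.norm_yStar_sub_le (s ω).x (s' ω).x)
  simp only [Pi.sub_apply, sub_add_sub_cancel] at h3 h4
  have h5 : 0 ≤ 1 + 1 / θ := by positivity
  simp only [errY, moveX, hy]
  exact h3.trans (add_le_add le_rfl (mul_le_mul_of_nonneg_left h4 h5))

/-- Change of the linear system error under a move of `x` and `y`. -/
theorem errLin_move (h : P.Standing μ L M τ ρ σf σg σg1 σg2) {B θ : ℝ} (hθ : 0 < θ)
    {s s' : Ω → State p q} (hs : RandState Pr mΩ B s) (hs' : RandState Pr mΩ B s')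
    (hv : ∀ ω, (s' ω).v = (s ω).v) :
    errLin P Pr s' ≤ (1 + θ) * errV P Pr s + (1 + 1 / θ) * ((L / μ + ρ * M / μ ^ 2) ^ 2 *
      (2 * ((1 + L / μ) ^ 2 * moveX Pr s s') + 2 * errY P Pr s')) := by
  have hL := h.L_pos
  have hμ := h.μ_pos
  have hM := h.M_nonneg
  have hρ := h.ρ_nonneg
  have h1 := hs.memLp_vSol h
  have h2 := hs'.memLp_vStar h
  have h3 := integral_norm_add_sq_le_young (hs.memLp_v.sub h1) (h1.sub h2) hθ
  have i1 := (integrable_norm_sq (hs'.memLp_x.sub hs.memLp_x)).const_mul ((1 + L / μ) ^ 2)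
  simp only [Pi.sub_apply] at i1
  have i2 := integrable_norm_sq (hs'.memLp_errY h)
  have h4 : ∫ ω, ‖P.vSol (s ω).x - P.vStar (s' ω).x (s' ω).y‖ ^ 2 ∂Pr
      ≤ (L / μ + ρ * M / μ ^ 2) ^ 2 *
      (2 * ((1 + L / μ) ^ 2 * moveX Pr s s') + 2 * errY P Pr s') := by
    rw [moveX, errY, ← integral_const_mul, ← integral_const_mul, ← integral_const_mul,
      ← integral_add (i1.const_mul 2) (i2.const_mul 2), ← integral_const_mul]
    refine integral_mono_of_nonneg (Eventually.of_forall fun ω => by positivity)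
      (((i1.const_mul 2).add (i2.const_mul 2)).const_mul _) (Eventually.of_forall fun ω => ?_)
    have h5 := h.norm_vSol_sub_vStar_le (s ω).x (s' ω).x (s' ω).y
    rw [norm_sub_rev (s ω).x] at h5
    set u := (1 + L / μ) * ‖(s' ω).x - (s ω).x‖ with hu
    set w := ‖(s' ω).y - P.yStar (s' ω).x‖ with hw
    calc ‖P.vSol (s ω).x - P.vStar (s' ω).x (s' ω).y‖ ^ 2
        ≤ ((L / μ + ρ * M / μ ^ 2) * (u + w)) ^ 2 := by gcongr
      _ = (L / μ + ρ * M / μ ^ 2) ^ 2 * (u + w) ^ 2 := by ring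
      _ ≤ (L / μ + ρ * M / μ ^ 2) ^ 2 * (2 * u ^ 2 + 2 * w ^ 2) := by
        gcongr
        nlinarith [sq_nonneg (u - w)]
      _ = _ := by rw [hu]; ring
  simp only [Pi.sub_apply, sub_add_sub_cancel] at h3
  have h5 : 0 ≤ 1 + 1 / θ := by positivity
  simp only [errLin, errV, hv] at h3 ⊢
  exact h3.trans (add_le_add le_rfl (mul_le_mul_of_nonneg_left h4 h5))

/-- Returns, after the linear system loop, from the target at (x, y) to the target at (x, y*(x)). -/
theorem errV_le_errLin (h : P.Standing μ L M τ ρ σf σg σg1 σg2) {B θ : ℝ} (hθ : 0 < θ)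
    {s : Ω → State p q} (hs : RandState Pr mΩ B s) :
    errV P Pr s ≤ (1 + θ) * errLin P Pr s
      + (1 + 1 / θ) * ((L / μ + ρ * M / μ ^ 2) ^ 2 * errY P Pr s) := by
  have hL := h.L_pos
  have hμ := h.μ_pos
  have hM := h.M_nonneg
  have hρ := h.ρ_nonneg
  have h1 := hs.memLp_vSol h
  have h2 := hs.memLp_vStar h
  have h3 := integral_norm_add_sq_le_young (hs.memLp_v.sub h2) (h2.sub h1) hθ
  have h4 := integral_sq_le_mul (U := fun ω => P.vStar (s ω).x (s ω).y - P.vSol (s ω).x)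
    (hs.memLp_errY h) (c := L / μ + ρ * M / μ ^ 2)
    (fun ω => by
      have := h.norm_vSol_sub_vStar_le (s ω).x (s ω).x (s ω).y
      rw [sub_self, norm_zero, mul_zero, zero_add] at this
      rwa [norm_sub_rev])
  simp only [Pi.sub_apply, sub_add_sub_cancel] at h3
  have h5 : 0 ≤ 1 + 1 / θ := by positivity
  simp only [errV, errLin, errY]
  exact h3.trans (add_le_add le_rfl (mul_le_mul_of_nonneg_left h4 h5))

end Errors

end SSGD

/-! ### Order of the samples, inner loops and one outer iteration. -/

namespace SSGD

open Filter Topology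

/-- Whether a sample is used before step `j` of phase `ph` of outer iteration `k`; the phases are
the upper level step, the lower level steps and the linear system steps. -/
def IsBefore (k ph j : ℕ) : DrawF ⊕ DrawG → Prop
  | .inl (.outer k' _) => k' < k ∨ (k' = k ∧ 1 ≤ ph)
  | .inl (.inner k' t _) => k' < k ∨ (k' = k ∧ ph = 2 ∧ t < j)
  | .inr (.mixed k' _) => k' < k ∨ (k' = k ∧ 1 ≤ ph)
  | .inr (.lower k' t _) => k' < k ∨ (k' = k ∧ (2 ≤ ph ∨ (ph = 1 ∧ t < j)))
  | .inr (.hess k' t _) => k' < k ∨ (k' = k ∧ ph = 2 ∧ t < j)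

/-- The samples used before step `j` of phase `ph` of outer iteration `k`. -/
def before (k ph j : ℕ) : Set (DrawF ⊕ DrawG) := {i | IsBefore k ph j i}

theorem before_upper_subset (k : ℕ) : before k 0 0 ⊆ before k 1 0 := by
  rintro ((_ | _) | (_ | _ | _)) <;> simp [before, IsBefore] <;> omega

theorem before_lower_subset (k t : ℕ) : before k 1 t ⊆ before k 1 (t + 1) := by
  rintro ((_ | _) | (_ | _ | _)) <;> simp [before, IsBefore]; omega

theorem before_lower_subset_linear (k t : ℕ) : before k 1 t ⊆ before k 2 0 := by
  rintro ((_ | _) | (_ | _ | _)) <;> simp [before, IsBefore]; omega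

theorem before_linear_subset (k t : ℕ) : before k 2 t ⊆ before k 2 (t + 1) := by
  rintro ((_ | _) | (_ | _ | _)) <;> simp [before, IsBefore] <;> omega

theorem before_linear_subset_succ (k t : ℕ) : before k 2 t ⊆ before (k + 1) 0 0 := by
  rintro ((_ | _) | (_ | _ | _)) <;> simp [before, IsBefore] <;> omega

section Loops

variable {p q : ℕ} {Ξ Z Ω : Type*} [MeasurableSpace Ξ] [MeasurableSpace Z]
  {mΩ : MeasurableSpace Ω} {P : Problem p q Ξ Z} {Pr : Measure Ω} {μ L M τ ρ σf σg σg1 σg2 : ℝ}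
  {ξ : DrawF → Ω → Ξ} {ζ : DrawG → Ω → Z} {a : Params}

/-- Conditions on the parameters under which both inner loops contract, by a factor `r` for the
mean squared errors. -/
structure Params.Contracting (a : Params) (μ L r : ℝ) : Prop where
  α_nonneg : 0 ≤ a.α
  β_nonneg : 0 ≤ a.β
  β_le : a.β * (μ + L) ≤ 2
  β_rate : (1 - a.β * μ) ^ 2 ≤ r
  η_nonneg : 0 ≤ a.η
  η_le : a.η * (μ + L) ≤ 2
  η_rate : (1 - a.η * μ) ^ 2 ≤ r
  r_lt : r < 1
  T_pos : 1 ≤ a.T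
  J_pos : 1 ≤ a.J
  Df_pos : 1 ≤ a.Df
  Dg_pos : 1 ≤ a.Dg
  S_pos : 1 ≤ a.S
  D_pos : 1 ≤ a.D

/-- V/(1 − r) is the fixed point of e ↦ re + V, so the noise accumulated over the steps stays below
it. -/
theorem le_geometric_step {r c e e' e₀ V : ℝ} {t : ℕ} (hc : c ≤ r) (hr : r < 1) (hr0 : 0 ≤ r)
    (he : 0 ≤ e) (h : e ≤ r ^ t * e₀ + V / (1 - r)) (h' : e' ≤ c * e + V) :
    e' ≤ r ^ (t + 1) * e₀ + V / (1 - r) := by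
  have h1 : 0 < 1 - r := by linarith
  have h2 : V / (1 - r) = r * (V / (1 - r)) + V := by field_simp; ring
  have h3 : c * e ≤ r * (r ^ t * e₀ + V / (1 - r)) :=
    (mul_le_mul_of_nonneg_right hc he).trans (mul_le_mul_of_nonneg_left h hr0)
  rw [h2]
  calc e' ≤ r * (r ^ t * e₀ + V / (1 - r)) + V := h'.trans (by linarith)
    _ = _ := by ring

/-- Only one factor r is kept, which makes all later constants independent of T and J. -/
theorem le_of_geometric {r e e₀ V : ℝ} {t : ℕ} (ht : 1 ≤ t) (hr : r < 1) (hr0 : 0 ≤ r)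
    (he : 0 ≤ e₀) (h : e ≤ r ^ t * e₀ + V) : e ≤ r * e₀ + V := by
  have h1 : r ^ t ≤ r := pow_le_of_le_one hr0 hr.le (by omega)
  have h2 := mul_le_mul_of_nonneg_right h1 he
  linarith

theorem errY_nonneg (s : Ω → State p q) : 0 ≤ errY P Pr s :=
  integral_nonneg fun _ => by positivity

theorem errLin_nonneg (s : Ω → State p q) : 0 ≤ errLin P Pr s :=
  integral_nonneg fun _ => by positivity

theorem lowerLoop_contract (hI : IsSampling P Pr ξ ζ)
    (h : P.Standing μ L M τ ρ σf σg σg1 σg2) {r : ℝ} (ha : a.Contracting μ L r) {k : ℕ} {B : ℝ}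
    {s : Ω → State p q} (hs : RandState Pr (past ξ ζ (before k 1 0)) B s) (t : ℕ) :
    RandState Pr (past ξ ζ (before k 1 t)) B
      (fun ω => loop (fun t => lowerStep P a (fun i => ζ (.lower k t i) ω)) t (s ω)) ∧
    (∀ ω, (loop (fun t => lowerStep P a (fun i => ζ (.lower k t i) ω)) t (s ω)).x = (s ω).x) ∧
    (∀ ω, (loop (fun t => lowerStep P a (fun i => ζ (.lower k t i) ω)) t (s ω)).v = (s ω).v) ∧
    errY P Pr (fun ω => loop (fun t => lowerStep P a (fun i => ζ (.lower k t i) ω)) t (s ω))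
      ≤ r ^ t * errY P Pr s + a.β ^ 2 * (σg ^ 2 / a.S) / (1 - r) := by
  have := hI.isProbabilityMeasure
  have hr0 : 0 ≤ r := (sq_nonneg _).trans ha.β_rate
  have hr1 : 0 < 1 - r := by linarith [ha.r_lt]
  induction t with
  | zero =>
    refine ⟨hs, fun ω => rfl, fun ω => rfl, ?_⟩
    simp only [loop, pow_zero, one_mul]
    have : 0 ≤ a.β ^ 2 * (σg ^ 2 / a.S) / (1 - r) := by positivity
    linarith
  | succ t ih =>
    obtain ⟨h1, h2, h3, h4⟩ := ih
    obtain ⟨h5, N, hN, hy⟩ := h1.lowerStep (a := a) hI h (dG := fun i => .lower k t i)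
      (fun i j hij => by simpa using hij) (before_lower_subset k t)
      (fun i => by simp [before, IsBefore]) (fun i => by simp [before, IsBefore]) ha.S_pos
    refine ⟨h5, fun ω => (h2 ω), fun ω => h3 ω, ?_⟩
    have h6 := errY_contract (s' := fun ω => loop (fun t => lowerStep P a
      (fun i => ζ (.lower k t i) ω)) (t + 1) (s ω)) h (hI.past_le _) ha.β_nonneg ha.β_le h1 hN (fun ω => rfl) hy
    exact le_geometric_step ha.β_rate ha.r_lt hr0 (errY_nonneg _) h4 h6

theorem linearLoop_contract (hI : IsSampling P Pr ξ ζ)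
    (h : P.Standing μ L M τ ρ σf σg σg1 σg2) {r : ℝ} (ha : a.Contracting μ L r) {k : ℕ}
    {s : Ω → State p q} (hs : RandState Pr (past ξ ζ (before k 2 0)) (M / μ) s) (t : ℕ) :
    RandState Pr (past ξ ζ (before k 2 t)) (M / μ)
      (fun ω => loop (fun j => linearStep P a (fun i => ξ (.inner k j i) ω)
        (fun i => ζ (.hess k j i) ω)) t (s ω)) ∧
    (∀ ω, (loop (fun j => linearStep P a (fun i => ξ (.inner k j i) ω)
        (fun i => ζ (.hess k j i) ω)) t (s ω)).x = (s ω).x) ∧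
    (∀ ω, (loop (fun j => linearStep P a (fun i => ξ (.inner k j i) ω)
        (fun i => ζ (.hess k j i) ω)) t (s ω)).y = (s ω).y) ∧
    errLin P Pr (fun ω => loop (fun j => linearStep P a (fun i => ξ (.inner k j i) ω)
        (fun i => ζ (.hess k j i) ω)) t (s ω))
      ≤ r ^ t * errLin P Pr s
        + a.η ^ 2 * (σf ^ 2 / a.Df + (M / μ) ^ 2 * σg2 ^ 2 / a.D) / (1 - r) := by
  have := hI.isProbabilityMeasure
  have hr0 : 0 ≤ r := (sq_nonneg _).trans ha.β_rate
  have hr1 : 0 < 1 - r := by linarith [ha.r_lt]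
  induction t with
  | zero =>
    refine ⟨hs, fun ω => rfl, fun ω => rfl, ?_⟩
    simp only [loop, pow_zero, one_mul]
    have : 0 ≤ a.η ^ 2 * (σf ^ 2 / a.Df + (M / μ) ^ 2 * σg2 ^ 2 / a.D) / (1 - r) := by positivity
    linarith
  | succ t ih =>
    obtain ⟨h1, h2, h3, h4⟩ := ih
    obtain ⟨h5, N, hN, hv⟩ := h1.linearStep (a := a) hI h (dF := fun i => .inner k t i)
      (dG := fun i => .hess k t i) (fun i j hij => by simpa using hij)
      (fun i j hij => by simpa using hij) (before_linear_subset k t)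
      (fun i => by simp [before, IsBefore]) (fun i => by simp [before, IsBefore])
      (fun i => by simp [before, IsBefore]) (fun i => by simp [before, IsBefore])
      ha.η_nonneg ha.η_le ha.Df_pos ha.D_pos
    refine ⟨h5, fun ω => (h2 ω), fun ω => h3 ω, ?_⟩
    have h6 := errLin_contract (s' := fun ω => loop (fun j => linearStep P a
      (fun i => ξ (.inner k j i) ω) (fun i => ζ (.hess k j i) ω)) (t + 1) (s ω)) h (hI.past_le _) ha.η_nonneg ha.η_le h1 hN (fun ω => rfl)
      (fun ω => rfl) hv
    exact le_geometric_step ha.η_rate ha.r_lt hr0 (errLin_nonneg _) h4 h6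

/-- The effect of one outer iteration on the errors. -/
theorem outerStep_recursion (hI : IsSampling P Pr ξ ζ)
    (h : P.Standing μ L M τ ρ σf σg σg1 σg2) {r : ℝ} (ha : a.Contracting μ L r) {k : ℕ}
    {s s' : Ω → State p q} (hs : RandState Pr (past ξ ζ (before k 0 0)) (M / μ) s)
    (hs' : s' = fun ω => outerStep P a (fun d => ξ d ω) (fun d => ζ d ω) k (s ω)) {θ : ℝ}
    (hθ : 0 < θ) :
    RandState Pr (past ξ ζ (before (k + 1) 0 0)) (M / μ) s' ∧
    errY P Pr s' ≤ r * ((1 + θ) * errY P Pr s + (1 + 1 / θ) * ((L / μ) ^ 2 * moveX Pr s s'))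
      + a.β ^ 2 * (σg ^ 2 / a.S) / (1 - r) ∧
    errV P Pr s' ≤ (1 + θ) * (r * ((1 + θ) * errV P Pr s
        + (1 + 1 / θ) * ((L / μ + ρ * M / μ ^ 2) ^ 2 *
          (2 * ((1 + L / μ) ^ 2 * moveX Pr s s') + 2 * errY P Pr s')))
        + a.η ^ 2 * (σf ^ 2 / a.Df + (M / μ) ^ 2 * σg2 ^ 2 / a.D) / (1 - r))
      + (1 + 1 / θ) * ((L / μ + ρ * M / μ ^ 2) ^ 2 * errY P Pr s') ∧
    moveX Pr s s' ≤ a.α ^ 2 * (2 * sqGrad P Pr s + 2 * errDir P Pr s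
      + (σf ^ 2 / a.Df + (M / μ) ^ 2 * σg1 ^ 2 / a.Dg)) ∧
    ∫ ω, P.Φ (s' ω).x ∂Pr ≤ ∫ ω, P.Φ (s ω).x ∂Pr - a.α / 2 * sqGrad P Pr s
      + a.α / 2 * errDir P Pr s
      + (L + M / μ * (τ + ρ)) * (1 + L / μ) ^ 2 * moveX Pr s s' := by
  have := hI.isProbabilityMeasure
  have hr0 : 0 ≤ r := (sq_nonneg _).trans ha.β_rate
  set s₁ : Ω → State p q := fun ω => upperStep P a (fun i => ξ (.outer k i) ω)
    (fun i => ζ (.mixed k i) ω) (s ω) with hs₁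
  set s₂ : Ω → State p q := fun ω => loop (fun t => lowerStep P a (fun i => ζ (.lower k t i) ω))
    a.T (s₁ ω) with hs₂
  obtain ⟨h1, N, hN, hx⟩ := hs.upperStep (a := a) hI h (dF := fun i => .outer k i)
    (dG := fun i => .mixed k i) (fun i j hij => by simpa using hij)
    (fun i j hij => by simpa using hij) (before_upper_subset k)
    (fun i => by simp [before, IsBefore]) (fun i => by simp [before, IsBefore])
    (fun i => by simp [before, IsBefore]) (fun i => by simp [before, IsBefore])
    ha.Df_pos ha.Dg_pos
  obtain ⟨h2, hx2, hv2, hy2⟩ := lowerLoop_contract (a := a) hI h ha h1 a.T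
  have h2' := h2.mono (past_mono (before_lower_subset_linear k a.T))
  obtain ⟨h3, hx3, hy3, hv3⟩ := linearLoop_contract (a := a) hI h ha h2' a.J
  have hss : s' = fun ω => loop (fun j => linearStep P a (fun i => ξ (.inner k j i) ω)
        (fun i => ζ (.hess k j i) ω)) a.J (s₂ ω) := hs'
  rw [← hss] at h3 hv3
  have hx' : ∀ ω, (s' ω).x = (s₁ ω).x := fun ω => by rw [hss]; exact (hx3 ω).trans (hx2 ω)
  have hy' : ∀ ω, (s' ω).y = (s₂ ω).y := fun ω => by rw [hss]; exact hy3 ω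
  have hmove₁ : moveX Pr s s₁ = moveX Pr s s' := by simp only [moveX, hx']
  have hmove₂ : moveX Pr s s₂ = moveX Pr s s' := by
    simp only [moveX, hx']
    exact integral_congr_ae (Eventually.of_forall fun ω => by
      simp only; rw [show (s₂ ω).x = (s₁ ω).x from hx2 ω])
  have herr : errY P Pr s' = errY P Pr s₂ := by
    simp only [errY, hx', hy']
    exact integral_congr_ae (Eventually.of_forall fun ω => by
      simp only; rw [show (s₂ ω).x = (s₁ ω).x from hx2 ω])
  have g0 := hs.mono (hI.past_le _)
  have g1 := h1.mono (hI.past_le _)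
  have g2 := h2.mono (hI.past_le _)
  have g3 := h3.mono (hI.past_le _)
  refine ⟨h3.mono (past_mono (before_linear_subset_succ k a.J)), ?_, ?_, ?_, ?_⟩
  -- The move of x shifts the target y*(x) before the lower loop contracts towards it; `errY_move`
  -- covers this part, and `hy2` the loop.
  · have e1 := errY_move h hθ g0 g1 (fun ω => rfl)
    have e2 := le_of_geometric ha.T_pos ha.r_lt hr0 (errY_nonneg _) hy2
    rw [hmove₁] at e1
    rw [herr]
    exact e2.trans (add_le_add (mul_le_mul_of_nonneg_left e1 hr0) le_rfl)
  -- v is compared directly with the state after the lower loop, so the new error of y appears. The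
  -- factor 1 + θ is paid again after the loop, for the return to the target at y*(x).
  · have e1 := errLin_move h hθ g0 g2 (fun ω => hv2 ω)
    have e2 := le_of_geometric ha.J_pos ha.r_lt hr0 (errLin_nonneg _) hv3
    have e3 := errV_le_errLin h hθ g3
    rw [hmove₂, ← herr] at e1
    refine e3.trans (add_le_add (mul_le_mul_of_nonneg_left (e2.trans (add_le_add
      (mul_le_mul_of_nonneg_left e1 hr0) le_rfl)) (by positivity)) le_rfl)
  · rw [← hmove₁]
    exact moveX_le h (hI.past_le _) hs hN hx
  · exact integral_Φ_descent h (hI.past_le _) ha.α_nonneg hs g3 hN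
      (fun ω => (hx' ω).trans (hx ω))

/-- The random state of SSGD after `k` outer iterations. -/
noncomputable def runState (P : Problem p q Ξ Z) (a : Params) (x₀ : Vec p) (y₀ v₀ : Vec q)
    (ξ : DrawF → Ω → Ξ) (ζ : DrawG → Ω → Z) (k : ℕ) (ω : Ω) : State p q :=
  run P a x₀ y₀ v₀ (fun d => ξ d ω) (fun d => ζ d ω) k

theorem randState_runState (hI : IsSampling P Pr ξ ζ)
    (h : P.Standing μ L M τ ρ σf σg σg1 σg2) {r : ℝ} (ha : a.Contracting μ L r)
    {x₀ : Vec p} {y₀ v₀ : Vec q} (hv : ‖v₀‖ ≤ M / μ) (k : ℕ) :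
    RandState Pr (past ξ ζ (before k 0 0)) (M / μ) (runState P a x₀ y₀ v₀ ξ ζ k) := by
  have := hI.isProbabilityMeasure
  induction k with
  | zero => exact ⟨(measurable_const : Measurable[past ξ ζ (before 0 0 0)]
    fun _ : Ω => (x₀, y₀, v₀)), memLp_const _, memLp_const _, fun _ => hv⟩
  | succ k ih => exact (outerStep_recursion hI h ha ih rfl one_pos).1

end Loops

/-! ### Exact numbers of oracle calls. -/

section Counters

variable {p q : ℕ} {Ξ Z : Type*} [MeasurableSpace Ξ] [MeasurableSpace Z]
  (P : Problem p q Ξ Z) (a : Params)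

theorem lowerLoop_counters (ζ : ℕ → ℕ → Z) (s : State p q) (t : ℕ) :
    (loop (fun t => lowerStep P a (ζ t)) t s).nGradF = s.nGradF ∧
    (loop (fun t => lowerStep P a (ζ t)) t s).nGradG = s.nGradG + t * a.S ∧
    (loop (fun t => lowerStep P a (ζ t)) t s).nJac = s.nJac ∧
    (loop (fun t => lowerStep P a (ζ t)) t s).nHess = s.nHess := by
  induction t with
  | zero => simp [loop]
  | succ t ih =>
    obtain ⟨h1, h2, h3, h4⟩ := ih
    refine ⟨h1, ?_, h3, h4⟩
    simp only [loop, lowerStep]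
    rw [h2]; ring

theorem linearLoop_counters (ξ : ℕ → ℕ → Ξ) (ζ : ℕ → ℕ → Z) (s : State p q) (j : ℕ) :
    (loop (fun j => linearStep P a (ξ j) (ζ j)) j s).nGradF = s.nGradF + j * a.Df ∧
    (loop (fun j => linearStep P a (ξ j) (ζ j)) j s).nGradG = s.nGradG ∧
    (loop (fun j => linearStep P a (ξ j) (ζ j)) j s).nJac = s.nJac ∧
    (loop (fun j => linearStep P a (ξ j) (ζ j)) j s).nHess = s.nHess + j * a.D := by
  induction j with
  | zero => simp [loop]
  | succ j ih =>
    obtain ⟨h1, h2, h3, h4⟩ := ih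
    refine ⟨?_, h2, h3, ?_⟩
    · simp only [loop, linearStep]
      rw [h1]; ring
    · simp only [loop, linearStep]
      rw [h4]; ring

theorem run_counters (x₀ : Vec p) (y₀ v₀ : Vec q) (ξ : DrawF → Ξ) (ζ : DrawG → Z) (k : ℕ) :
    (run P a x₀ y₀ v₀ ξ ζ k).nGradF = k * (a.Df + a.J * a.Df) ∧
    (run P a x₀ y₀ v₀ ξ ζ k).nGradG = k * (a.T * a.S) ∧
    (run P a x₀ y₀ v₀ ξ ζ k).nJac = k * a.Dg ∧
    (run P a x₀ y₀ v₀ ξ ζ k).nHess = k * (a.J * a.D) := by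
  induction k with
  | zero => simp [run, loop]
  | succ k ih =>
    obtain ⟨h1, h2, h3, h4⟩ := ih
    set s := run P a x₀ y₀ v₀ ξ ζ k with hs
    have hrun : run P a x₀ y₀ v₀ ξ ζ (k + 1) = outerStep P a ξ ζ k s := rfl
    rw [hrun, outerStep]
    obtain ⟨l1, l2, l3, l4⟩ := linearLoop_counters P a (fun j i => ξ (.inner k j i))
      (fun j i => ζ (.hess k j i)) (loop (fun t => lowerStep P a (fun i => ζ (.lower k t i))) a.T
        (upperStep P a (fun i => ξ (.outer k i)) (fun i => ζ (.mixed k i)) s)) a.J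
    obtain ⟨m1, m2, m3, m4⟩ := lowerLoop_counters P a (fun t i => ζ (.lower k t i))
      (upperStep P a (fun i => ξ (.outer k i)) (fun i => ζ (.mixed k i)) s) a.T
    refine ⟨l1.trans ?_, l2.trans (m2.trans ?_), l3.trans (m3.trans ?_), l4.trans ?_⟩
    · rw [m1, upperStep, h1]; ring
    · rw [upperStep, h2]; ring
    · rw [upperStep, h3]; ring
    · rw [m4, upperStep, h4]; ring

end Counters

end SSGD

namespace SSGD

/-! ### Scalar recursions: summation, transient and absorption. -/

section Scalar

/-- Telescoping. With 1 − lam = b/(4κ), each use turns into one factor of order κ. -/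
theorem sum_le_of_recursion {lam : ℝ} {e x : ℕ → ℝ} (h : ∀ k, e (k + 1) ≤ lam * e k + x k) (K : ℕ) :
    e K + (1 - lam) * ∑ k ∈ Finset.range K, e k ≤ e 0 + ∑ k ∈ Finset.range K, x k := by
  induction K with
  | zero => simp
  | succ K ih =>
    rw [Finset.sum_range_succ, Finset.sum_range_succ]
    linarith [h K]

/-- The solution of `f (k + 1) = lam * f k + x k`, `f 0 = 0`. -/
def recSol (lam : ℝ) (x : ℕ → ℝ) : ℕ → ℝ
  | 0 => 0
  | k + 1 => lam * recSol lam x k + x k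

theorem recSol_nonneg {lam : ℝ} {x : ℕ → ℝ} (hl : 0 ≤ lam) (hx : ∀ k, 0 ≤ x k) (k : ℕ) :
    0 ≤ recSol lam x k := by
  induction k with
  | zero => exact le_rfl
  | succ k ih => exact add_nonneg (mul_nonneg hl ih) (hx k)

theorem le_recSol {lam : ℝ} {e x : ℕ → ℝ} (hl : 0 ≤ lam) (h : ∀ k, e (k + 1) ≤ lam * e k + x k)
    (k : ℕ) : e k ≤ lam ^ k * e 0 + recSol lam x k := by
  induction k with
  | zero => simp [recSol]
  | succ k ih =>
    have := mul_le_mul_of_nonneg_left ih hl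
    calc e (k + 1) ≤ lam * (lam ^ k * e 0 + recSol lam x k) + x k := (h k).trans (by linarith)
      _ = _ := by rw [recSol]; ring

/-- The recursions that the errors of SSGD satisfy: `e` and `w` are the errors of `y` and `v`, `G`
and `E` the squared norms of the hypergradient and of the bias, `D` the squared displacement, and
`φ` the objective. -/
structure ErrorRecursion (A b κ α nf n1 ng n2 : ℝ) (e w G E D φ : ℕ → ℝ) : Prop where
  e_nonneg : ∀ k, 0 ≤ e k
  w_nonneg : ∀ k, 0 ≤ w k
  D_nonneg : ∀ k, 0 ≤ D k
  e_le : ∀ k, e (k + 1) ≤ (1 - b / (4 * κ)) * e k + A * (κ ^ 3 * D k + κ * ng)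
  w_le : ∀ k, w (k + 1) ≤ (1 - b / (4 * κ)) * w k
    + A * (κ ^ 7 * D k + κ ^ 5 * e (k + 1) + κ * nf + κ ^ 3 * n2)
  w_bound : ∀ k, w k ≤ A * κ ^ 2
  E_le : ∀ k, E k ≤ A * (κ ^ 2 * e k + w k)
  D_le : ∀ k, D k ≤ A * α ^ 2 * (G k + E k + nf + κ ^ 2 * n1)
  φ_le : ∀ k, φ (k + 1) ≤ φ k - α / 2 * G k + α / 2 * E k + A * κ ^ 3 * D k

variable {A b κ α nf n1 ng n2 : ℝ} {e w G E D φ : ℕ → ℝ}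

/-- The contribution of the initial error of `y` to the error of `v`: the trivial bound on `w` is
used as long as that initial error has not decayed. -/
theorem ErrorRecursion.w_le_transient (h : ErrorRecursion A b κ α nf n1 ng n2 e w G E D φ)
    (hA : 0 ≤ A) (hb : 0 < b) (hb1 : b ≤ 1) (hκ : 1 ≤ κ) (hnf : 0 ≤ nf) (hng : 0 ≤ ng)
    (hn2 : 0 ≤ n2) {R : ℝ} (he : e 0 ≤ R ^ 2) (k : ℕ) :
    w (k + 1) ≤ (1 - b / (4 * κ)) * w k + (A * (1 + R ^ 2) * κ ^ 3 * (1 - b / (16 * κ)) ^ (k + 1)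
      + A * κ ^ 5 * recSol (1 - b / (4 * κ)) (fun k => A * (κ ^ 3 * D k + κ * ng)) (k + 1)
      + A * (κ ^ 7 * D k + κ * nf + κ ^ 3 * n2)) := by
  have hκ0 : 0 < κ := by linarith
  have hb4 : b / (4 * κ) ≤ 1 := by rw [div_le_one (by positivity)]; linarith
  have hb16 : b / (16 * κ) ≤ 1 := by rw [div_le_one (by positivity)]; linarith
  have hl : 0 ≤ 1 - b / (4 * κ) := by linarith
  have hf := recSol_nonneg hl (x := fun k => A * (κ ^ 3 * D k + κ * ng)) (fun k => by
    have := h.D_nonneg k; positivity) (k + 1)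
  have h1 := le_recSol hl h.e_le (k + 1)
  set f := recSol (1 - b / (4 * κ)) (fun k => A * (κ ^ 3 * D k + κ * ng)) (k + 1)
  set s := (1 - b / (16 * κ)) ^ (k + 1) with hs
  have hs0 : 0 ≤ s := pow_nonneg (by linarith) _
  -- s decays with a quarter of the rate, and Bernoulli's inequality bounds the transient of e by
  -- s⁴R². The spare powers of s will offset powers of κ.
  have hls : (1 - b / (4 * κ)) ^ (k + 1) ≤ s ^ 4 := by
    have hs4 : s ^ 4 = ((1 - b / (16 * κ)) ^ 4) ^ (k + 1) := by rw [hs, ← pow_mul, ← pow_mul, mul_comm (k + 1)]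
    rw [hs4]
    refine pow_le_pow_left₀ hl ?_ _
    have := one_add_mul_le_pow (a := -(b / (16 * κ))) (by linarith) 4
    have e1 : b / (4 * κ) = 4 * (b / (16 * κ)) := by field_simp; norm_num
    rw [e1]
    push_cast at this
    linarith
  have hD := h.D_nonneg k
  have hw := h.w_nonneg k
  have hw' := mul_nonneg hl hw
  have hrest : 0 ≤ A * (κ ^ 7 * D k + κ * nf + κ ^ 3 * n2) := by positivity
  have hff : 0 ≤ A * κ ^ 5 * f := by positivity
  -- While κs ≥ 1, the trivial bound Aκ² is at most Aκ³s. Once κs ≤ 1, κ⁵s⁴ = κ²s(κs)³ ≤ κ³s. Either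
  -- way the transient costs κ³s, whose sum over k is of order κ⁴.
  by_cases hc : 1 ≤ κ * s
  · have h2 := h.w_bound (k + 1)
    have h3 : A * κ ^ 2 * 1 ≤ A * κ ^ 2 * ((1 + R ^ 2) * (κ * s)) := by
      refine mul_le_mul_of_nonneg_left ?_ (by positivity)
      nlinarith [sq_nonneg R]
    have h4 : A * κ ^ 2 * ((1 + R ^ 2) * (κ * s)) = A * (1 + R ^ 2) * κ ^ 3 * s := by ring
    linarith
  · have hc' : κ * s ≤ 1 := by linarith
    have h2 := h.w_le k
    have h5 : e (k + 1) ≤ s ^ 4 * R ^ 2 + f := by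
      have := mul_le_mul hls he (h.e_nonneg 0) (by positivity)
      linarith
    have h6 : κ ^ 5 * s ^ 4 ≤ κ ^ 3 * s := by
      have h7 : (κ * s) ^ 3 ≤ 1 := pow_le_one₀ (by positivity) hc'
      calc κ ^ 5 * s ^ 4 = κ ^ 2 * s * (κ * s) ^ 3 := by ring
        _ ≤ κ ^ 2 * s * 1 := by gcongr
        _ ≤ κ ^ 3 * s := by
          rw [mul_one]
          exact mul_le_mul_of_nonneg_right (pow_le_pow_right₀ hκ (by norm_num)) hs0
    have h8 : A * κ ^ 5 * e (k + 1) ≤ A * κ ^ 5 * (s ^ 4 * R ^ 2 + f) := by gcongr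
    have h9 : A * (1 + R ^ 2) * (κ ^ 5 * s ^ 4) ≤ A * (1 + R ^ 2) * (κ ^ 3 * s) := by gcongr
    have h10 : 0 ≤ A * (κ ^ 5 * s ^ 4) := by positivity
    linarith

/-- Collects powers of κ. The critical ones go through both recursions: κ · κ⁵ · κ · κ³ = κ¹⁰ for
the displacement and κ · κ⁵ · κ · κ = κ⁸ for the noise of y; the transient gives κ · κ³ · κ = κ⁵. -/
theorem sum_bound_le (hA : 1 ≤ A) (hb : 0 < b) (hb1 : b ≤ 1) (hκ : 1 ≤ κ) (hnf : 0 ≤ nf)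
    (hng : 0 ≤ ng) (hn2 : 0 ≤ n2) {R s n : ℝ} (hs : 0 ≤ s) (hn : 0 ≤ n) :
    κ ^ 2 * (4 * κ / b * (R ^ 2 + A * (κ ^ 3 * s + n * (κ * ng))))
      + 4 * κ / b * (A * κ ^ 2 + (A * (1 + R ^ 2) * κ ^ 3 * (16 * κ / b)
        + A * κ ^ 5 * (4 * κ / b * (A * (κ ^ 3 * s + n * (κ * ng))))
        + A * (κ ^ 7 * s + n * (κ * nf) + n * (κ ^ 3 * n2))))
      ≤ 128 * A ^ 2 / b ^ 2 * ((1 + R ^ 2) * κ ^ 5 + κ ^ 10 * s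
        + n * (κ ^ 2 * nf + κ ^ 8 * ng + κ ^ 4 * n2)) := by
  have hκ0 : 0 < κ := by linarith
  obtain ⟨β, hβ⟩ : ∃ β, β = 1 / b := ⟨_, rfl⟩
  have hβ1 : 1 ≤ β := by rw [hβ, le_div_iff₀ hb]; linarith
  have e1 : ∀ t : ℝ, t * κ / b = t * κ * β := fun t => by rw [hβ]; ring
  have e2 : 128 * A ^ 2 / b ^ 2 = 128 * A ^ 2 * β ^ 2 := by rw [hβ]; field_simp
  rw [e1, e1, e2]
  have hA2 : A ≤ A ^ 2 := le_self_pow₀ hA two_ne_zero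
  have hA1 : 1 ≤ A ^ 2 := one_le_pow₀ hA
  have hβ2 : β ≤ β ^ 2 := le_self_pow₀ hβ1 two_ne_zero
  have p1 : β ≤ A ^ 2 * β ^ 2 := hβ2.trans (le_mul_of_one_le_left (sq_nonneg β) hA1)
  have p2 : A * β ≤ A ^ 2 * β ^ 2 := mul_le_mul hA2 hβ2 (by positivity) (by positivity)
  have p3 : A * β ^ 2 ≤ A ^ 2 * β ^ 2 := by gcongr
  have q3 : κ ^ 3 ≤ κ ^ 5 := pow_le_pow_right₀ hκ (by norm_num)
  have q4 : κ ^ 4 ≤ κ ^ 8 := pow_le_pow_right₀ hκ (by norm_num)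
  have q6 : κ ^ 6 ≤ κ ^ 10 := pow_le_pow_right₀ hκ (by norm_num)
  have q8 : κ ^ 8 ≤ κ ^ 10 := pow_le_pow_right₀ hκ (by norm_num)
  have t1 : 4 * (β * (R ^ 2 * κ ^ 3)) ≤ 4 * (A ^ 2 * β ^ 2 * ((1 + R ^ 2) * κ ^ 5)) := by
    gcongr; linarith
  have t2 : 4 * (A * β * (κ ^ 6 * s)) ≤ 4 * (A ^ 2 * β ^ 2 * (κ ^ 10 * s)) := by gcongr
  have t3 : 4 * (A * β * (n * (κ ^ 4 * ng))) ≤ 4 * (A ^ 2 * β ^ 2 * (n * (κ ^ 8 * ng))) := by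
    gcongr
  have t4 : 4 * (A * β * κ ^ 3) ≤ 4 * (A ^ 2 * β ^ 2 * ((1 + R ^ 2) * κ ^ 5)) := by
    have : 1 * κ ^ 3 ≤ (1 + R ^ 2) * κ ^ 5 :=
      mul_le_mul (by linarith [sq_nonneg R]) q3 (by positivity) (by positivity)
    rw [one_mul] at this
    gcongr
  have t5 : 64 * (A * β ^ 2 * ((1 + R ^ 2) * κ ^ 5))
      ≤ 64 * (A ^ 2 * β ^ 2 * ((1 + R ^ 2) * κ ^ 5)) := by gcongr
  have t6 : 4 * (A * β * (κ ^ 8 * s)) ≤ 4 * (A ^ 2 * β ^ 2 * (κ ^ 10 * s)) := by gcongr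
  have t7 : 4 * (A * β * (n * (κ ^ 2 * nf + κ ^ 4 * n2)))
      ≤ 4 * (A ^ 2 * β ^ 2 * (n * (κ ^ 2 * nf + κ ^ 4 * n2))) := by gcongr
  have u1 : 0 ≤ A ^ 2 * β ^ 2 * ((1 + R ^ 2) * κ ^ 5) := by positivity
  have u2 : 0 ≤ A ^ 2 * β ^ 2 * (κ ^ 10 * s) := by positivity
  have u3 : 0 ≤ A ^ 2 * β ^ 2 * (n * (κ ^ 8 * ng)) := by positivity
  have u4 : 0 ≤ A ^ 2 * β ^ 2 * (n * (κ ^ 2 * nf + κ ^ 4 * n2)) := by positivity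
  -- The initial terms add up to 72 and the others to less; the nonnegative slack fills every
  -- coefficient up to 128.
  linear_combination t1 + t2 + t3 + t4 + t5 + t6 + t7 + 56 * u1 + 104 * u2 + 108 * u3 + 124 * u4

/-- The accumulated errors of the two inner problems. -/
theorem ErrorRecursion.sum_le (h : ErrorRecursion A b κ α nf n1 ng n2 e w G E D φ)
    (hA : 1 ≤ A) (hb : 0 < b) (hb1 : b ≤ 1) (hκ : 1 ≤ κ) (hnf : 0 ≤ nf) (hng : 0 ≤ ng)
    (hn2 : 0 ≤ n2) {R : ℝ} (he : e 0 ≤ R ^ 2) (K : ℕ) :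
    κ ^ 2 * (∑ k ∈ Finset.range K, e k) + ∑ k ∈ Finset.range K, w k
      ≤ 128 * A ^ 2 / b ^ 2 * ((1 + R ^ 2) * κ ^ 5 + κ ^ 10 * (∑ k ∈ Finset.range K, D k)
        + K * (κ ^ 2 * nf + κ ^ 8 * ng + κ ^ 4 * n2)) := by
  have hκ0 : 0 < κ := by linarith
  have hb4 : b / (4 * κ) ≤ 1 := by rw [div_le_one (by positivity)]; linarith
  have hb16 : b / (16 * κ) ≤ 1 := by rw [div_le_one (by positivity)]; linarith
  have hl : 0 ≤ 1 - b / (4 * κ) := by linarith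
  set lam := 1 - b / (4 * κ) with hlam
  have h1lam : 1 - lam = b / (4 * κ) := by rw [hlam]; ring
  set x : ℕ → ℝ := fun k => A * (κ ^ 3 * D k + κ * ng) with hx
  set f := recSol lam x with hf
  have hx0 : ∀ k, 0 ≤ x k := fun k => by
    have := h.D_nonneg k; rw [hx]; positivity
  have hf0 : ∀ k, 0 ≤ f k := recSol_nonneg hl hx0
  set SD := ∑ k ∈ Finset.range K, D k with hSD
  have hSD0 : 0 ≤ SD := Finset.sum_nonneg fun k _ => h.D_nonneg k
  have hsx : ∑ k ∈ Finset.range K, x k = A * (κ ^ 3 * SD + K * (κ * ng)) := by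
    simp only [hx]
    rw [← Finset.mul_sum, Finset.sum_add_distrib, ← Finset.mul_sum, Finset.sum_const,
      Finset.card_range, nsmul_eq_mul]
  have hmul : ∀ {t B : ℝ}, b / (4 * κ) * t ≤ B → t ≤ 4 * κ / b * B := fun {t B} hB => by
    have : t = 4 * κ / b * (b / (4 * κ) * t) := by field_simp
    rw [this]
    exact mul_le_mul_of_nonneg_left hB (by positivity)
  have he1 : ∑ k ∈ Finset.range K, e k ≤ 4 * κ / b * (R ^ 2 + A * (κ ^ 3 * SD + K * (κ * ng))) := by
    have h1 := sum_le_of_recursion h.e_le K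
    rw [h1lam, hsx] at h1
    exact hmul (by linarith [h.e_nonneg K])
  -- f starts at 0 and so carries no initial term; the shift by one index adds f K, which the
  -- telescoped inequality already contains on its left side.
  have hf1 : ∑ k ∈ Finset.range K, f (k + 1) ≤ 4 * κ / b * (A * (κ ^ 3 * SD + K * (κ * ng))) := by
    have h1 := sum_le_of_recursion (lam := lam) (e := f) (x := x) (fun k => le_rfl) K
    rw [h1lam, hsx] at h1
    have h2 : ∑ k ∈ Finset.range K, f (k + 1) = ∑ k ∈ Finset.range K, f k + f K - f 0 := by
      have := Finset.sum_range_succ f K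
      rw [Finset.sum_range_succ'] at this
      linarith
    have h3 : f 0 = 0 := rfl
    refine hmul ?_
    rw [h2, h3]
    rw [h3] at h1
    have h4 : b / (4 * κ) * f K ≤ 1 * f K := mul_le_mul_of_nonneg_right hb4 (hf0 K)
    linarith
  set s : ℕ → ℝ := fun k => (1 - b / (16 * κ)) ^ (k + 1) with hs
  have hs1 : ∑ k ∈ Finset.range K, s k ≤ 16 * κ / b := by
    have hν : 0 ≤ 1 - b / (16 * κ) := by linarith
    have h1 := sum_le_of_recursion (lam := 1 - b / (16 * κ)) (e := s) (x := fun _ => 0)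
      (fun k => by rw [hs]; simp only; rw [pow_succ']; linarith) K
    have h2 : s 0 ≤ 1 := by
      have : 0 ≤ b / (16 * κ) := by positivity
      simp only [hs, zero_add, pow_one]
      linarith
    have h3 : 0 ≤ s K := pow_nonneg hν _
    have h4 : b / (16 * κ) * ∑ k ∈ Finset.range K, s k ≤ 1 := by
      simp only [Finset.sum_const_zero, add_zero, sub_sub_cancel] at h1
      linarith
    have h5 : ∑ k ∈ Finset.range K, s k
        = 16 * κ / b * (b / (16 * κ) * ∑ k ∈ Finset.range K, s k) := by field_simp
    rw [h5]
    exact (mul_le_mul_of_nonneg_left h4 (by positivity)).trans_eq (mul_one _)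
  have hw1 : ∑ k ∈ Finset.range K, w k ≤ 4 * κ / b * (A * κ ^ 2
      + (A * (1 + R ^ 2) * κ ^ 3 * (16 * κ / b)
      + A * κ ^ 5 * (4 * κ / b * (A * (κ ^ 3 * SD + K * (κ * ng))))
      + A * (κ ^ 7 * SD + K * (κ * nf) + K * (κ ^ 3 * n2)))) := by
    have h1 := sum_le_of_recursion
      (h.w_le_transient (by linarith) hb hb1 hκ hnf hng hn2 he) K
    refine hmul ?_
    rw [h1lam] at h1
    have h2 := h.w_nonneg K
    have h3 := h.w_bound 0
    rw [Finset.sum_add_distrib, Finset.sum_add_distrib, ← Finset.mul_sum, ← Finset.mul_sum,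
      ← Finset.mul_sum, Finset.sum_add_distrib, Finset.sum_add_distrib, ← Finset.mul_sum,
      Finset.sum_const, Finset.sum_const, Finset.card_range, nsmul_eq_mul, nsmul_eq_mul] at h1
    have h4 : A * (1 + R ^ 2) * κ ^ 3 * ∑ k ∈ Finset.range K, s k
        ≤ A * (1 + R ^ 2) * κ ^ 3 * (16 * κ / b) := by gcongr
    have h5 : A * κ ^ 5 * ∑ k ∈ Finset.range K, f (k + 1)
        ≤ A * κ ^ 5 * (4 * κ / b * (A * (κ ^ 3 * SD + K * (κ * ng)))) := by gcongr
    linarith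
  exact (add_le_add (mul_le_mul_of_nonneg_left he1 (sq_nonneg κ)) hw1).trans
    (sum_bound_le hA hb hb1 hκ hnf hng hn2 hSD0 (Nat.cast_nonneg K))

/-- S is the total of squared gradients, AQ bounds the total bias and V is noise. Both inequalities
contain W = S + AQ + V on the right; with c of size 1/(16A²B), W returns with factors 1/8 and 1/256,
small enough to be moved to the left. -/
theorem le_of_absorption {A B c c₁ S Q V k R X₀ Δ : ℝ} (hA : 1 ≤ A) (hB : 1 ≤ B)
    (hc : 16 * A ^ 2 * B * c = 1) (hS : 0 ≤ S) (hQ : 0 ≤ Q) (hV : 0 ≤ V) (hk : 0 ≤ k)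
    (hΔ : 0 ≤ Δ) (hc₁ : 0 < c₁)
    (hdesc : S ≤ X₀ + A * Q + 2 * A ^ 2 * c * (S + A * Q + V))
    (hX₀ : X₀ ≤ 2 * Δ / c₁ * k)
    (hQle : Q ≤ B * ((1 + R ^ 2) * k + A * c ^ 2 * (S + A * Q + V) + V)) :
    S ≤ 2 * (2 * Δ / c₁ + 5 * A * B * (1 + R ^ 2) + 5 * A * B + 1) * (k + V) := by
  have hc0 : 0 < c := by
    by_contra hn
    have : 16 * A ^ 2 * B * c ≤ 0 := mul_nonpos_of_nonneg_of_nonpos (by positivity) (by linarith)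
    linarith
  have hW : 0 ≤ S + A * Q + V := by positivity
  obtain ⟨W, hWd⟩ : ∃ W, W = S + A * Q + V := ⟨_, rfl⟩
  rw [← hWd] at hdesc hQle hW
  have hcs : c ≤ 1 / 16 := by
    have : 1 * c ≤ A ^ 2 * B * c :=
      mul_le_mul_of_nonneg_right (one_le_mul_of_one_le_of_one_le (one_le_pow₀ hA) hB) hc0.le
    linarith
  have a1 : 2 * A ^ 2 * c ≤ 1 / 8 := by
    have : A ^ 2 * c * 1 ≤ A ^ 2 * c * B := mul_le_mul_of_nonneg_left hB (by positivity)
    linarith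
  have a2 : A * (B * (A * c ^ 2)) ≤ 1 / 256 := by
    have : A * (B * (A * c ^ 2)) = 16 * A ^ 2 * B * c * c / 16 := by ring
    rw [this, hc]
    linarith
  have b1 : A * Q ≤ A * B * ((1 + R ^ 2) * k) + 1 / 256 * W + A * B * V := by
    have h1 := mul_le_mul_of_nonneg_left hQle (by linarith : 0 ≤ A)
    have h2 := mul_le_mul_of_nonneg_right a2 hW
    linarith
  have b2 : 2 * A ^ 2 * c * W ≤ 1 / 8 * W := mul_le_mul_of_nonneg_right a1 hW
  have hABX : 0 ≤ A * B * ((1 + R ^ 2) * k) := by positivity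
  have hABV : V ≤ A * B * V := le_mul_of_one_le_left hV (one_le_mul_of_one_le_of_one_le hA hB)
  have b3 : S ≤ 2 * (2 * Δ / c₁ * k + 5 * (A * B * ((1 + R ^ 2) * k)) + 5 * (A * B * V)) := by
    have : 0 ≤ 2 * Δ / c₁ * k := by positivity
    linarith
  have d1 : 0 ≤ Δ / c₁ * V := by positivity
  have d2 : 0 ≤ A * B * (1 + R ^ 2) * V := by positivity
  have d3 : 0 ≤ A * B * k := by positivity
  linear_combination b3 + 4 * d1 + 10 * d2 + 10 * d3 + 2 * hk + 2 * hV

/-- The bound α ≤ c₀κ⁻⁵ keeps κ¹⁰∑D below Ac₀²W, which closes the loop between bias and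
displacement; the lower bound on α converts Δ/α into κ⁵. -/
theorem ErrorRecursion.rate (h : ErrorRecursion A b κ α nf n1 ng n2 e w G E D φ)
    (hA : 1 ≤ A) (hb : 0 < b) (hb1 : b ≤ 1) (hκ : 1 ≤ κ) (hnf : 0 ≤ nf) (hn1 : 0 ≤ n1)
    (hng : 0 ≤ ng) (hn2 : 0 ≤ n2) (hG : ∀ k, 0 ≤ G k) {R Δ c₁ B : ℝ}
    (hB : B = 128 * A ^ 2 / b ^ 2) (hc₁ : 0 < c₁) (hα1 : c₁ / κ ^ 5 ≤ α)
    (hα2 : α ≤ 1 / (16 * A ^ 2 * B) / κ ^ 5) (he : e 0 ≤ R ^ 2) {K : ℕ} (hK : 1 ≤ K)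
    (hφ : φ 0 - φ K ≤ Δ) :
    1 / (K : ℝ) * ∑ k ∈ Finset.range K, G k
      ≤ 2 * (2 * |Δ| / c₁ + 5 * A * B * (1 + R ^ 2) + 5 * A * B + 1) * (κ ^ 5 / K
        + κ ^ 2 * nf + κ ^ 2 * n1 + κ ^ 8 * ng + κ ^ 4 * n2) := by
  have hκ0 : 0 < κ := by linarith
  have hκ5 : 0 < κ ^ 5 := by positivity
  have hα0 : 0 < α := lt_of_lt_of_le (by positivity) hα1
  have hB1 : 1 ≤ B := by
    rw [hB, le_div_iff₀ (by positivity)]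
    nlinarith
  have hK0 : (0 : ℝ) < K := by exact_mod_cast hK
  set c₀ := 1 / (16 * A ^ 2 * B) with hc₀
  have hc0 : 0 < c₀ := by positivity
  have hc0' : 16 * A ^ 2 * B * c₀ = 1 := by rw [hc₀]; field_simp
  have hακ : α * κ ^ 5 ≤ c₀ := by rwa [le_div_iff₀ hκ5] at hα2
  set SG := ∑ k ∈ Finset.range K, G k with hSG
  set SE := ∑ k ∈ Finset.range K, E k with hSE
  set SD := ∑ k ∈ Finset.range K, D k with hSD
  set Q := κ ^ 2 * (∑ k ∈ Finset.range K, e k) + ∑ k ∈ Finset.range K, w k with hQ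
  set V := κ ^ 2 * nf + κ ^ 2 * n1 + κ ^ 8 * ng + κ ^ 4 * n2 with hV
  have hSG0 : 0 ≤ SG := Finset.sum_nonneg fun k _ => hG k
  have hQ0 : 0 ≤ Q := by
    have h1 : 0 ≤ ∑ k ∈ Finset.range K, e k := Finset.sum_nonneg fun k _ => h.e_nonneg k
    have h2 : 0 ≤ ∑ k ∈ Finset.range K, w k := Finset.sum_nonneg fun k _ => h.w_nonneg k
    positivity
  have hV0 : 0 ≤ V := by positivity
  have hSEQ : SE ≤ A * Q := by
    calc SE ≤ ∑ k ∈ Finset.range K, A * (κ ^ 2 * e k + w k) :=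
          Finset.sum_le_sum fun k _ => h.E_le k
      _ = A * Q := by rw [← Finset.mul_sum, Finset.sum_add_distrib, ← Finset.mul_sum]
  have hnV : nf + κ ^ 2 * n1 ≤ V := by
    have : nf ≤ κ ^ 2 * nf := le_mul_of_one_le_left hnf (one_le_pow₀ hκ)
    have h3 : 0 ≤ κ ^ 8 * ng := by positivity
    have h4 : 0 ≤ κ ^ 4 * n2 := by positivity
    linarith
  set W := SG + A * Q + K * V with hW
  have hW0 : 0 ≤ W := by positivity
  have hSDW : SD ≤ A * α ^ 2 * W := by
    calc SD ≤ ∑ k ∈ Finset.range K, A * α ^ 2 * (G k + E k + nf + κ ^ 2 * n1) :=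
          Finset.sum_le_sum fun k _ => h.D_le k
      _ = A * α ^ 2 * (SG + SE + K * (nf + κ ^ 2 * n1)) := by
          rw [← Finset.mul_sum, Finset.sum_add_distrib, Finset.sum_add_distrib,
            Finset.sum_add_distrib, Finset.sum_const, Finset.sum_const, Finset.card_range,
            nsmul_eq_mul, nsmul_eq_mul]
          ring
      _ ≤ A * α ^ 2 * W := by
          have : (K : ℝ) * (nf + κ ^ 2 * n1) ≤ K * V := by gcongr
          have : SG + SE + K * (nf + κ ^ 2 * n1) ≤ W := by linarith
          gcongr
  have hSD10 : κ ^ 10 * SD ≤ A * c₀ ^ 2 * W := by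
    calc κ ^ 10 * SD ≤ κ ^ 10 * (A * α ^ 2 * W) := by gcongr
      _ = A * (α * κ ^ 5) ^ 2 * W := by ring
      _ ≤ A * c₀ ^ 2 * W := by gcongr
  -- One factor α is kept in front, because the descent inequality is later divided by α; the other
  -- needs only ακ³ ≤ ακ⁵ ≤ c₀.
  have hSD3 : κ ^ 3 * SD ≤ α * (A * c₀ * W) := by
    have h1 : α * κ ^ 3 ≤ c₀ := by
      refine le_trans ?_ hακ
      exact mul_le_mul_of_nonneg_left (pow_le_pow_right₀ hκ (by norm_num)) hα0.le
    calc κ ^ 3 * SD ≤ κ ^ 3 * (A * α ^ 2 * W) := by gcongr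
      _ = α * (A * (α * κ ^ 3) * W) := by ring
      _ ≤ α * (A * c₀ * W) := by gcongr
  have hQle : Q ≤ B * ((1 + R ^ 2) * κ ^ 5 + A * c₀ ^ 2 * W + K * V) := by
    have h1 := h.sum_le hA hb hb1 hκ hnf hng hn2 he K
    rw [← hB] at h1
    refine h1.trans (mul_le_mul_of_nonneg_left ?_ (by linarith))
    have h2 : (K : ℝ) * (κ ^ 2 * nf + κ ^ 8 * ng + κ ^ 4 * n2) ≤ K * V := by
      gcongr
      have : 0 ≤ κ ^ 2 * n1 := by positivity
      linarith
    linarith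
  have hdesc : SG ≤ 2 * Δ / α + A * Q + 2 * A ^ 2 * c₀ * W := by
    have h1 : ∀ K : ℕ, φ K ≤ φ 0 - α / 2 * (∑ k ∈ Finset.range K, G k)
        + α / 2 * (∑ k ∈ Finset.range K, E k) + A * κ ^ 3 * ∑ k ∈ Finset.range K, D k := by
      intro K
      induction K with
      | zero => simp
      | succ K ih =>
        rw [Finset.sum_range_succ, Finset.sum_range_succ, Finset.sum_range_succ]
        linarith [h.φ_le K]
    have h2 := h1 K
    have h3 : A * (κ ^ 3 * SD) ≤ A * (α * (A * c₀ * W)) := by gcongr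
    have h4 : α / 2 * SE ≤ α / 2 * (A * Q) := by gcongr
    have h5 : α / 2 * SG ≤ Δ + α / 2 * (A * Q) + A * (α * (A * c₀ * W)) := by linarith
    have h6 : SG = 2 / α * (α / 2 * SG) := by field_simp
    rw [h6]
    refine (mul_le_mul_of_nonneg_left h5 (by positivity)).trans_eq ?_
    field_simp
  have hΔ : 2 * Δ / α ≤ 2 * |Δ| / c₁ * κ ^ 5 := by
    have h1 : 1 / α ≤ κ ^ 5 / c₁ := by
      rw [div_le_div_iff₀ hα0 hc₁]
      rw [div_le_iff₀ hκ5] at hα1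
      linarith
    calc 2 * Δ / α ≤ 2 * |Δ| * (1 / α) := by
          rw [mul_one_div]; gcongr; exact le_abs_self Δ
      _ ≤ 2 * |Δ| * (κ ^ 5 / c₁) := by gcongr
      _ = _ := by ring
  set X := (1 + R ^ 2) * κ ^ 5 with hX
  have hX0 : 0 ≤ X := by positivity
  have hKV : 0 ≤ K * V := by positivity
  have hfinal := le_of_absorption hA hB1 hc0' hSG0 hQ0 hKV hκ5.le (abs_nonneg Δ) hc₁ hdesc hΔ hQle
  calc 1 / (K : ℝ) * SG ≤ 1 / (K : ℝ) * (2 * (2 * |Δ| / c₁ + 5 * A * B * (1 + R ^ 2)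
        + 5 * A * B + 1) * (κ ^ 5 + K * V)) := by gcongr
    _ = _ := by
      have e1 : κ ^ 5 / K + κ ^ 2 * nf + κ ^ 2 * n1 + κ ^ 8 * ng + κ ^ 4 * n2
          = 1 / K * (κ ^ 5 + K * V) := by
        rw [hV]; field_simp; ring
      rw [e1]; ring

end Scalar

end SSGD

namespace SSGD

/-! ### Constants independent of μ. -/

section Constants

/-- With d = b/(4κ) the inner rate is 1 − 4d, and even two Young factors 1 + d leave a rate of at
most 1 − d. The complementary Young factor 1 + 1/d is of order κ. -/
theorem contraction_bounds {b κ : ℝ} (hb : 0 < b) (hb1 : b ≤ 1) (hκ : 1 ≤ κ) :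
    0 ≤ 1 - b / κ ∧ 0 < b / (4 * κ) ∧ b / (4 * κ) ≤ 1 ∧
    (1 + b / (4 * κ)) * (1 - b / κ) ≤ 1 - b / (4 * κ) ∧
    (1 + b / (4 * κ)) ^ 2 * (1 - b / κ) ≤ 1 - b / (4 * κ) ∧
    1 + 1 / (b / (4 * κ)) ≤ 5 / b * κ := by
  have hκ0 : 0 < κ := by linarith
  obtain ⟨d, hd⟩ : ∃ d, d = b / (4 * κ) := ⟨_, rfl⟩
  have h4 : b / κ = 4 * d := by rw [hd]; field_simp
  have hd0 : 0 < d := by rw [hd]; positivity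
  have hd1 : b / κ ≤ 1 := by rw [div_le_one hκ0]; linarith
  rw [← hd, h4]
  rw [h4] at hd1
  refine ⟨by linarith, hd0, by linarith, ?_, ?_, ?_⟩
  · linear_combination 2 * hd0 + 4 * mul_pos hd0 hd0
  · linear_combination hd0 + 7 * mul_pos hd0 hd0 + 4 * mul_pos hd0 (mul_pos hd0 hd0)
  · have h1 : 1 / d = 4 / b * κ := by rw [hd]; field_simp
    have h2 : 1 ≤ 1 / b * κ := by
      rw [one_div, inv_mul_eq_div, le_div_iff₀ hb]; linarith
    rw [h1]
    linear_combination h2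

/-- The drift of y* contributes κ² and Young's inequality one more κ; the noise is divided by 1 − r
= b/κ. -/
theorem errY_step_le {A b κ L β e e' D ng : ℝ} (hb : 0 < b) (hb1 : b ≤ 1)
    (hκ : 1 ≤ κ) (hA : 5 / b ≤ A) (hA' : 4 / (L ^ 2 * b) ≤ A) (hβ : β ^ 2 ≤ 4 / L ^ 2)
    (he : 0 ≤ e) (hD : 0 ≤ D) (hng : 0 ≤ ng)
    (h : e' ≤ (1 - b / κ) * ((1 + b / (4 * κ)) * e + (1 + 1 / (b / (4 * κ))) * (κ ^ 2 * D))
      + β ^ 2 * ng / (1 - (1 - b / κ))) :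
    e' ≤ (1 - b / (4 * κ)) * e + A * (κ ^ 3 * D + κ * ng) := by
  have hκ0 : 0 < κ := by linarith
  obtain ⟨hr0, hd0, hd1, h1, -, h3⟩ := contraction_bounds hb hb1 hκ
  have hr1 : 1 - b / κ ≤ 1 := by have : 0 ≤ b / κ := by positivity
                                 linarith
  have t1 := mul_le_mul_of_nonneg_right h1 he
  have t2 : (1 - b / κ) * ((1 + 1 / (b / (4 * κ))) * (κ ^ 2 * D)) ≤ 1 * (A * κ * (κ ^ 2 * D)) := by
    have : 1 + 1 / (b / (4 * κ)) ≤ A * κ := h3.trans (by gcongr)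
    gcongr
  have t3 : β ^ 2 * ng / (1 - (1 - b / κ)) ≤ A * κ * ng := by
    have e1 : β ^ 2 * ng / (1 - (1 - b / κ)) = β ^ 2 / b * κ * ng := by
      rw [sub_sub_cancel]; field_simp
    have e2 : β ^ 2 / b ≤ A := by
      refine le_trans ?_ hA'
      rw [← div_div]
      gcongr
    rw [e1]
    gcongr
  linear_combination h + t1 + t2 + t3

/-- The squared Lipschitz constant of `vStar` is of order κ⁴; Young's factor makes it κ⁵ in front of
e', and the Lipschitz constant of y* adds κ² in front of D. In 40/b, 5 comes from Young and 8 from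
2(1 + κ)² ≤ 8κ². -/
theorem errV_step_le {A b κ L m n η w w' e' D nf n2 : ℝ} (hL : 0 < L) (hb : 0 < b) (hb1 : b ≤ 1)
    (hκ : 1 ≤ κ) (hn : 0 ≤ n) (hA : 40 / b * (1 + n) ^ 2 ≤ A)
    (hA' : 2 / (L ^ 2 * b) * (1 + m ^ 2) ≤ A) (hη : η ^ 2 ≤ 1 / L ^ 2)
    (hw : 0 ≤ w) (he : 0 ≤ e') (hD : 0 ≤ D) (hnf : 0 ≤ nf) (hn2 : 0 ≤ n2)
    (h : w' ≤ (1 + b / (4 * κ)) * ((1 - b / κ) * ((1 + b / (4 * κ)) * w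
        + (1 + 1 / (b / (4 * κ))) * ((κ + n * κ ^ 2) ^ 2 *
          (2 * ((1 + κ) ^ 2 * D) + 2 * e')))
        + η ^ 2 * (nf + (m * κ) ^ 2 * n2) / (1 - (1 - b / κ)))
      + (1 + 1 / (b / (4 * κ))) * ((κ + n * κ ^ 2) ^ 2 * e')) :
    w' ≤ (1 - b / (4 * κ)) * w + A * (κ ^ 7 * D + κ ^ 5 * e' + κ * nf + κ ^ 3 * n2) := by
  have hκ0 : 0 < κ := by linarith
  obtain ⟨hr0, hd0, hd1, h1, h2, h3⟩ := contraction_bounds hb hb1 hκ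
  have t1 := mul_le_mul_of_nonneg_right h2 hw
  have hc : (κ + n * κ ^ 2) ^ 2 ≤ (1 + n) ^ 2 * κ ^ 4 := by
    have : κ + n * κ ^ 2 ≤ (1 + n) * κ ^ 2 := by
      linear_combination le_self_pow₀ hκ two_ne_zero
    calc (κ + n * κ ^ 2) ^ 2 ≤ ((1 + n) * κ ^ 2) ^ 2 := by gcongr
      _ = _ := by ring
  have hp : (1 + 1 / (b / (4 * κ))) * (κ + n * κ ^ 2) ^ 2 ≤ A / 8 * κ ^ 5 := by
    calc (1 + 1 / (b / (4 * κ))) * (κ + n * κ ^ 2) ^ 2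
        ≤ 5 / b * κ * ((1 + n) ^ 2 * κ ^ 4) := by gcongr
      _ = 40 / b * (1 + n) ^ 2 / 8 * κ ^ 5 := by ring
      _ ≤ A / 8 * κ ^ 5 := by gcongr
  have hA0 : 0 ≤ A := le_trans (by positivity) hA
  have hq : (1 + b / (4 * κ)) * (1 - b / κ) ≤ 1 := by linarith
  have hκ2 : (1 + κ) ^ 2 ≤ 4 * κ ^ 2 := by
    calc (1 + κ) ^ 2 ≤ (κ + κ) ^ 2 := by gcongr
      _ = _ := by ring
  have t2 : (1 + b / (4 * κ)) * (1 - b / κ) * (((1 + 1 / (b / (4 * κ))) * (κ + n * κ ^ 2) ^ 2) *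
      (2 * ((1 + κ) ^ 2 * D) + 2 * e')) ≤ 1 * (A / 8 * κ ^ 5 * (2 * (4 * κ ^ 2 * D) + 2 * e')) := by
    gcongr
  have t3 : ((1 + 1 / (b / (4 * κ))) * (κ + n * κ ^ 2) ^ 2) * e' ≤ A / 8 * κ ^ 5 * e' := by gcongr
  have t4 : (1 + b / (4 * κ)) * (η ^ 2 * (nf + (m * κ) ^ 2 * n2) / (1 - (1 - b / κ)))
      ≤ A * κ * nf + A * κ ^ 3 * n2 := by
    have e1 : (1 + b / (4 * κ)) * (η ^ 2 * (nf + (m * κ) ^ 2 * n2) / (1 - (1 - b / κ)))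
        = (1 + b / (4 * κ)) * (η ^ 2 / b) * κ * (nf + (m * κ) ^ 2 * n2) := by
      rw [sub_sub_cancel]; field_simp
    have e2 : (1 + b / (4 * κ)) * (η ^ 2 / b) ≤ 2 / (L ^ 2 * b) := by
      calc (1 + b / (4 * κ)) * (η ^ 2 / b) ≤ (1 + 1) * (1 / L ^ 2 / b) := by gcongr
        _ = _ := by rw [div_div]; ring
    have e3 : 0 ≤ 2 / (L ^ 2 * b) := by positivity
    have e4 : 2 / (L ^ 2 * b) ≤ A := by
      linear_combination hA' + mul_nonneg e3 (sq_nonneg m)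
    have e5 : 2 / (L ^ 2 * b) * m ^ 2 ≤ A := by linear_combination hA' + e3
    rw [e1]
    calc (1 + b / (4 * κ)) * (η ^ 2 / b) * κ * (nf + (m * κ) ^ 2 * n2)
        ≤ 2 / (L ^ 2 * b) * κ * (nf + (m * κ) ^ 2 * n2) := by gcongr
      _ = 2 / (L ^ 2 * b) * (κ * nf) + 2 / (L ^ 2 * b) * m ^ 2 * (κ ^ 3 * n2) := by ring
      _ ≤ A * (κ * nf) + A * (κ ^ 3 * n2) := by gcongr
      _ = _ := by ring
  have u1 : 0 ≤ A * (κ ^ 5 * e') := by positivity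
  have u2 : 0 ≤ A * (κ ^ 7 * D) := by positivity
  linear_combination h + t1 + t2 + t3 + t4 + 5 / 8 * u1

/-- The constant in the error recursions of SSGD. -/
noncomputable def recursionConst (L M τ ρ b : ℝ) : ℝ :=
  2 + 5 / b + 4 / (L ^ 2 * b) + 40 / b * (1 + ρ * (M / L) / L) ^ 2
    + 2 / (L ^ 2 * b) * (1 + (M / L) ^ 2) + 5 * (M / L) ^ 2 + 4 * (L + M / L * (τ + ρ))
    + 2 * (L + τ * (M / L)) ^ 2 + 2 * L ^ 2

theorem recursionConst_bounds {L M τ ρ b : ℝ} (hL : 0 < L) (hM : 0 ≤ M) (hτ : 0 ≤ τ) (hρ : 0 ≤ ρ)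
    (hb : 0 < b) :
    2 ≤ recursionConst L M τ ρ b ∧ 5 / b ≤ recursionConst L M τ ρ b ∧
    4 / (L ^ 2 * b) ≤ recursionConst L M τ ρ b ∧
    40 / b * (1 + ρ * (M / L) / L) ^ 2 ≤ recursionConst L M τ ρ b ∧
    2 / (L ^ 2 * b) * (1 + (M / L) ^ 2) ≤ recursionConst L M τ ρ b ∧
    4 * (M / L) ^ 2 ≤ recursionConst L M τ ρ b ∧
    4 * (L + M / L * (τ + ρ)) ≤ recursionConst L M τ ρ b ∧
    2 * (L + τ * (M / L)) ^ 2 ≤ recursionConst L M τ ρ b ∧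
    2 * L ^ 2 ≤ recursionConst L M τ ρ b := by
  have h1 : 0 ≤ 5 / b := by positivity
  have h2 : 0 ≤ 4 / (L ^ 2 * b) := by positivity
  have h3 : 0 ≤ 40 / b * (1 + ρ * (M / L) / L) ^ 2 := by positivity
  have h4 : 0 ≤ 2 / (L ^ 2 * b) * (1 + (M / L) ^ 2) := by positivity
  have h5 : 0 ≤ (M / L) ^ 2 := by positivity
  have h6 : 0 ≤ L + M / L * (τ + ρ) := by positivity
  have h7 : 0 ≤ (L + τ * (M / L)) ^ 2 := by positivity
  have h8 : 0 ≤ L ^ 2 := by positivity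
  unfold recursionConst
  refine ⟨?_, ?_, ?_, ?_, ?_, ?_, ?_, ?_, ?_⟩ <;> linarith

/-- For a step t between b/L and 2/(μ + L) one has 0 ≤ tμ ≤ 1, so (1 − tμ)² ≤ 1 − tμ ≤ 1 − bμ/L. -/
theorem Params.Admissible.contracting {a : Params} {μ L b c₁ c₀ : ℝ}
    (ha : a.Admissible μ L b c₁ c₀) (hμ : 0 < μ) (hμL : μ ≤ L) (hb : 0 < b) (hc₁ : 0 < c₁) :
    a.Contracting μ L (1 - b / (L / μ)) := by
  have hL : 0 < L := hμ.trans_le hμL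
  have hsum : 0 < μ + L := by linarith
  have key : ∀ t : ℝ, b / L ≤ t → t * (μ + L) ≤ 2 → (1 - t * μ) ^ 2 ≤ 1 - b / (L / μ) := by
    intro t h1 h2
    have h3 : b / (L / μ) = b / L * μ := by field_simp
    have h4 : b / L * μ ≤ t * μ := by gcongr
    have ht : 0 ≤ t := le_trans (by positivity) h1
    have h5 : t * μ ≤ 1 := by
      have : t * μ ≤ t * L := by gcongr
      linarith
    have h6 : (1 - t * μ) * (1 - t * μ) ≤ 1 * (1 - t * μ) :=
      mul_le_mul_of_nonneg_right (by linarith [mul_nonneg ht hμ.le]) (by linarith)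
    rw [h3, sq]
    linarith
  have hβ : a.β * (μ + L) ≤ 2 := (le_div_iff₀ hsum).1 ha.β_upper
  have hη0 : 0 ≤ a.η := le_trans (by positivity) ha.η_lower
  have hη : a.η * (μ + L) ≤ 2 := by
    have h1 := (le_div_iff₀ hL).1 ha.η_upper.le
    have h2 : a.η * μ ≤ a.η * L := by gcongr
    linarith
  have hκ : 0 < b / (L / μ) := by positivity
  exact ⟨le_trans (by positivity) ha.α_lower, le_trans (by positivity) ha.β_lower, hβ,
    key _ ha.β_lower hβ, hη0, hη, key _ ha.η_lower hη, by linarith,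
    ha.T_pos, ha.J_pos, ha.Df_pos, ha.Dg_pos, ha.S_pos, ha.D_pos⟩

end Constants

/-! ### The scalar recursions for the iterates of SSGD. -/

section Instance

variable {p q : ℕ} {Ξ : Type u} {Z : Type v} {Ω : Type w} [MeasurableSpace Ξ] [MeasurableSpace Z]
  [MeasurableSpace Ω] {P : Problem p q Ξ Z} {Pr : Measure Ω} {ξ : DrawF → Ω → Ξ}
  {ζ : DrawG → Ω → Z} {μ L M τ ρ σf σg σg1 σg2 : ℝ}

/-- Writes every coefficient as a power of κ times a quantity independent of μ, with the Young
weight b/(4κ). -/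
theorem errorRecursion_runState (hI : IsSampling P Pr ξ ζ)
    (h : P.Standing μ L M τ ρ σf σg σg1 σg2) {a : Params} {b c₁ c₀ : ℝ}
    (ha : a.Admissible μ L b c₁ c₀) (hb : 0 < b) (hb1 : b ≤ 1) (hc₁ : 0 < c₁)
    {x₀ : Vec p} {y₀ v₀ : Vec q} (hv : ‖v₀‖ ≤ M / μ) :
    ErrorRecursion (recursionConst L M τ ρ b) b (L / μ) a.α (σf ^ 2 / a.Df) (σg1 ^ 2 / a.Dg)
      (σg ^ 2 / a.S) (σg2 ^ 2 / a.D)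
      (fun k => errY P Pr (runState P a x₀ y₀ v₀ ξ ζ k))
      (fun k => errV P Pr (runState P a x₀ y₀ v₀ ξ ζ k))
      (fun k => sqGrad P Pr (runState P a x₀ y₀ v₀ ξ ζ k))
      (fun k => errDir P Pr (runState P a x₀ y₀ v₀ ξ ζ k))
      (fun k => moveX Pr (runState P a x₀ y₀ v₀ ξ ζ k) (runState P a x₀ y₀ v₀ ξ ζ (k + 1)))
      (fun k => ∫ ω, P.Φ (runState P a x₀ y₀ v₀ ξ ζ k ω).x ∂Pr) := by
  have := hI.isProbabilityMeasure
  have hμ := h.μ_pos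
  have hL := h.L_pos
  have hM := h.M_nonneg
  have hτ := h.τ_nonneg
  have hρ := h.ρ_nonneg
  have hκ : 1 ≤ L / μ := (one_le_div hμ).2 h.μ_le
  have hct := ha.contracting hμ h.μ_le hb hc₁
  have hd := (contraction_bounds hb hb1 hκ).2.1
  have hst := randState_runState (x₀ := x₀) (y₀ := y₀) hI h hct hv
  have hst' := fun k => (hst k).mono (hI.past_le _)
  have hrec := fun k => (outerStep_recursion hI h hct (hst k)
    (s' := runState P a x₀ y₀ v₀ ξ ζ (k + 1)) rfl hd).2
  obtain ⟨b1, b2, b3, b4, b5, b6, b7, b8, b9⟩ := recursionConst_bounds hL hM hτ hρ hb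
  have hMμ : M / μ = M / L * (L / μ) := by field_simp
  have hρμ : ρ * M / μ ^ 2 = ρ * (M / L) / L * (L / μ) ^ 2 := by field_simp
  have hτμ : τ * M / μ = τ * (M / L) * (L / μ) := by field_simp
  have hn : 0 ≤ ρ * (M / L) / L := by positivity
  have hm : 0 ≤ M / L := by positivity
  have hE := fun k => errDir_le h (hst' k)
  have hW := fun k => errV_le h (hst' k)
  have he0 : ∀ k, 0 ≤ errY P Pr (runState P a x₀ y₀ v₀ ξ ζ k) := fun k =>
    integral_nonneg fun _ => by positivity
  have hw0 : ∀ k, 0 ≤ errV P Pr (runState P a x₀ y₀ v₀ ξ ζ k) := fun k =>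
    integral_nonneg fun _ => by positivity
  have hG0 : ∀ k, 0 ≤ sqGrad P Pr (runState P a x₀ y₀ v₀ ξ ζ k) := fun k =>
    integral_nonneg fun _ => by positivity
  have hE0 : ∀ k, 0 ≤ errDir P Pr (runState P a x₀ y₀ v₀ ξ ζ k) := fun k =>
    integral_nonneg fun _ => by positivity
  have hD0 : ∀ k, 0 ≤ moveX Pr (runState P a x₀ y₀ v₀ ξ ζ k)
      (runState P a x₀ y₀ v₀ ξ ζ (k + 1)) := fun k => integral_nonneg fun _ => by positivity
  have hβ : a.β ^ 2 ≤ 4 / L ^ 2 := by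
    have h1 : a.β ≤ 2 / L := ha.β_upper.trans (by gcongr; linarith)
    calc a.β ^ 2 ≤ (2 / L) ^ 2 := pow_le_pow_left₀ hct.β_nonneg h1 2
      _ = _ := by rw [div_pow]; norm_num
  have hη : a.η ^ 2 ≤ 1 / L ^ 2 := by
    calc a.η ^ 2 ≤ (1 / L) ^ 2 := pow_le_pow_left₀ hct.η_nonneg ha.η_upper.le 2
      _ = _ := by rw [div_pow]; norm_num
  have hnf : 0 ≤ σf ^ 2 / a.Df := by positivity
  have hn1 : 0 ≤ σg1 ^ 2 / a.Dg := by positivity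
  have hng : 0 ≤ σg ^ 2 / a.S := by positivity
  have hn2 : 0 ≤ σg2 ^ 2 / a.D := by positivity
  -- From here on μ enters only through κ = L/μ, which is then generalized to a free variable.
  simp only [hMμ, hρμ, hτμ, mul_div_assoc _ (σg2 ^ 2), mul_div_assoc _ (σg1 ^ 2)] at hrec hE hW
  generalize L / μ = κ at *
  generalize recursionConst L M τ ρ b = A at *
  generalize M / L = m at *
  generalize σf ^ 2 / (a.Df : ℝ) = nf at *
  generalize σg1 ^ 2 / (a.Dg : ℝ) = n1 at *
  generalize σg ^ 2 / (a.S : ℝ) = ng at *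
  generalize σg2 ^ 2 / (a.D : ℝ) = n2 at *
  have hκ0 : 0 < κ := by linarith
  have hκκ : (1 + κ) ^ 2 ≤ 4 * κ ^ 2 := by
    calc (1 + κ) ^ 2 ≤ (κ + κ) ^ 2 := by gcongr
      _ = _ := by ring
  refine ⟨he0, hw0, hD0, fun k => ?_, fun k => ?_, fun k => ?_, fun k => ?_, fun k => ?_,
    fun k => ?_⟩
  · exact errY_step_le hb hb1 hκ b2 b3 hβ (he0 k) (hD0 k) hng (hrec k).1
  · exact errV_step_le hL hb hb1 hκ hn b4 b5 hη (hw0 k) (he0 (k + 1)) (hD0 k) hnf hn2 (hrec k).2.1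
  · refine (hW k).trans ?_
    calc (2 * (m * κ)) ^ 2 = 4 * m ^ 2 * κ ^ 2 := by ring
      _ ≤ A * κ ^ 2 := by gcongr
  · refine (hE k).trans ?_
    have e1 : 2 * (L + τ * m * κ) ^ 2 ≤ A * κ ^ 2 := by
      have : L + τ * m * κ ≤ (L + τ * m) * κ := by
        linear_combination mul_le_mul_of_nonneg_left hκ hL.le
      calc 2 * (L + τ * m * κ) ^ 2 ≤ 2 * ((L + τ * m) * κ) ^ 2 := by gcongr
        _ = 2 * (L + τ * m) ^ 2 * κ ^ 2 := by ring
        _ ≤ A * κ ^ 2 := by gcongr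
    have e2 := mul_le_mul_of_nonneg_right e1 (he0 k)
    have e3 := mul_le_mul_of_nonneg_right b9 (hw0 k)
    linarith
  · refine (hrec k).2.2.1.trans ?_
    have e1 := mul_le_mul_of_nonneg_right b1 (hG0 k)
    have e2 := mul_le_mul_of_nonneg_right b1 (hE0 k)
    have e3 : 1 * nf ≤ A * nf := mul_le_mul_of_nonneg_right (by linarith) hnf
    have e4 : m ^ 2 * (κ ^ 2 * n1) ≤ A * (κ ^ 2 * n1) :=
      mul_le_mul_of_nonneg_right (by linarith [sq_nonneg m]) (by positivity)
    linear_combination a.α ^ 2 * (e1 + e2 + e3 + e4)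
  · refine (hrec k).2.2.2.trans ?_
    have e1 : (L + m * κ * (τ + ρ)) * (1 + κ) ^ 2 ≤ A * κ ^ 3 := by
      have : L + m * κ * (τ + ρ) ≤ (L + m * (τ + ρ)) * κ := by
        linear_combination mul_le_mul_of_nonneg_left hκ hL.le
      calc (L + m * κ * (τ + ρ)) * (1 + κ) ^ 2
          ≤ (L + m * (τ + ρ)) * κ * (4 * κ ^ 2) := by gcongr
        _ = 4 * (L + m * (τ + ρ)) * κ ^ 3 := by ring
        _ ≤ A * κ ^ 3 := by gcongr
    have e2 := mul_le_mul_of_nonneg_right e1 (hD0 k)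
    linarith

end Instance

end SSGD

namespace SSGD

/-- The admissible size of `α κ⁵`. -/
noncomputable def stepConst (L M τ ρ b : ℝ) : ℝ :=
  1 / (16 * recursionConst L M τ ρ b ^ 2 * (128 * recursionConst L M τ ρ b ^ 2 / b ^ 2))

/-- The constant of the convergence rate. -/
noncomputable def rateConst (L M τ ρ b c₁ Δ R : ℝ) : ℝ :=
  2 * (2 * |Δ| / c₁ + 5 * recursionConst L M τ ρ b
    * (128 * recursionConst L M τ ρ b ^ 2 / b ^ 2) * (1 + R ^ 2)
    + 5 * recursionConst L M τ ρ b * (128 * recursionConst L M τ ρ b ^ 2 / b ^ 2) + 1)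

/-! ### The convergence rate. -/

section Rate

variable {p q : ℕ} {Ξ : Type u} {Z : Type v} {Ω : Type w} [MeasurableSpace Ξ] [MeasurableSpace Z]
  [MeasurableSpace Ω] {P : Problem p q Ξ Z} {Pr : Measure Ω} {ξ : DrawF → Ω → Ξ}
  {ζ : DrawG → Ω → Z} {μ L M τ ρ σf σg σg1 σg2 : ℝ}

theorem convergence_rate (hI : IsSampling P Pr ξ ζ) (h : P.Standing μ L M τ ρ σf σg σg1 σg2)
    {a : Params} {b c₁ Δ R : ℝ} (ha : a.Admissible μ L b c₁ (stepConst L M τ ρ b)) (hb : 0 < b)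
    (hb1 : b ≤ 1) (hc₁ : 0 < c₁) {x₀ : Vec p} {y₀ v₀ : Vec q}
    (h₀ : P.InitOK μ M Δ R x₀ y₀ v₀) :
    Differentiable ℝ P.Φ ∧
    (∀ k : ℕ, Integrable (fun ω => ‖gradient P.Φ
      (run P a x₀ y₀ v₀ (fun d => ξ d ω) (fun d => ζ d ω) k).x‖ ^ 2) Pr) ∧
    ∀ K : ℕ, 1 ≤ K →
      (1 / (K : ℝ)) * ∑ k ∈ Finset.range K, ∫ ω, ‖gradient P.Φ
          (run P a x₀ y₀ v₀ (fun d => ξ d ω) (fun d => ζ d ω) k).x‖ ^ 2 ∂Pr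
        ≤ rateConst L M τ ρ b c₁ Δ R * ((L / μ) ^ 5 / K
          + (L / μ) ^ 2 * σf ^ 2 / a.Df
          + (L / μ) ^ 2 * σg1 ^ 2 / a.Dg
          + (L / μ) ^ 8 * σg ^ 2 / a.S
          + (L / μ) ^ 4 * σg2 ^ 2 / a.D) := by
  have := hI.isProbabilityMeasure
  have hκ : 1 ≤ L / μ := (one_le_div h.μ_pos).2 h.μ_le
  have hct := ha.contracting h.μ_pos h.μ_le hb hc₁
  have hst := fun k => (randState_runState (x₀ := x₀) (y₀ := y₀) hI h hct h₀.norm_v₀ k).mono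
    (hI.past_le _)
  refine ⟨fun x => (h.hasGradientAt_Φ x).differentiableAt, fun k => ?_, fun K hK => ?_⟩
  · rw [h.gradient_Φ]
    exact integrable_norm_sq ((hst k).memLp_hyperGrad h)
  · have hrec := errorRecursion_runState (x₀ := x₀) (y₀ := y₀) hI h ha hb hb1 hc₁ h₀.norm_v₀
    have hA := (recursionConst_bounds h.L_pos h.M_nonneg h.τ_nonneg h.ρ_nonneg hb).1
    have he : errY P Pr (runState P a x₀ y₀ v₀ ξ ζ 0) ≤ R ^ 2 := by
      have e1 : errY P Pr (runState P a x₀ y₀ v₀ ξ ζ 0) = ‖y₀ - P.yStar x₀‖ ^ 2 := by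
        simp [errY, runState, run, loop]
      rw [e1]
      exact pow_le_pow_left₀ (norm_nonneg _) h₀.dist_y₀ 2
    -- The gap bound holds at every point, so it can be integrated at the random point xᴷ.
    have hφ : ∫ ω, P.Φ (runState P a x₀ y₀ v₀ ξ ζ 0 ω).x ∂Pr
        - ∫ ω, P.Φ (runState P a x₀ y₀ v₀ ξ ζ K ω).x ∂Pr ≤ Δ := by
      rw [← integral_sub ((hst 0).integrable_Φ h) ((hst K).integrable_Φ h)]
      refine (integral_mono (((hst 0).integrable_Φ h).sub ((hst K).integrable_Φ h))
        (integrable_const Δ) fun ω => h₀.gap _).trans_eq ?_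
      simp
    have hr := hrec.rate (by linarith) hb hb1 hκ (by positivity) (by positivity) (by positivity)
      (by positivity) (fun k => integral_nonneg fun _ => by positivity) rfl hc₁ ha.α_lower
      ha.α_upper he hK hφ
    rw [h.gradient_Φ]
    rw [mul_div_assoc _ (σf ^ 2), mul_div_assoc _ (σg1 ^ 2), mul_div_assoc _ (σg ^ 2),
      mul_div_assoc _ (σg2 ^ 2)]
    exact hr

end Rate

/-! ### Random output and oracle complexity. -/

section Complexity

theorem integral_uniformOn_prod {Ω : Type w} [MeasurableSpace Ω] {Pr : Measure Ω}
    [IsProbabilityMeasure Pr] {K : ℕ} (hK : 1 ≤ K) {f : ℕ → Ω → ℝ} (hf : ∀ k, Integrable (f k) Pr) :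
    Integrable (fun z : Fin K × Ω => f z.1 z.2) ((uniformOn Set.univ).prod Pr) ∧
    ∫ z : Fin K × Ω, f z.1 z.2 ∂((uniformOn Set.univ).prod Pr)
      = (1 / (K : ℝ)) * ∑ k ∈ Finset.range K, ∫ ω, f k ω ∂Pr := by
  have : NeZero K := ⟨by omega⟩
  have : IsProbabilityMeasure (uniformOn (Set.univ : Set (Fin K))) :=
    isProbabilityMeasure_uniformOn Set.finite_univ Set.univ_nonempty
  -- Measurability is given for each index separately; a finite sum of indicators of the slices
  -- makes it joint.
  have hm : AEStronglyMeasurable (fun z : Fin K × Ω => f z.1 z.2) ((uniformOn Set.univ).prod Pr) := by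
    have e : (fun z : Fin K × Ω => f z.1 z.2)
        = fun z => ∑ k : Fin K, Set.indicator (Prod.fst ⁻¹' {k}) (fun z => f k z.2) z := by
      funext z
      rw [Finset.sum_eq_single z.1]
      · simp
      · intro k _ hk
        exact Set.indicator_of_notMem (by simpa using hk.symm) _
      · simp
    rw [e]
    refine Finset.aestronglyMeasurable_fun_sum _ fun k _ => ?_
    exact (hf k).aestronglyMeasurable.comp_snd.indicator (measurable_fst (measurableSet_singleton k))
  have hi : Integrable (fun z : Fin K × Ω => f z.1 z.2) ((uniformOn Set.univ).prod Pr) := by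
    rw [integrable_prod_iff hm]
    exact ⟨Filter.Eventually.of_forall fun k => hf k, Integrable.of_finite⟩
  refine ⟨hi, ?_⟩
  have hu : ∀ k : Fin K, (uniformOn (Set.univ : Set (Fin K))).real {k} = 1 / (K : ℝ) := fun k => by
    rw [Measure.real, uniformOn_univ]
    simp
  rw [integral_prod _ hi, integral_fintype Integrable.of_finite, Finset.mul_sum,
    Finset.sum_range (fun k => 1 / (K : ℝ) * ∫ ω, f k ω ∂Pr)]
  exact Finset.sum_congr rfl fun k _ => by rw [hu, smul_eq_mul]

/-- The rounding errors are at most 2 ≤ 2X; the added 1 keeps the number positive even for c = 0,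
the case of zero variance. -/
theorem natCeil_succ_bounds {c X : ℝ} (hc : 0 ≤ c) (hX : 1 ≤ X) :
    c * X ≤ (⌈c * X⌉₊ + 1 : ℕ) ∧ ((⌈c * X⌉₊ + 1 : ℕ) : ℝ) ≤ (c + 2) * X := by
  have h1 := Nat.le_ceil (c * X)
  have h2 := Nat.ceil_lt_add_one (by positivity : 0 ≤ c * X)
  push_cast
  constructor <;> linarith

/-- Number of samples (or iterations) that brings an error `κ ^ m * V / n` below `ε / (5 * C)`. -/
noncomputable def sampleSize (C κ ε V : ℝ) (m : ℕ) : ℕ := ⌈5 * C * V * (κ ^ m / ε)⌉₊ + 1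

theorem sampleSize_spec {C κ ε V : ℝ} {m : ℕ} (hC : 0 < C) (hκ : 1 ≤ κ) (hε : 0 < ε) (hε1 : ε ≤ 1)
    (hV : 0 ≤ V) : C * (κ ^ m * V / sampleSize C κ ε V m) ≤ ε / 5 ∧
      (sampleSize C κ ε V m : ℝ) ≤ (5 * C * V + 2) * (κ ^ m / ε) := by
  have hX : 1 ≤ κ ^ m / ε := by
    rw [le_div_iff₀ hε, one_mul]
    exact hε1.trans (one_le_pow₀ hκ)
  obtain ⟨h1, h2⟩ := natCeil_succ_bounds (c := 5 * C * V) (by positivity) hX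
  refine ⟨?_, h2⟩
  have h3 : (0 : ℝ) < sampleSize C κ ε V m := by
    rw [sampleSize]; positivity
  rw [mul_div_assoc', div_le_iff₀ h3]
  calc C * (κ ^ m * V) = ε / 5 * (5 * C * V * (κ ^ m / ε)) := by field_simp
    _ ≤ _ := by gcongr; exact h1

/-- K is of order κ⁵/ε, so a batch of order κᵐ/ε costs κᵐ⁺⁵/ε² in total; m = 8 dominates. The 5
counts twice the gradients of F (the outer batch is charged to an inner one, as J ≥ 1) and once each
other kind. -/
theorem cost_le {W κ ε : ℝ} (hκ : 1 ≤ κ) (hε : 0 < ε) {K Df Dg S D T J : ℕ}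
    (hT : 1 ≤ T) (hJ : 1 ≤ J) (hK : K ≤ W * (κ ^ 5 / ε)) (hDf : Df ≤ W * (κ ^ 2 / ε))
    (hDg : Dg ≤ W * (κ ^ 2 / ε)) (hS : S ≤ W * (κ ^ 8 / ε)) (hD : D ≤ W * (κ ^ 4 / ε)) :
    ((K * (Df + J * Df) : ℕ) : ℝ) ≤ 5 * W ^ 2 * κ ^ 7 / ε ^ 2 * J ∧
    ((K * (T * S) : ℕ) : ℝ) ≤ 5 * W ^ 2 * κ ^ 13 / ε ^ 2 * T ∧
    ((K * Dg : ℕ) : ℝ) ≤ 5 * W ^ 2 * κ ^ 7 / ε ^ 2 ∧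
    ((K * (J * D) : ℕ) : ℝ) ≤ 5 * W ^ 2 * κ ^ 9 / ε ^ 2 * J ∧
    ((K * (Df + J * Df) + K * (T * S) + K * Dg + K * (J * D) : ℕ) : ℝ)
      ≤ 5 * W ^ 2 * κ ^ 13 / ε ^ 2 * (max T J : ℕ) := by
  have hκ0 : 0 < κ := by linarith
  have hW0 : 0 ≤ W ^ 2 / ε ^ 2 := by positivity
  have hJ1 : (1 : ℝ) ≤ J := by exact_mod_cast hJ
  have hT1 : (1 : ℝ) ≤ T := by exact_mod_cast hT
  have key : ∀ {n : ℕ} {m : ℕ}, (n : ℝ) ≤ W * (κ ^ m / ε) →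
      (K : ℝ) * n ≤ W ^ 2 / ε ^ 2 * κ ^ (m + 5) := fun {n m} hn => by
    refine (mul_le_mul hK hn (Nat.cast_nonneg n) ((Nat.cast_nonneg K).trans hK)).trans_eq ?_
    rw [pow_add]
    field_simp
  have k1 := key hDf
  have k2 := key hDg
  have k3 := key hS
  have k4 := key hD
  have c1 : (K : ℝ) * (Df + J * Df) ≤ 2 * (W ^ 2 / ε ^ 2 * κ ^ 7 * J) := by
    calc (K : ℝ) * (Df + J * Df) = (1 + J) * (K * Df) := by ring
      _ ≤ (J + J) * (W ^ 2 / ε ^ 2 * κ ^ 7) := by gcongr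
      _ = _ := by ring
  have c2 : (K : ℝ) * (T * S) ≤ W ^ 2 / ε ^ 2 * κ ^ 13 * T := by
    calc (K : ℝ) * (T * S) = K * S * T := by ring
      _ ≤ _ := by gcongr
  have c4 : (K : ℝ) * (J * D) ≤ W ^ 2 / ε ^ 2 * κ ^ 9 * J := by
    calc (K : ℝ) * (J * D) = K * D * J := by ring
      _ ≤ _ := by gcongr
  have n1 : 0 ≤ W ^ 2 / ε ^ 2 * κ ^ 7 := by positivity
  have n2 : 0 ≤ W ^ 2 / ε ^ 2 * κ ^ 7 * J := by positivity
  have n3 : 0 ≤ W ^ 2 / ε ^ 2 * κ ^ 13 * T := by positivity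
  have n4 : 0 ≤ W ^ 2 / ε ^ 2 * κ ^ 9 * J := by positivity
  have e : ∀ m : ℕ, 5 * W ^ 2 * κ ^ m / ε ^ 2 = 5 * (W ^ 2 / ε ^ 2 * κ ^ m) := fun m => by ring
  obtain ⟨N, hN⟩ : ∃ N : ℝ, N = (max T J : ℕ) := ⟨_, rfl⟩
  have hNT : (T : ℝ) ≤ N := by rw [hN]; exact_mod_cast le_max_left T J
  have hNJ : (J : ℝ) ≤ N := by rw [hN]; exact_mod_cast le_max_right T J
  have hN1 : 1 ≤ N := hT1.trans hNT
  have q7 : κ ^ 7 ≤ κ ^ 13 := pow_le_pow_right₀ hκ (by norm_num)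
  have q9 : κ ^ 9 ≤ κ ^ 13 := pow_le_pow_right₀ hκ (by norm_num)
  have m1 : W ^ 2 / ε ^ 2 * κ ^ 7 * J ≤ W ^ 2 / ε ^ 2 * κ ^ 13 * N := by gcongr
  have m2 : W ^ 2 / ε ^ 2 * κ ^ 13 * T ≤ W ^ 2 / ε ^ 2 * κ ^ 13 * N := by gcongr
  have m3 : W ^ 2 / ε ^ 2 * κ ^ 7 * 1 ≤ W ^ 2 / ε ^ 2 * κ ^ 13 * N := by gcongr
  have m4 : W ^ 2 / ε ^ 2 * κ ^ 9 * J ≤ W ^ 2 / ε ^ 2 * κ ^ 13 * N := by gcongr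
  rw [← hN, e, e, e]
  push_cast
  refine ⟨by linarith, by linarith, by linarith, by linarith, by linarith⟩

end Complexity

end SSGD

/-! ### Choice of the constants and assembly. -/

theorem theorem1 (L M τ ρ b : ℝ) (hL : 0 < L) (hM : 0 ≤ M) (hτ : 0 ≤ τ) (hρ : 0 ≤ ρ)
    (hb : 0 < b) (hb1 : b < 1) :
    ∃ c₀ : ℝ, 0 < c₀ ∧ ∀ c₁ : ℝ, 0 < c₁ → c₁ ≤ c₀ → ∀ Δ R : ℝ,
      -- the convergence rate
      (∃ C : ℝ, 0 < C ∧
        ∀ μ : ℝ, 0 < μ → μ ≤ L → ∀ σf σg σg1 σg2 : ℝ,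
        ∀ (p q : ℕ) (Ξ : Type u) (Z : Type v) (Ω : Type w) [MeasurableSpace Ξ] [MeasurableSpace Z] [MeasurableSpace Ω]
          (P : SSGD.Problem p q Ξ Z) (Pr : MeasureTheory.Measure Ω)
          (ξ : SSGD.DrawF → Ω → Ξ) (ζ : SSGD.DrawG → Ω → Z)
          (x₀ : SSGD.Vec p) (y₀ v₀ : SSGD.Vec q) (a : SSGD.Params),
          P.Assumptions μ L M τ ρ σf σg σg1 σg2 →
          SSGD.IsSampling P Pr ξ ζ →
          P.InitOK μ M Δ R x₀ y₀ v₀ →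
          a.Admissible μ L b c₁ c₀ →
          Differentiable ℝ P.Φ ∧
          (∀ k : ℕ, MeasureTheory.Integrable (fun ω => ‖gradient P.Φ
            (SSGD.run P a x₀ y₀ v₀ (fun d => ξ d ω) (fun d => ζ d ω) k).x‖ ^ 2) Pr) ∧
          ∀ K : ℕ, 1 ≤ K →
            (1 / (K : ℝ)) * ∑ k ∈ Finset.range K, ∫ ω, ‖gradient P.Φ
                (SSGD.run P a x₀ y₀ v₀ (fun d => ξ d ω) (fun d => ζ d ω) k).x‖ ^ 2 ∂Pr
              ≤ C * ((L / μ) ^ 5 / K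
                + (L / μ) ^ 2 * σf ^ 2 / a.Df
                + (L / μ) ^ 2 * σg1 ^ 2 / a.Dg
                + (L / μ) ^ 8 * σg ^ 2 / a.S
                + (L / μ) ^ 4 * σg2 ^ 2 / a.D)) ∧
      -- the complexity of reaching an `ε`-stationary point
      (∀ σf σg σg1 σg2 : ℝ, ∃ C : ℝ, 0 < C ∧
        ∀ μ : ℝ, 0 < μ → μ ≤ L → ∀ ε : ℝ, 0 < ε → ε ≤ 1 →
        ∃ K Df Dg S D : ℕ, 1 ≤ K ∧ 1 ≤ Df ∧ 1 ≤ Dg ∧ 1 ≤ S ∧ 1 ≤ D ∧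
        ∀ (p q : ℕ) (Ξ : Type u) (Z : Type v) (Ω : Type w) [MeasurableSpace Ξ] [MeasurableSpace Z] [MeasurableSpace Ω]
          (P : SSGD.Problem p q Ξ Z) (Pr : MeasureTheory.Measure Ω)
          (ξ : SSGD.DrawF → Ω → Ξ) (ζ : SSGD.DrawG → Ω → Z)
          (x₀ : SSGD.Vec p) (y₀ v₀ : SSGD.Vec q) (a : SSGD.Params),
          P.Assumptions μ L M τ ρ σf σg σg1 σg2 →
          SSGD.IsSampling P Pr ξ ζ →
          P.InitOK μ M Δ R x₀ y₀ v₀ →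
          a.Admissible μ L b c₁ c₀ →
          a.Df = Df → a.Dg = Dg → a.S = S → a.D = D →
          -- an iterate chosen uniformly at random from the first `K` is `ε`-stationary
          (MeasureTheory.Integrable (fun z : Fin K × Ω => ‖gradient P.Φ
              (SSGD.run P a x₀ y₀ v₀ (fun d => ξ d z.2) (fun d => ζ d z.2) z.1).x‖ ^ 2)
            ((ProbabilityTheory.uniformOn Set.univ).prod Pr) ∧
          ∫ z : Fin K × Ω, ‖gradient P.Φ
              (SSGD.run P a x₀ y₀ v₀ (fun d => ξ d z.2) (fun d => ζ d z.2) z.1).x‖ ^ 2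
            ∂((ProbabilityTheory.uniformOn Set.univ).prod Pr) ≤ ε) ∧
          -- oracle calls made in `K` outer iterations
          ∀ ω : Ω, ∀ s : SSGD.State p q,
            s = SSGD.run P a x₀ y₀ v₀ (fun d => ξ d ω) (fun d => ζ d ω) K →
            (s.nGradF : ℝ) ≤ C * (L / μ) ^ 7 / ε ^ 2 * a.J ∧
            (s.nGradG : ℝ) ≤ C * (L / μ) ^ 13 / ε ^ 2 * a.T ∧
            (s.nJac : ℝ) ≤ C * (L / μ) ^ 7 / ε ^ 2 ∧
            (s.nHess : ℝ) ≤ C * (L / μ) ^ 9 / ε ^ 2 * a.J ∧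
            (s.cost : ℝ) ≤ C * (L / μ) ^ 13 / ε ^ 2 * (max a.T a.J : ℕ)) := by
  have hA := (SSGD.recursionConst_bounds hL hM hτ hρ hb).1
  have hA0 : 0 < SSGD.recursionConst L M τ ρ b := by linarith
  refine ⟨SSGD.stepConst L M τ ρ b, by rw [SSGD.stepConst]; positivity, fun c₁ hc₁ _ Δ R => ?_⟩
  -- Δ is an arbitrary real here, and positivity is saved by |Δ| in the constant.
  have hC : 0 < SSGD.rateConst L M τ ρ b c₁ Δ R := by
    rw [SSGD.rateConst]; positivity
  have hstd : ∀ {μ σf σg σg1 σg2 : ℝ}, 0 < μ → μ ≤ L → ∀ {p q : ℕ} {Ξ : Type u} {Z : Type v}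
      [MeasurableSpace Ξ] [MeasurableSpace Z] {P : SSGD.Problem p q Ξ Z},
      P.Assumptions μ L M τ ρ σf σg σg1 σg2 → P.Standing μ L M τ ρ σf σg σg1 σg2 :=
    fun h1 h2 _ _ _ _ _ _ _ h => ⟨h, h1, h2, hM, hτ, hρ⟩
  refine ⟨⟨SSGD.rateConst L M τ ρ b c₁ Δ R, hC, ?_⟩, fun σf σg σg1 σg2 => ?_⟩
  · intro μ hμ hμL σf σg σg1 σg2 p q Ξ Z Ω _ _ _ P Pr ξ ζ x₀ y₀ v₀ a hP hI h₀ ha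
    exact SSGD.convergence_rate hI (hstd hμ hμL hP) ha hb hb1.le hc₁ h₀
  · obtain ⟨C, hCd⟩ : ∃ C, C = SSGD.rateConst L M τ ρ b c₁ Δ R := ⟨_, rfl⟩
    rw [← hCd] at hC
    -- One constant for all five sizes: V = 1 is used for the number of iterations and a squared
    -- variance bound for each batch.
    obtain ⟨W, hW⟩ : ∃ W, W = 5 * C * (1 + σf ^ 2 + σg1 ^ 2 + σg ^ 2 + σg2 ^ 2) + 2 := ⟨_, rfl⟩
    have hW0 : 0 < W := by rw [hW]; positivity
    refine ⟨5 * W ^ 2, by positivity, fun μ hμ hμL ε hε hε1 => ?_⟩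
    have hκ : 1 ≤ L / μ := (one_le_div hμ).2 hμL
    have hsize : ∀ {V : ℝ} (m : ℕ), 0 ≤ V → V ≤ 1 + σf ^ 2 + σg1 ^ 2 + σg ^ 2 + σg2 ^ 2 →
        C * ((L / μ) ^ m * V / SSGD.sampleSize C (L / μ) ε V m) ≤ ε / 5 ∧
        (SSGD.sampleSize C (L / μ) ε V m : ℝ) ≤ W * ((L / μ) ^ m / ε) := fun {V} m hV hV' => by
      obtain ⟨h1, h2⟩ := SSGD.sampleSize_spec (m := m) hC hκ hε hε1 hV
      refine ⟨h1, h2.trans ?_⟩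
      rw [hW]
      gcongr
    have hf := sq_nonneg σf
    have hg := sq_nonneg σg
    have hg1 := sq_nonneg σg1
    have hg2 := sq_nonneg σg2
    -- The exponents 5, 2, 2, 8, 4 are those of the five terms of the rate, each brought below ε/5.
    obtain ⟨r1, s1⟩ := hsize (V := 1) 5 zero_le_one (by linarith)
    obtain ⟨r2, s2⟩ := hsize 2 hf (by linarith)
    obtain ⟨r3, s3⟩ := hsize 2 hg1 (by linarith)
    obtain ⟨r4, s4⟩ := hsize 8 hg (by linarith)
    obtain ⟨r5, s5⟩ := hsize 4 hg2 (by linarith)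
    have hpos : ∀ (V : ℝ) (m : ℕ), 1 ≤ SSGD.sampleSize C (L / μ) ε V m := fun V m =>
      Nat.le_add_left 1 _
    refine ⟨_, _, _, _, _, hpos 1 5, hpos (σf ^ 2) 2, hpos (σg1 ^ 2) 2, hpos (σg ^ 2) 8,
      hpos (σg2 ^ 2) 4, ?_⟩
    intro p q Ξ Z Ω _ _ _ P Pr ξ ζ x₀ y₀ v₀ a hP hI h₀ ha hDf hDg hS hD
    have := hI.isProbabilityMeasure
    obtain ⟨-, hint, hrate⟩ :=
      SSGD.convergence_rate hI (hstd hμ hμL hP) ha hb hb1.le hc₁ h₀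
    obtain ⟨i1, i2⟩ := SSGD.integral_uniformOn_prod (hpos 1 5) hint
    refine ⟨⟨i1, ?_⟩, fun ω s hs => ?_⟩
    · refine (i2.trans_le (hrate _ (hpos 1 5))).trans ?_
      rw [hDf, hDg, hS, hD, ← hCd]
      rw [mul_one] at r1
      linarith
    · obtain ⟨n1, n2, n3, n4⟩ := SSGD.run_counters P a x₀ y₀ v₀ (fun d => ξ d ω)
        (fun d => ζ d ω) (SSGD.sampleSize C (L / μ) ε 1 5)
      rw [← hs, hDf] at n1
      rw [← hs, hS] at n2
      rw [← hs, hDg] at n3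
      rw [← hs, hD] at n4
      rw [SSGD.State.cost, n1, n2, n3, n4]
      exact SSGD.cost_le hκ hε ha.T_pos ha.J_pos s1 s2 s3 s4 s5
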